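/- **Setting.** A multi-faceted affinity system with $n\ge 1$ members $V=\{1,\dots,n\}$ and $f\ge 1$ facets gives every member $s\in V$ strict rankings $\pi_s^1,\dots,\pi_s^f$ of $V$ (repetitions allowed, so a member may have fewer than $f$ different rankings). Let $\pi_s^i(1:k)$ be the set of the topmost $k$ elements of $\pi_s^i$ (all of $V$ if $k\ge n$). For $\theta>0$, $S\subseteq V$, $\psi:S\to\{1,\dots,f\}$ and $i\in V$ put $$\phi^\theta_{S,\psi}(i)=\bigl|\{s\in S:\ i\in\pi_s^{\psi(s)}(1:\lceil\theta|S|\rceil)\}\bigr|.$$ The pair $(S,\psi)$ is an $(\alpha,\beta,\theta)$-multifaceted community if $\phi^\theta_{S,\psi}(i)\ge\alpha|S|$ for all $i\in S$ and $\phi^\theta_{S,\psi}(j)<\beta|S|$ for all $j\notin S$; the set $S$ is an $f$-faceted $(\alpha,\beta,\theta)$-community if some such $\psi$ exists. Algorithms are randomized programs (assignments, branching, loops) for a unit-cost real random-access machine: natural-number variables and arrays with addition, truncated subtraction and comparison; real variables and arrays with $+,-,\times,\div$ and comparison, and conversion of natural numbers to reals (no rounding of reals to natural numbers, no constants other than natural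 numbers in a program); drawing a uniformly random element of $\{0,\dots,k\}$; and looking up the element at a given position of a given ranking $\pi_s^i$. Each of these operations takes constant time. The input is $n,f,\alpha,\beta,\theta$ and the rankings. **Theorem.** There are a single randomized algorithm and universal constants $K\in\mathbb N$, $C>0$ such that the following holds for all $n,f\ge1$, all reals $0\le\beta<\alpha\le1$ and $\theta>0$, and every multi-faceted affinity system with $n$ members and $f$ facets. Put $\gamma=\alpha-\beta$, $L=\log(16/\gamma)$ and $\theta'=\max(\theta,\alpha)$. 1. On this input the algorithm always halts within $K f n^2$ steps; in particular it runs in $O(n^2)$ time for a bounded number $f$ of facets. 2. For every $f$-faceted $(\alpha,\beta,\theta)$-community $S$, with probability at least $$(fn)^{-C\,\frac{L}{\alpha}}\ \left(\frac{f\,\theta' L}{\alpha}\right)^{-\frac{C}{\gamma^2}\log\left(\frac{\theta' L}{\alpha\gamma}\right)}\ f^{-C\,\frac{\log n}{\gamma^2}}$$ the algorithm outputs exactly $S$ together with a facet assignment $\psi':S\to\{1,\dots,f\}$ such that $(S,\psi')$ is an $(\alpha-\gamma/4,\ \beta+\gamma/4,\ \theta)$-multifaceted community. -/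

import Mathlib

/-! ### Multi-faceted affinity systems and communities -/

/-- A multi-faceted affinity system on the members `Fin n` with `f` facets: every member `s` has
`f` strict rankings `π s 0, …, π s (f - 1)` of all members (repetitions are allowed, so a member
may well have fewer than `f` different rankings). The member which `s` puts at position `p` in its
`i`-th ranking is `π s i p`; positions are counted from `0`, the most preferred one. -/
abbrev MultiAffinity (n f : ℕ) : Type := Fin n → Fin f → Equiv.Perm (Fin n)

/-- `multiVotes π θ S ψ i` is the number of members `s ∈ S` that have `i` among the topmost
`⌈θ |S|⌉` elements of the ranking `ψ s` of `s`. -/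
noncomputable def multiVotes {n f : ℕ} (π : MultiAffinity n f) (θ : ℝ) (S : Finset (Fin n))
    (ψ : {x // x ∈ S} → Fin f) (i : Fin n) : ℕ :=
  (Finset.univ.filter fun s : {x // x ∈ S} =>
    ((π s.1 (ψ s)).symm i).val < ⌈θ * (S.card : ℝ)⌉₊).card

/-- `(S, ψ)` is an `(α, β, θ)`-multifaceted community. -/
def IsMultiCommunity {n f : ℕ} (π : MultiAffinity n f) (α β θ : ℝ) (S : Finset (Fin n))
    (ψ : {x // x ∈ S} → Fin f) : Prop :=
  (∀ i, i ∈ S → α * (S.card : ℝ) ≤ (multiVotes π θ S ψ i : ℝ)) ∧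
  (∀ j, j ∉ S → (multiVotes π θ S ψ j : ℝ) < β * (S.card : ℝ))

/-! ### Randomized programs with a step count

A randomized random-access machine with unit costs, programmed in a small structured language.
The memory consists of natural-number variables and arrays and of real variables and arrays.
Natural numbers can be added, subtracted and compared, they index the arrays, and a uniformly
random one can be drawn; reals can be added, subtracted, multiplied, divided and compared.
There is no rounding of reals to natural numbers, and the only constants in programs are natural
numbers. The input rankings are in a read-only table. Every expression in a program has a
fixed size, so that evaluating it counts as a constant number of elementary operations. -/

namespace RandRAM

/-- Natural-number expressions. -/
inductive NExp : Type
  | const (k : ℕ) : NExp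
  | var (v : ℕ) : NExp
  /-- the entry with the given index of the array number `a` -/
  | arr (a : ℕ) (idx : NExp) : NExp
  | plus (e₁ e₂ : NExp) : NExp
  /-- truncated subtraction -/
  | minus (e₁ e₂ : NExp) : NExp
  /-- the member at position `p` in the `i`-th ranking of member `s` -/
  | query (s i p : NExp) : NExp

/-- Real expressions. -/
inductive RExp : Type
  | cast (e : NExp) : RExp
  | var (v : ℕ) : RExp
  | arr (a : ℕ) (idx : NExp) : RExp
  | plus (e₁ e₂ : RExp) : RExp
  | minus (e₁ e₂ : RExp) : RExp
  | times (e₁ e₂ : RExp) : RExp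
  /-- division, with value `0` if the denominator is `0` -/
  | quot (e₁ e₂ : RExp) : RExp

/-- Tests. -/
inductive BExp : Type
  | nle (e₁ e₂ : NExp) : BExp
  | rle (e₁ e₂ : RExp) : BExp
  | neg (b : BExp) : BExp
  | both (b₁ b₂ : BExp) : BExp

/-- Programs. -/
inductive Prog : Type
  | skip : Prog
  | nset (v : ℕ) (e : NExp) : Prog
  | nstore (a : ℕ) (idx e : NExp) : Prog
  | rset (v : ℕ) (e : RExp) : Prog
  | rstore (a : ℕ) (idx : NExp) (e : RExp) : Prog
  /-- put a uniformly random element of `{0, …, k}` into the variable `v`, `k` the value of `e` -/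
  | draw (v : ℕ) (e : NExp) : Prog
  | seq (c₁ c₂ : Prog) : Prog
  | cond (b : BExp) (c₁ c₂ : Prog) : Prog
  | loop (b : BExp) (c : Prog) : Prog

/-- The memory. -/
structure Mem : Type where
  nvar : ℕ → ℕ
  narr : ℕ → ℕ → ℕ
  rvar : ℕ → ℝ
  rarr : ℕ → ℕ → ℝ

/-- The value of a natural-number expression; `inp` is the read-only input table. -/
def NExp.val (inp : ℕ → ℕ → ℕ → ℕ) (m : Mem) : NExp → ℕ
  | .const k => k
  | .var v => m.nvar v
  | .arr a idx => m.narr a (idx.val inp m)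
  | .plus e₁ e₂ => e₁.val inp m + e₂.val inp m
  | .minus e₁ e₂ => e₁.val inp m - e₂.val inp m
  | .query s i p => inp (s.val inp m) (i.val inp m) (p.val inp m)

/-- The value of a real expression. -/
noncomputable def RExp.val (inp : ℕ → ℕ → ℕ → ℕ) (m : Mem) : RExp → ℝ
  | .cast e => (e.val inp m : ℝ)
  | .var v => m.rvar v
  | .arr a idx => m.rarr a (idx.val inp m)
  | .plus e₁ e₂ => e₁.val inp m + e₂.val inp m
  | .minus e₁ e₂ => e₁.val inp m - e₂.val inp m
  | .times e₁ e₂ => e₁.val inp m * e₂.val inp m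
  | .quot e₁ e₂ => e₁.val inp m / e₂.val inp m

/-- The truth of a test. -/
def BExp.holds (inp : ℕ → ℕ → ℕ → ℕ) (m : Mem) : BExp → Prop
  | .nle e₁ e₂ => e₁.val inp m ≤ e₂.val inp m
  | .rle e₁ e₂ => e₁.val inp m ≤ e₂.val inp m
  | .neg b => ¬ b.holds inp m
  | .both b₁ b₂ => b₁.holds inp m ∧ b₂.holds inp m

/-- A configuration: the programs still to be executed, first one first, and the memory. The
machine has halted when nothing is left to be executed. -/
abbrev Config : Type := List Prog × Mem

open Classical in
/-- One step of the machine. A halted machine stays as it is. -/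
noncomputable def step (inp : ℕ → ℕ → ℕ → ℕ) : Config → PMF Config
  | ([], m) => PMF.pure ([], m)
  | (.skip :: l, m) => PMF.pure (l, m)
  | (.nset v e :: l, m) =>
      PMF.pure (l, { m with nvar := Function.update m.nvar v (e.val inp m) })
  | (.nstore a idx e :: l, m) =>
      PMF.pure (l, { m with
        narr := Function.update m.narr a
          (Function.update (m.narr a) (idx.val inp m) (e.val inp m)) })
  | (.rset v e :: l, m) =>
      PMF.pure (l, { m with rvar := Function.update m.rvar v (e.val inp m) })
  | (.rstore a idx e :: l, m) =>
      PMF.pure (l, { m with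
        rarr := Function.update m.rarr a
          (Function.update (m.rarr a) (idx.val inp m) (e.val inp m)) })
  | (.draw v e :: l, m) =>
      (PMF.uniformOfFintype (Fin (e.val inp m + 1))).map fun k =>
        (l, { m with nvar := Function.update m.nvar v k.val })
  | (.seq c₁ c₂ :: l, m) => PMF.pure (c₁ :: c₂ :: l, m)
  | (.cond b c₁ c₂ :: l, m) =>
      PMF.pure (if b.holds inp m then c₁ :: l else c₂ :: l, m)
  | (.loop b c :: l, m) =>
      PMF.pure (if b.holds inp m then c :: .loop b c :: l else l, m)

/-- The distribution of the configuration after `T` steps. -/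
noncomputable def run (inp : ℕ → ℕ → ℕ → ℕ) : ℕ → Config → PMF Config
  | 0, c => PMF.pure c
  | T + 1, c => (step inp c).bind (run inp T)

/-- The input table of a multi-faceted affinity system (`0` outside the range). -/
def inputTable {n f : ℕ} (π : MultiAffinity n f) (s i p : ℕ) : ℕ :=
  if h : s < n ∧ i < f ∧ p < n then (π ⟨s, h.1⟩ ⟨i, h.2.1⟩ ⟨p, h.2.2⟩).val else 0

/-- The initial memory: the natural-number variables `0` and `1` hold `n` and `f`, the real
variables `0`, `1` and `2` hold `α`, `β` and `θ`, and everything else is `0`. -/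
noncomputable def initMem (n f : ℕ) (α β θ : ℝ) : Mem where
  nvar := fun v => if v = 0 then n else if v = 1 then f else 0
  narr := fun _ _ => 0
  rvar := fun v => if v = 0 then α else if v = 1 then β else if v = 2 then θ else 0
  rarr := fun _ _ => 0

/-- The distribution of the configuration after `T` steps of the program `P` on the input
`n, f, π, α, β, θ`. -/
noncomputable def exec (P : Prog) {n f : ℕ} (π : MultiAffinity n f) (α β θ : ℝ) (T : ℕ) :
    PMF Config :=
  run (inputTable π) T ([P], initMem n f α β θ)

/-- The program has halted and has put out the set `S` (its indicator is in the natural-number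
array `0`) and the facet assignment `ψ` on `S` (in the natural-number array `1`). -/
def Outputs {n f : ℕ} (S : Finset (Fin n)) (ψ : {x // x ∈ S} → Fin f) (c : Config) : Prop :=
  c.1 = [] ∧ (∀ x : Fin n, c.2.narr 0 x.val = if x ∈ S then 1 else 0) ∧
    ∀ x : {x // x ∈ S}, c.2.narr 1 x.1.val = (ψ x).val

end RandRAM

/-- The lower bound for the success probability, with the constant `C` in all the exponents. -/
noncomputable def successBound (C : ℝ) (n f : ℕ) (α β θ : ℝ) : ℝ :=
  let γ := α - β
  let L := Real.log (16 / γ)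
  let θ' := max θ α
  ((f : ℝ) * n) ^ (-(C * (L / α))) *
    ((f : ℝ) * θ' * L / α) ^ (-(C * (1 / γ ^ 2 * Real.log (θ' * L / (α * γ))))) *
    (f : ℝ) ^ (-(C * (Real.log n / γ ^ 2)))

namespace RandRAM

open scoped ENNReal

/-! ### Expected values of programs with a time bound -/

/-! The program is a short chain of lucky guesses, each of which is paid for by a factor of the
claimed probability. Every natural number that depends on the unknown $S$ or would need rounding
(the list depth $l=\min(n,\lceil\theta|S|\rceil)$, sample sizes, vote thresholds) is drawn from
$\{0,\dots,2n\}$. There are 25 such draws, and the cost $(2n+1)^{-25}$ is absorbed into the claimed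
bound, mainly into $(fn)^{-CL/\alpha}$, as $L/\alpha\ge2$.

Fix a witness $\psi$ and put $\gamma=\alpha-\beta$. One subroutine, `ballot`, samples voters with
facets from the current list and replaces the list by the members with enough votes. In the main
case its four calls act as follows. (1) Nobody votes, the threshold is 0, and everybody is elected
(`reach_ballot_trivial`). (2) About $L/\alpha$ voters are drawn from $V$. By averaging, some tuple
of voters in $S$ has top lists that miss at most $\gamma|S|/16$ members of $S$. This tuple is hit
with its facets, and the union $U$ of its top lists has size $O(\theta'L|S|/\alpha)$
(`Supported.cover`). (3) About $\log(\theta'L/(\alpha\gamma))/\gamma^2$ voters are drawn from $U$.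
With luck all of them lie in $S\cap U$ and use $\psi$; by Chernoff and Markov half of such samples
misjudge few members of $U$, so the winners $T$ differ from $S$ in at most $\gamma|S|/8$ members
(`Supported.restrict`). (4) $O(\log n/\gamma^2)$ voters are drawn from $T$. Only their facets need
luck, because $T$ is nearly $S$, and half of these samples judge all $n$ members correctly: the
winners are exactly $S$ (`Supported.final_sample`). If a sample size would exceed $n$, or if
$\alpha|S|\le2$, direct guesses replace these steps.

There remain the facets of the members of $S$. If $|S|=O(\log n/\gamma^2)$, all of them are guessed.
Otherwise every member $i$ of $V$ is a constraint: the sum over $s\in S$ of the gains of $s$ for $i$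
must exceed $-\gamma|S|/4$. Constraints carry multiplicative weights, the members of $S$ come in
uniformly random order, and each one takes the facet of largest weighted gain, found in $O(fn)$
time. This is at least as good as following $\psi$. Since the order is random, the mean gain of
$\psi$ over the remaining set $R$ is with good probability at least
$-\frac{\gamma}{16}\sqrt{|S|/|R|}$ for all constraints at all times, and these errors sum to at most
$\gamma|S|/8$. The potential `RandomOrder.pot` combines the scaled weights with exponential moments
of the deviations. It does not grow on average while it is below 1 (`RandomOrder.sum_pot_le`),
starts at no more than $1/2$, and a final value below 1 gives all constraints. So this phase
succeeds with probability at least $1/2$.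

The machine is handled by a calculus of lower bounds for expectations under a time limit (`Tri`,
`Reach`, `Det`). Used with lucky draws it bounds the success probability; used with all draws and
probability 1 it proves that the program halts in time. -/

@[ext]
theorem Mem.ext {m m' : Mem} (h₁ : m.nvar = m'.nvar) (h₂ : m.narr = m'.narr)
    (h₃ : m.rvar = m'.rvar) (h₄ : m.rarr = m'.rarr) : m = m' := by
  cases m; cases m'; simp_all

/-- Set a natural-number variable. -/
def Mem.setN (m : Mem) (v x : ℕ) : Mem := { m with nvar := Function.update m.nvar v x }

/-- Replace a natural-number array. -/
def Mem.setA (m : Mem) (a : ℕ) (g : ℕ → ℕ) : Mem := { m with narr := Function.update m.narr a g }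

/-- Set a real variable. -/
def Mem.setR (m : Mem) (v : ℕ) (x : ℝ) : Mem := { m with rvar := Function.update m.rvar v x }

/-- Replace a real array. -/
def Mem.setRA (m : Mem) (a : ℕ) (g : ℕ → ℝ) : Mem := { m with rarr := Function.update m.rarr a g }

section proj
variable (m : Mem)
@[simp] theorem Mem.nvar_setN (v x w : ℕ) :
    (m.setN v x).nvar w = if w = v then x else m.nvar w := by
  simp [Mem.setN, Function.update_apply]
@[simp] theorem Mem.narr_setN (v x : ℕ) : (m.setN v x).narr = m.narr := rfl
@[simp] theorem Mem.rvar_setN (v x : ℕ) : (m.setN v x).rvar = m.rvar := rfl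
@[simp] theorem Mem.rarr_setN (v x : ℕ) : (m.setN v x).rarr = m.rarr := rfl
@[simp] theorem Mem.nvar_setA (a : ℕ) (g : ℕ → ℕ) : (m.setA a g).nvar = m.nvar := rfl
@[simp] theorem Mem.narr_setA (a : ℕ) (g : ℕ → ℕ) (b : ℕ) :
    (m.setA a g).narr b = if b = a then g else m.narr b := by
  simp [Mem.setA, Function.update_apply]
@[simp] theorem Mem.rvar_setA (a : ℕ) (g : ℕ → ℕ) : (m.setA a g).rvar = m.rvar := rfl
@[simp] theorem Mem.rarr_setA (a : ℕ) (g : ℕ → ℕ) : (m.setA a g).rarr = m.rarr := rfl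
@[simp] theorem Mem.nvar_setR (v : ℕ) (x : ℝ) : (m.setR v x).nvar = m.nvar := rfl
@[simp] theorem Mem.narr_setR (v : ℕ) (x : ℝ) : (m.setR v x).narr = m.narr := rfl
@[simp] theorem Mem.rvar_setR (v : ℕ) (x : ℝ) (w : ℕ) :
    (m.setR v x).rvar w = if w = v then x else m.rvar w := by
  simp [Mem.setR, Function.update_apply]
@[simp] theorem Mem.rarr_setR (v : ℕ) (x : ℝ) : (m.setR v x).rarr = m.rarr := rfl
@[simp] theorem Mem.nvar_setRA (a : ℕ) (g : ℕ → ℝ) : (m.setRA a g).nvar = m.nvar := rfl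
@[simp] theorem Mem.narr_setRA (a : ℕ) (g : ℕ → ℝ) : (m.setRA a g).narr = m.narr := rfl
@[simp] theorem Mem.rvar_setRA (a : ℕ) (g : ℕ → ℝ) : (m.setRA a g).rvar = m.rvar := rfl
@[simp] theorem Mem.rarr_setRA (a : ℕ) (g : ℕ → ℝ) (b : ℕ) :
    (m.setRA a g).rarr b = if b = a then g else m.rarr b := by
  simp [Mem.setRA, Function.update_apply]
end proj

variable {inp : ℕ → ℕ → ℕ → ℕ}

open Classical in
/-- The expectation of `Q` at the final memory, counting only runs that halt within `T` steps. -/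
noncomputable def value (inp : ℕ → ℕ → ℕ → ℕ) : ℕ → Config → (Mem → ℝ≥0∞) → ℝ≥0∞
  | 0, c, Q => if c.1 = [] then Q c.2 else 0
  | T + 1, c, Q => ∑' c', step inp c c' * value inp T c' Q

open Classical in
theorem value_nil (T : ℕ) (m : Mem) (Q : Mem → ℝ≥0∞) : value inp T ([], m) Q = Q m := by
  induction T with
  | zero => simp [value]
  | succ T ih =>
    rw [value, tsum_eq_single ([], m)]
    · simp [step, ih]
    · intro c hc
      simp [step, PMF.pure_apply, hc]

theorem value_succ_of_step {c c' : Config} (h : step inp c = PMF.pure c') (T : ℕ)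
    (Q : Mem → ℝ≥0∞) : value inp (T + 1) c Q = value inp T c' Q := by
  classical
  rw [value, h, tsum_eq_single c']
  · simp
  · intro c hc
    simp [PMF.pure_apply, hc]

/-- A halted configuration keeps its value, and one that is still running counts as 0 at time 0.
Hence more time never hurts, and all time bounds below can be rounded up freely. -/
theorem value_le_succ (T : ℕ) (c : Config) (Q : Mem → ℝ≥0∞) :
    value inp T c Q ≤ value inp (T + 1) c Q := by
  induction T generalizing c with
  | zero =>
    obtain ⟨l, m⟩ := c
    by_cases h : l = []
    · subst h; rw [value_nil, value_nil]
    · simp [value, h]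
  | succ T ih =>
    rw [value, value]
    exact ENNReal.tsum_le_tsum fun c' => mul_le_mul_right (ih c') _

theorem value_mono {T T' : ℕ} (h : T ≤ T') (c : Config) (Q : Mem → ℝ≥0∞) :
    value inp T c Q ≤ value inp T' c Q :=
  monotone_nat_of_le_succ (f := fun T => value inp T c Q) (fun T => value_le_succ T c Q) h

-- The bridge from the recursive expectation to the distribution `run` of the machine.
open Classical in
theorem value_indicator (T : ℕ) (c : Config) (A : Set Mem) :
    value inp T c (fun m => if m ∈ A then 1 else 0) =
      (run inp T c).toOuterMeasure {c | c.1 = [] ∧ c.2 ∈ A} := by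
  induction T generalizing c with
  | zero =>
    rw [value, run, PMF.toOuterMeasure_pure_apply]
    by_cases h : c.1 = [] <;> simp [h]
  | succ T ih =>
    rw [value, run, PMF.toOuterMeasure_bind_apply]
    simp only [ih]

theorem value_draw (T : ℕ) (v : ℕ) (e : NExp) (l : List Prog) (m : Mem) (Q : Mem → ℝ≥0∞) :
    value inp (T + 1) (.draw v e :: l, m) Q =
      (∑ k ∈ Finset.range (e.val inp m + 1), value inp T (l, m.setN v k) Q) /
        ((e.val inp m : ℝ≥0∞) + 1) := by
  classical
  rw [value]
  have h : ∀ g : Config → ℝ≥0∞, ∑' c', step inp (.draw v e :: l, m) c' * g c' =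
      ∑' k : Fin (e.val inp m + 1), PMF.uniformOfFintype (Fin (e.val inp m + 1)) k *
        g (l, m.setN v k) := by
    intro g
    simp only [step, PMF.map_apply, ← ENNReal.tsum_mul_right]
    rw [ENNReal.tsum_comm]
    refine tsum_congr fun k => ?_
    rw [tsum_eq_single (l, m.setN v k)]
    · simp [Mem.setN]
    · intro c hc
      rw [if_neg, zero_mul]
      exact hc
  rw [h, tsum_fintype]
  simp only [PMF.uniformOfFintype_apply, Fintype.card_fin]
  rw [← Finset.mul_sum, Finset.sum_range, div_eq_mul_inv, mul_comm]
  push_cast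
  rfl

/-- Started in `m`, the program halts within `T` steps, in a memory in which `Q` has an expectation
of at least `x` (only halting runs are counted). -/
def Tri (inp : ℕ → ℕ → ℕ → ℕ) (c : Prog) (m : Mem) (T : ℕ) (Q : Mem → ℝ≥0∞) (x : ℝ≥0∞) : Prop :=
  ∀ (l : List Prog) (T' : ℕ) (Q' : Mem → ℝ≥0∞), (∀ m', Q m' ≤ value inp T' (l, m') Q') →
    x ≤ value inp (T + T') (c :: l, m) Q'

theorem Tri.mono {c : Prog} {m : Mem} {T T₁ : ℕ} {Q Q₁ : Mem → ℝ≥0∞} {x x₁ : ℝ≥0∞}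
    (h : Tri inp c m T Q x) (hT : T ≤ T₁) (hQ : ∀ m, Q m ≤ Q₁ m) (hx : x₁ ≤ x) :
    Tri inp c m T₁ Q₁ x₁ := fun l T' Q' h' =>
  hx.trans ((h l T' Q' fun m' => (hQ m').trans (h' m')).trans
    (value_mono (Nat.add_le_add_right hT T') _ _))

theorem Tri.mono_time {c : Prog} {m : Mem} {T T₁ : ℕ} {Q : Mem → ℝ≥0∞} {x : ℝ≥0∞}
    (h : Tri inp c m T Q x) (hT : T ≤ T₁) : Tri inp c m T₁ Q x :=
  h.mono hT (fun _ => le_rfl) le_rfl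

theorem Tri.zero (c : Prog) (m : Mem) (T : ℕ) (Q : Mem → ℝ≥0∞) : Tri inp c m T Q 0 :=
  fun _ _ _ _ => zero_le

theorem Tri.of_step {c : Prog} {m m' : Mem} {Q : Mem → ℝ≥0∞}
    (h : ∀ l, step inp (c :: l, m) = PMF.pure (l, m')) : Tri inp c m 1 Q (Q m') := by
  intro l T' Q' h'
  rw [Nat.add_comm, value_succ_of_step (h l)]
  exact h' m'

theorem Tri.skip {m : Mem} {Q : Mem → ℝ≥0∞} : Tri inp .skip m 1 Q (Q m) :=
  Tri.of_step fun _ => rfl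

theorem Tri.nset {m : Mem} {Q : Mem → ℝ≥0∞} {v : ℕ} {e : NExp} :
    Tri inp (.nset v e) m 1 Q (Q (m.setN v (e.val inp m))) :=
  Tri.of_step fun _ => rfl

theorem Tri.nstore {m : Mem} {Q : Mem → ℝ≥0∞} {a : ℕ} {i e : NExp} :
    Tri inp (.nstore a i e) m 1 Q
      (Q (m.setA a (Function.update (m.narr a) (i.val inp m) (e.val inp m)))) :=
  Tri.of_step fun _ => rfl

theorem Tri.rset {m : Mem} {Q : Mem → ℝ≥0∞} {v : ℕ} {e : RExp} :
    Tri inp (.rset v e) m 1 Q (Q (m.setR v (e.val inp m))) :=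
  Tri.of_step fun _ => rfl

theorem Tri.rstore {m : Mem} {Q : Mem → ℝ≥0∞} {a : ℕ} {i : NExp} {e : RExp} :
    Tri inp (.rstore a i e) m 1 Q
      (Q (m.setRA a (Function.update (m.rarr a) (i.val inp m) (e.val inp m)))) :=
  Tri.of_step fun _ => rfl

theorem Tri.draw {m : Mem} {Q : Mem → ℝ≥0∞} {v : ℕ} {e : NExp} :
    Tri inp (.draw v e) m 1 Q
      ((∑ k ∈ Finset.range (e.val inp m + 1), Q (m.setN v k)) / ((e.val inp m : ℝ≥0∞) + 1)) := by
  intro l T' Q' h'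
  rw [Nat.add_comm 1 T', value_draw]
  gcongr
  exact h' _

/-- `Tri` quantifies over the remaining stack, so the first triple can be used with `c₂` on top of
the stack. One extra step unfolds the `seq`. -/
theorem Tri.seq {c₁ c₂ : Prog} {m : Mem} {T₁ T₂ : ℕ} {Q₁ Q : Mem → ℝ≥0∞} {x : ℝ≥0∞}
    (h₁ : Tri inp c₁ m T₁ Q₁ x) (h₂ : ∀ m', Tri inp c₂ m' T₂ Q (Q₁ m')) :
    Tri inp (.seq c₁ c₂) m (T₁ + T₂ + 1) Q x := by
  intro l T' Q' h'
  rw [show T₁ + T₂ + 1 + T' = T₁ + (T₂ + T') + 1 by ring,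
    value_succ_of_step (c' := (c₁ :: c₂ :: l, m)) rfl]
  exact h₁ (c₂ :: l) (T₂ + T') Q' fun m' => h₂ m' l T' Q' h'

theorem Tri.cond_true {b : BExp} {c₁ c₂ : Prog} {m : Mem} {T : ℕ} {Q : Mem → ℝ≥0∞} {x : ℝ≥0∞}
    (hb : b.holds inp m) (h : Tri inp c₁ m T Q x) : Tri inp (.cond b c₁ c₂) m (T + 1) Q x := by
  intro l T' Q' h'
  rw [Nat.add_right_comm, value_succ_of_step (c' := (c₁ :: l, m)) (by simp [step, hb])]
  exact h l T' Q' h'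

theorem Tri.cond_false {b : BExp} {c₁ c₂ : Prog} {m : Mem} {T : ℕ} {Q : Mem → ℝ≥0∞} {x : ℝ≥0∞}
    (hb : ¬ b.holds inp m) (h : Tri inp c₂ m T Q x) : Tri inp (.cond b c₁ c₂) m (T + 1) Q x := by
  intro l T' Q' h'
  rw [Nat.add_right_comm, value_succ_of_step (c' := (c₂ :: l, m)) (by simp [step, hb])]
  exact h l T' Q' h'

theorem Tri.loop_done {b : BExp} {c : Prog} {m : Mem} {Q : Mem → ℝ≥0∞}
    (hb : ¬ b.holds inp m) : Tri inp (.loop b c) m 1 Q (Q m) :=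
  Tri.of_step fun _ => by simp [step, hb]

theorem Tri.loop_step {b : BExp} {c : Prog} {m : Mem} {T₁ T₂ : ℕ} {Q₁ Q : Mem → ℝ≥0∞} {x : ℝ≥0∞}
    (hb : b.holds inp m) (h₁ : Tri inp c m T₁ Q₁ x)
    (h₂ : ∀ m', Tri inp (.loop b c) m' T₂ Q (Q₁ m')) :
    Tri inp (.loop b c) m (T₁ + T₂ + 1) Q x := by
  intro l T' Q' h'
  rw [show T₁ + T₂ + 1 + T' = T₁ + (T₂ + T') + 1 by ring,
    value_succ_of_step (c' := (c :: .loop b c :: l, m)) (by simp [step, hb])]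
  exact h₁ (.loop b c :: l) (T₂ + T') Q' fun m' => h₂ m' l T' Q' h'

/-- A loop with a counter `q` and a value function `V`. -/
theorem Tri.loop {b : BExp} {c : Prog} {T N : ℕ} (V : ℕ → Mem → ℝ≥0∞)
    (hstep : ∀ q < N, ∀ m, V q m ≠ 0 → b.holds inp m ∧ Tri inp c m T (V (q + 1)) (V q m))
    (hdone : ∀ m, V N m ≠ 0 → ¬ b.holds inp m) (m : Mem) :
    Tri inp (.loop b c) m (N * (T + 1) + 1) (V N) (V 0 m) := by
  suffices h : ∀ r ≤ N, ∀ m, Tri inp (.loop b c) m (r * (T + 1) + 1) (V N) (V (N - r) m) by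
    simpa using h N le_rfl m
  intro r
  induction r with
  | zero =>
    intro _ m
    rcases eq_or_ne (V N m) 0 with h0 | h0
    · simpa [h0] using Tri.zero _ _ _ _
    · simpa using Tri.loop_done (hdone m h0)
  | succ r ih =>
    intro hr m
    rcases eq_or_ne (V (N - (r + 1)) m) 0 with h0 | h0
    · simpa [h0] using Tri.zero _ _ _ _
    · obtain ⟨hb, h⟩ := hstep (N - (r + 1)) (by omega) m h0
      rw [show N - (r + 1) + 1 = N - r by omega] at h
      exact (Tri.loop_step hb h (ih (by omega))).mono_time (by ring_nf; omega)

/-- From `m` the program reaches, within `T` steps and with probability at least `p`, a final memory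
with the property `P`. -/
def Reach (inp : ℕ → ℕ → ℕ → ℕ) (c : Prog) (m : Mem) (T : ℕ) (p : ℝ≥0∞) (P : Mem → Prop) : Prop :=
  ∀ (Q : Mem → ℝ≥0∞) (x : ℝ≥0∞), (∀ m', P m' → x ≤ Q m') → Tri inp c m T Q (p * x)

theorem Reach.mono {c : Prog} {m : Mem} {T T' : ℕ} {p p' : ℝ≥0∞} {P P' : Mem → Prop}
    (h : Reach inp c m T p P) (hT : T ≤ T') (hp : p' ≤ p) (hP : ∀ m, P m → P' m) :
    Reach inp c m T' p' P' := fun Q x hx =>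
  (h Q x fun m' hm' => hx m' (hP m' hm')).mono hT (fun _ => le_rfl) (mul_le_mul_left hp x)

theorem Reach.seq {c₁ c₂ : Prog} {m : Mem} {T₁ T₂ : ℕ} {p₁ p₂ : ℝ≥0∞} {P₁ P : Mem → Prop}
    (h₁ : Reach inp c₁ m T₁ p₁ P₁) (h₂ : ∀ m', P₁ m' → Reach inp c₂ m' T₂ p₂ P) :
    Reach inp (.seq c₁ c₂) m (T₁ + T₂ + 1) (p₁ * p₂) P := by
  classical
  intro Q x hx
  rw [mul_assoc]
  -- Outside `P₁` nothing is claimed, so the intermediate expectation is 0 there.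
  refine Tri.seq (Q₁ := fun m' => if P₁ m' then p₂ * x else 0)
    (h₁ _ _ fun m' hm' => by simp [hm']) fun m' => ?_
  by_cases hm' : P₁ m'
  · simpa [hm'] using h₂ m' hm' Q x hx
  · simpa [hm'] using Tri.zero _ _ _ _

/-- The lucky version: of the average over all draws only the summand of the wanted value is kept.
-/
theorem Reach.draw {v : ℕ} {e : NExp} {m : Mem} {a : ℕ} (ha : a ≤ e.val inp m) :
    Reach inp (.draw v e) m 1 ((e.val inp m : ℝ≥0∞) + 1)⁻¹ (fun m' => m' = m.setN v a) := by
  intro Q x hx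
  refine Tri.draw.mono le_rfl (fun _ => le_rfl) ?_
  rw [ENNReal.div_eq_inv_mul]
  gcongr
  exact (hx _ rfl).trans (Finset.single_le_sum (f := fun k => Q (m.setN v k))
    (fun _ _ => zero_le) (Finset.mem_range.2 (Nat.lt_succ_of_le ha)))

/-- Demonic version of the rule for random draws. -/
theorem Reach.draw_all {v : ℕ} {e : NExp} {m : Mem} :
    Reach inp (.draw v e) m 1 1 (fun m' => ∃ a ≤ e.val inp m, m' = m.setN v a) := by
  intro Q x hx
  refine Tri.draw.mono le_rfl (fun _ => le_rfl) ?_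
  rw [one_mul, ENNReal.le_div_iff_mul_le (by simp) (by simp)]
  calc x * ((e.val inp m : ℝ≥0∞) + 1)
      = ∑ _k ∈ Finset.range (e.val inp m + 1), x := by simp [mul_comm]
    _ ≤ _ := Finset.sum_le_sum fun k hk =>
        hx _ ⟨k, Nat.lt_succ_iff.1 (Finset.mem_range.1 hk), rfl⟩

/-- The program is deterministic on `m`, with result `m'`. -/
def Det (inp : ℕ → ℕ → ℕ → ℕ) (c : Prog) (m : Mem) (T : ℕ) (m' : Mem) : Prop :=
  ∀ Q : Mem → ℝ≥0∞, Tri inp c m T Q (Q m')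

theorem Det.mono {c : Prog} {m m' m'' : Mem} {T T' : ℕ} (h : Det inp c m T m') (hT : T ≤ T')
    (hm : m' = m'') : Det inp c m T' m'' := fun Q => hm ▸ (h Q).mono_time hT

theorem Det.reach {c : Prog} {m m' : Mem} {T : ℕ} (h : Det inp c m T m') :
    Reach inp c m T 1 (fun m'' => m'' = m') := fun Q x hx =>
  (h Q).mono le_rfl (fun _ => le_rfl) (by simpa using hx _ rfl)

theorem Det.skip {m : Mem} : Det inp .skip m 1 m := fun _ => Tri.skip

theorem Det.nset {m : Mem} {v : ℕ} {e : NExp} :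
    Det inp (.nset v e) m 1 (m.setN v (e.val inp m)) := fun _ => Tri.nset

theorem Det.nstore {m : Mem} {a : ℕ} {i e : NExp} :
    Det inp (.nstore a i e) m 1
      (m.setA a (Function.update (m.narr a) (i.val inp m) (e.val inp m))) := fun _ => Tri.nstore

theorem Det.rset {m : Mem} {v : ℕ} {e : RExp} :
    Det inp (.rset v e) m 1 (m.setR v (e.val inp m)) := fun _ => Tri.rset

theorem Det.rstore {m : Mem} {a : ℕ} {i : NExp} {e : RExp} :
    Det inp (.rstore a i e) m 1
      (m.setRA a (Function.update (m.rarr a) (i.val inp m) (e.val inp m))) := fun _ => Tri.rstore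

theorem Det.seq_tri {c₁ c₂ : Prog} {m m₁ : Mem} {T₁ T₂ : ℕ} {Q : Mem → ℝ≥0∞} {x : ℝ≥0∞}
    (h₁ : Det inp c₁ m T₁ m₁) (h₂ : Tri inp c₂ m₁ T₂ Q x) :
    Tri inp (.seq c₁ c₂) m (T₁ + T₂ + 1) Q x := by
  classical
  refine Tri.seq (Q₁ := fun m' => if m' = m₁ then x else 0)
    ((h₁ _).mono le_rfl (fun _ => le_rfl) (by simp)) fun m' => ?_
  by_cases hm' : m' = m₁
  · subst hm'; simpa using h₂
  · simpa [hm'] using Tri.zero _ _ _ _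

theorem Det.seq {c₁ c₂ : Prog} {m m₁ m₂ : Mem} {T₁ T₂ : ℕ}
    (h₁ : Det inp c₁ m T₁ m₁) (h₂ : Det inp c₂ m₁ T₂ m₂) :
    Det inp (.seq c₁ c₂) m (T₁ + T₂ + 1) m₂ := fun Q => h₁.seq_tri (h₂ Q)

theorem Det.seq_reach {c₁ c₂ : Prog} {m m₁ : Mem} {T₁ T₂ : ℕ} {p : ℝ≥0∞} {P : Mem → Prop}
    (h₁ : Det inp c₁ m T₁ m₁) (h₂ : Reach inp c₂ m₁ T₂ p P) :
    Reach inp (.seq c₁ c₂) m (T₁ + T₂ + 1) p P := fun Q x hx => h₁.seq_tri (h₂ Q x hx)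

theorem Det.cond {b : BExp} {c₁ c₂ : Prog} {m m' : Mem} {T : ℕ}
    (h₁ : b.holds inp m → Det inp c₁ m T m') (h₂ : ¬ b.holds inp m → Det inp c₂ m T m') :
    Det inp (.cond b c₁ c₂) m (T + 1) m' := by
  intro Q
  by_cases h : b.holds inp m
  · exact Tri.cond_true h (h₁ h Q)
  · exact Tri.cond_false h (h₂ h Q)

/-- A deterministic loop, `M q` being the memory after `q` rounds. -/
theorem Det.loop {b : BExp} {c : Prog} {T N : ℕ} (M : ℕ → Mem)
    (hstep : ∀ q < N, b.holds inp (M q) ∧ Det inp c (M q) T (M (q + 1)))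
    (hdone : ¬ b.holds inp (M N)) :
    Det inp (.loop b c) (M 0) (N * (T + 1) + 1) (M N) := by
  classical
  intro Q
  refine (Tri.loop (V := fun q m => if m = M q then Q (M N) else 0) (N := N) (T := T) ?_ ?_
    (M 0)).mono le_rfl (fun m => ?_) (by simp)
  · intro q hq m hm
    have hm' : m = M q := by by_contra h; simp [h] at hm
    subst hm'
    exact ⟨(hstep q hq).1, ((hstep q hq).2 _).mono le_rfl (fun _ => le_rfl) (by simp)⟩
  · intro m hm
    have hm' : m = M N := by by_contra h; simp [h] at hm
    rwa [hm']
  · split_ifs with h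
    · rw [h]
    · exact zero_le

/-- A loop with an invariant that holds with certainty. -/
theorem Reach.loop {b : BExp} {c : Prog} {T N : ℕ} (I : ℕ → Mem → Prop)
    (hstep : ∀ q < N, ∀ m, I q m → b.holds inp m ∧ Reach inp c m T 1 (I (q + 1)))
    (hdone : ∀ m, I N m → ¬ b.holds inp m) {m : Mem} (hm : I 0 m) :
    Reach inp (.loop b c) m (N * (T + 1) + 1) 1 (I N) := by
  classical
  intro Q x hx
  refine (Tri.loop (V := fun q m => if I q m then x else 0) (N := N) (T := T) ?_ ?_
    m).mono le_rfl (fun m => ?_) (by simp [hm])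
  · intro q hq m hm
    have hm' : I q m := by by_contra h; simp [h] at hm
    refine ⟨(hstep q hq m hm').1, ((hstep q hq m hm').2 _ x fun m' h' => ?_).mono le_rfl
      (fun _ => le_rfl) (by simp [hm'])⟩
    simp [h']
  · intro m hm
    exact hdone m (by by_contra h; simp [h] at hm)
  · split_ifs with h
    · exact hx m h
    · exact zero_le

theorem Reach.le_run {c : Prog} {m : Mem} {T : ℕ} {p : ℝ≥0∞} {P : Mem → Prop}
    (h : Reach inp c m T p P) :
    p ≤ (run inp T ([c], m)).toOuterMeasure {c | c.1 = [] ∧ P c.2} := by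
  classical
  have := h (fun m => if P m then 1 else 0) 1 (fun m' h' => by simp [h']) [] 0
    (fun m => if P m then 1 else 0) (fun m' => by rw [value_nil])
  rw [mul_one, Nat.add_zero] at this
  exact this.trans_eq (value_indicator T _ {m | P m})

/-- A lower bound of 1 for the event of having halted leaves no mass for other configurations. -/
theorem Reach.halts {c : Prog} {m : Mem} {T : ℕ} {P : Mem → Prop}
    (h : Reach inp c m T 1 P) : ∀ c' ∈ (run inp T ([c], m)).support, c'.1 = [] := by
  have h1 := le_antisymm ((PMF.toOuterMeasure_mono _ (by simp)).trans_eq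
    ((PMF.toOuterMeasure_apply_eq_one_iff _ Set.univ).2 (Set.subset_univ _))) h.le_run
  rw [PMF.toOuterMeasure_apply_eq_one_iff] at h1
  exact fun c' hc' => (h1 hc').1

end RandRAM

namespace RandRAM

open scoped ENNReal

variable {inp : ℕ → ℕ → ℕ → ℕ}

/-! ### The program -/

/-- `for v < w do c`, where `v` and `w` are variables. -/
def upTo (v w : ℕ) (c : Prog) : Prog :=
  .seq (.nset v (.const 0))
    (.loop (.nle (.plus (.var v) (.const 1)) (.var w))
      (.seq c (.nset v (.plus (.var v) (.const 1)))))

/-- The member at position `nvar 15` of the ranking number `nvar j` of member `nvar 16`. -/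
def ranked (j : ℕ) : NExp := .query (.var 16) (.var j) (.var 15)

/-- Give every member an initial number of votes: `nvar 8` in the current list, `0` outside. -/
def initVotes : Prog :=
  upTo 17 0 (.cond (.nle (.const 1) (.arr 0 (.var 17)))
    (.nstore 3 (.var 17) (.var 8)) (.nstore 3 (.var 17) (.const 0)))

/-- A vote for each of the topmost members of a ranking. -/
def castVotes : Prog :=
  upTo 15 2 (.nstore 3 (ranked 14) (.plus (.arr 3 (ranked 14)) (.const 1)))

/-- Sample one voter and let it vote. -/
def sampleVoter : Prog :=
  .seq (.draw 12 (.var 5)) <| .seq (.draw 13 (.var 7)) <|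
  .seq (.draw 14 (.minus (.var 1) (.const 1))) <|
  .seq (.nset 16 (.arr 2 (.plus (.var 11) (.var 12)))) <|
  .seq (.cond (.nle (.var 13) (.const 0)) castVotes .skip) <|
  .nset 11 (.plus (.var 11) (.var 6))

/-- Make a list of the members with at least `nvar 9` votes. -/
def collect : Prog :=
  .seq (.nset 3 (.const 0)) <|
  upTo 17 0 (.cond (.nle (.var 9) (.arr 3 (.var 17)))
    (.seq (.nstore 0 (.var 17) (.const 1)) <| .seq (.nstore 2 (.var 3) (.var 17)) <|
      .nset 3 (.plus (.var 3) (.const 1)))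
    (.nstore 0 (.var 17) (.const 0)))

/-- Guess a number between `0` and `2 n`. -/
def guess (v : ℕ) : Prog := .draw v (.plus (.var 0) (.var 0))

/-- The part of a ballot after its parameters have been guessed. -/
def ballotCore : Prog :=
  .seq initVotes <| .seq (.nset 11 (.const 0)) <| .seq (upTo 10 4 sampleVoter) collect

/-- A ballot: sample voters from the current list, and pass to the list of the winners. -/
def ballot : Prog :=
  .seq (guess 4) <| .seq (guess 5) <| .seq (guess 6) <| .seq (guess 7) <| .seq (guess 8) <|
  .seq (guess 9) ballotCore

/-- The total weight of the topmost members of a ranking. -/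
def totalWeight : Prog :=
  .seq (.rset 4 (.cast (.const 0))) <|
  upTo 15 2 (.rset 4 (.plus (.var 4) (.arr 0 (ranked 14))))

/-- Choose the best of the first `nvar 18` rankings, if there are any. -/
def chooseBest : Prog :=
  upTo 14 18 (.seq totalWeight
    (.cond (.neg (.both (.nle (.const 1) (.var 14)) (.neg (.rle (.var 5) (.var 4)))))
      (.seq (.nset 19 (.var 14)) (.rset 5 (.var 4))) .skip))

/-- Mark the topmost members of the chosen ranking. -/
def markTop : Prog := upTo 15 2 (.nstore 4 (ranked 19) (.const 1))

/-- Update the weights, and remove the marks. -/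
def reweight : Prog :=
  upTo 17 0 (.seq
    (.rstore 0 (.var 17) (.times (.arr 0 (.var 17)) (.minus (.cast (.const 1))
      (.times (.arr 1 (.var 17)) (.minus (.cast (.arr 4 (.var 17))) (.arr 2 (.var 17)))))))
    (.nstore 4 (.var 17) (.const 0)))

/-- Remove the member at position `nvar 12` from the list and put it into the variable `16`. -/
def extract : Prog :=
  .seq (.nset 16 (.arr 2 (.var 12))) <| .seq (.nset 3 (.minus (.var 3) (.const 1))) <|
  .nstore 2 (.var 12) (.arr 2 (.var 3))

/-- Choose a facet for one member, after the draws. -/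
def assignCore : Prog :=
  .seq extract <| .seq chooseBest <| .seq (.nstore 1 (.var 16) (.var 19)) <| .seq markTop reweight

/-- Choose a facet for one member. -/
def assignOne : Prog :=
  .seq (.draw 12 (.minus (.var 3) (.const 1))) <|
  .seq (.draw 19 (.minus (.var 1) (.const 1))) assignCore

/-- Initialize the weights. -/
def initWeights : Prog :=
  .seq (.rset 3 (.quot (.minus (.var 0) (.var 1)) (.cast (.const 32)))) <|
  upTo 17 0 (.cond (.nle (.const 1) (.arr 0 (.var 17)))
    (.seq (.rstore 0 (.var 17) (.cast (.const 1))) <| .seq (.rstore 1 (.var 17) (.var 3)) <|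
      .rstore 2 (.var 17) (.var 0))
    (.seq (.rstore 0 (.var 17) (.minus (.cast (.const 0)) (.cast (.const 1)))) <|
      .seq (.rstore 1 (.var 17) (.minus (.cast (.const 0)) (.var 3))) <|
      .rstore 2 (.var 17) (.var 1)))

/-- Choose a facet for each member of the list. -/
def assignAll : Prog :=
  .seq (.draw 18 (.var 1)) <| .seq initWeights <| .loop (.nle (.const 1) (.var 3)) assignOne

/-- The whole program. -/
def communityProg : Prog :=
  .seq (guess 2) <| .seq ballot <| .seq ballot <| .seq ballot <| .seq ballot assignAll

/-! ### The deterministic parts -/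

section commute
variable (m : Mem)
theorem Mem.setA_setN (v x a : ℕ) (g : ℕ → ℕ) : (m.setN v x).setA a g = (m.setA a g).setN v x := rfl
theorem Mem.setR_setN (v x a : ℕ) (r : ℝ) : (m.setN v x).setR a r = (m.setR a r).setN v x := rfl
@[simp] theorem Mem.setN_setN_same (v x y : ℕ) : (m.setN v x).setN v y = m.setN v y := by
  simp [Mem.setN]
@[simp] theorem Mem.setA_setA_same (v : ℕ) (x y : ℕ → ℕ) :
    (m.setA v x).setA v y = m.setA v y := by
  simp [Mem.setA]
@[simp] theorem Mem.setR_setR_same (v : ℕ) (x y : ℝ) :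
    (m.setR v x).setR v y = m.setR v y := by
  simp [Mem.setR]
@[simp] theorem Mem.setA_self (a : ℕ) : m.setA a (m.narr a) = m := by
  simp [Mem.setA]
@[simp] theorem Mem.setN_self (v : ℕ) : m.setN v (m.nvar v) = m := by
  simp [Mem.setN]
@[simp] theorem Mem.setR_self (v : ℕ) : m.setR v (m.rvar v) = m := by
  simp [Mem.setR]
@[simp] theorem Mem.setRA_self (v : ℕ) : m.setRA v (m.rarr v) = m := by
  simp [Mem.setRA]
end commute

/-- `G q` describes the memory after `q` rounds up to the counter `v`, which is set on top of it; so
the counter need not be tracked in `G`. -/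
theorem Det.upTo {v w : ℕ} {c : Prog} {T N : ℕ} {m : Mem} (G : ℕ → Mem) (h0 : G 0 = m)
    (hw : ∀ q, (G q).nvar w = N) (hvw : v ≠ w)
    (hstep : ∀ q < N, Det inp c ((G q).setN v q) T ((G (q + 1)).setN v q)) :
    Det inp (upTo v w c) m (N * (T + 3) + 3) ((G N).setN v N) := by
  have h := Det.loop (inp := inp) (b := .nle (.plus (.var v) (.const 1)) (.var w))
    (c := .seq c (.nset v (.plus (.var v) (.const 1)))) (T := T + 2) (N := N)
    (fun q => (G q).setN v q) ?_ ?_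
  · refine (Det.seq Det.nset (m₁ := m.setN v 0) (h0 ▸ h)).mono (by ring_nf; omega) rfl
  · intro q hq
    refine ⟨?_, ((hstep q hq).seq Det.nset).mono (by omega) ?_⟩
    · simp [BExp.holds, NExp.val, hvw.symm, hw]; omega
    · simp [NExp.val]
  · simp [BExp.holds, NExp.val, hvw.symm, hw]

theorem det_initVotes (m : Mem) :
    Det inp initVotes m (m.nvar 0 * 5 + 3)
      ((m.setA 3 (fun i => if i < m.nvar 0 then (if 1 ≤ m.narr 0 i then m.nvar 8 else 0)
        else m.narr 3 i)).setN 17 (m.nvar 0)) := by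
  refine Det.upTo (T := 2)
    (fun q => m.setA 3 (fun i => if i < q then (if 1 ≤ m.narr 0 i then m.nvar 8 else 0)
        else m.narr 3 i)) ?_ ?_ (by decide) ?_
  · simp
  · simp
  · intro q hq
    refine Det.cond (fun hb => Det.nstore.mono le_rfl ?_) (fun hb => Det.nstore.mono le_rfl ?_) <;>
    · simp [BExp.holds, NExp.val] at hb
      simp only [NExp.val, Mem.setA_setN, Mem.setA_setA_same]
      congr 2
      funext i
      rcases eq_or_ne i q with rfl | hi
      · simp [hb]
      · have : i < q + 1 ↔ i < q := by omega
        simp [Function.update_of_ne hi, this]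

/-- How often a member occurs among the topmost `l` positions of a ranking. -/
def tally (inp : ℕ → ℕ → ℕ → ℕ) (l s j i : ℕ) : ℕ :=
  ((Finset.range l).filter fun p => inp s j p = i).card

theorem tally_succ (l s j i : ℕ) :
    tally inp (l + 1) s j i = tally inp l s j i + if inp s j l = i then 1 else 0 := by
  unfold tally
  rw [Finset.range_add_one, Finset.filter_insert]
  split_ifs <;> simp

theorem det_castVotes (m : Mem) :
    Det inp castVotes m (m.nvar 2 * 4 + 3)
      ((m.setA 3 (fun i => m.narr 3 i + tally inp (m.nvar 2) (m.nvar 16) (m.nvar 14) i)).setN 15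
        (m.nvar 2)) := by
  refine Det.upTo (T := 1)
    (fun q => m.setA 3 (fun i => m.narr 3 i + tally inp q (m.nvar 16) (m.nvar 14) i)) ?_ ?_
      (by decide) ?_
  · simp [tally]
  · simp
  · intro q hq
    refine Det.nstore.mono le_rfl ?_
    simp only [NExp.val, ranked, Mem.setA_setN, Mem.setA_setA_same]
    congr 2
    funext i
    simp only [tally_succ]
    rcases eq_or_ne i (inp (m.nvar 16) (m.nvar 14) q) with rfl | hi
    · simp [add_assoc]
    · simp [Function.update_of_ne hi, hi.symm]

/-- The list of the numbers `i < q` with `P i`, and its length. -/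
def listing (P : ℕ → Prop) [DecidablePred P] (L : ℕ → ℕ) : ℕ → (ℕ → ℕ) × ℕ
  | 0 => (L, 0)
  | q + 1 => if P q then
      (Function.update (listing P L q).1 (listing P L q).2 q, (listing P L q).2 + 1)
    else listing P L q

theorem listing_le (P : ℕ → Prop) [DecidablePred P] (L : ℕ → ℕ) (q : ℕ) :
    (listing P L q).2 ≤ q := by
  induction q with
  | zero => simp [listing]
  | succ q ih => rw [listing]; split_ifs <;> grind

theorem listing_card (P : ℕ → Prop) [DecidablePred P] (L : ℕ → ℕ) (q : ℕ) :
    (listing P L q).2 = ((Finset.range q).filter P).card := by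
  induction q with
  | zero => simp [listing]
  | succ q ih =>
    rw [listing, Finset.range_add_one, Finset.filter_insert]
    split_ifs <;> simp [ih]

theorem listing_mem (P : ℕ → Prop) [DecidablePred P] (L : ℕ → ℕ) (q : ℕ) :
    ∀ r < (listing P L q).2, (listing P L q).1 r < q ∧ P ((listing P L q).1 r) := by
  induction q with
  | zero => simp [listing]
  | succ q ih =>
    rw [listing]
    split_ifs with h
    · intro r hr
      rcases eq_or_ne r (listing P L q).2 with rfl | hne
      · simpa using h
      · have := ih r (by simp at hr; omega)
        simp only [Function.update_of_ne hne]
        exact ⟨by omega, this.2⟩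
    · exact fun r hr => ⟨(ih r hr).1.trans (by omega), (ih r hr).2⟩

theorem listing_surj (P : ℕ → Prop) [DecidablePred P] (L : ℕ → ℕ) (q : ℕ) :
    ∀ i < q, P i → ∃ r < (listing P L q).2, (listing P L q).1 r = i := by
  induction q with
  | zero => simp
  | succ q ih =>
    intro i hi hP
    rw [listing]
    rcases eq_or_ne i q with rfl | hne
    · simp only [hP, if_true]
      exact ⟨_, Nat.lt_succ_self _, by simp⟩
    · obtain ⟨r, hr, h⟩ := ih i (by omega) hP
      split_ifs
      · exact ⟨r, Nat.lt_succ_of_lt hr, by simp [Function.update_of_ne hr.ne, h]⟩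
      · exact ⟨r, hr, h⟩

theorem det_collect (m : Mem) :
    Det inp collect m (m.nvar 0 * 9 + 5)
      ((((m.setA 0 (fun i => if i < m.nvar 0 then (if m.nvar 9 ≤ m.narr 3 i then 1 else 0)
          else m.narr 0 i)).setA 2
          (listing (fun i => m.nvar 9 ≤ m.narr 3 i) (m.narr 2) (m.nvar 0)).1).setN 3
          (listing (fun i => m.nvar 9 ≤ m.narr 3 i) (m.narr 2) (m.nvar 0)).2).setN 17
          (m.nvar 0)) := by
  refine (Det.nset.seq (Det.upTo (T := 6)
    (fun q => ((m.setA 0 (fun i => if i < q then (if m.nvar 9 ≤ m.narr 3 i then 1 else 0)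
          else m.narr 0 i)).setA 2
          (listing (fun i => m.nvar 9 ≤ m.narr 3 i) (m.narr 2) q).1).setN 3
          (listing (fun i => m.nvar 9 ≤ m.narr 3 i) (m.narr 2) q).2) ?_ (N := m.nvar 0) ?_
      (by decide) ?_)).mono (by omega) rfl
  · simp [listing, NExp.val]
  · simp
  · intro q hq
    refine Det.cond (T := 5) (fun hb => ?_) (fun hb => ?_)
    · simp [BExp.holds, NExp.val] at hb
      refine (Det.nstore.seq (Det.nstore.seq Det.nset)).mono (by omega) ?_
      apply Mem.ext
      · funext w; simp [NExp.val, listing, hb]; grind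
      · funext a; simp [NExp.val, listing, hb]
        split_ifs with h1 h2
        · rfl
        · funext i
          rcases eq_or_ne i q with rfl | hi
          · simp [hb]
          · have : i ≤ q ↔ i < q := by omega
            simp [Function.update_of_ne hi, this]
        · rfl
      · rfl
      · rfl
    · simp [BExp.holds, NExp.val] at hb
      refine Det.nstore.mono (by omega) ?_
      have hb' : ¬ m.nvar 9 ≤ m.narr 3 q := by omega
      apply Mem.ext
      · funext w; simp [listing, hb']
      · funext a; simp [NExp.val, listing, hb']
        split_ifs with h1 h2
        · simp at *; omega
        · funext i
          rcases eq_or_ne i q with rfl | hi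
          · simp [hb']
          · have : i ≤ q ↔ i < q := by omega
            simp [Function.update_of_ne hi, this]
        · rfl
        · rfl
      · rfl
      · rfl

/-- The total weight of the topmost `l` members of a ranking. -/
def score (inp : ℕ → ℕ → ℕ → ℕ) (u : ℕ → ℝ) (l s j : ℕ) : ℝ :=
  ∑ p ∈ Finset.range l, u (inp s j p)

theorem det_totalWeight (m : Mem) :
    Det inp totalWeight m (m.nvar 2 * 4 + 5)
      ((m.setR 4 (score inp (m.rarr 0) (m.nvar 2) (m.nvar 16) (m.nvar 14))).setN 15
        (m.nvar 2)) := by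
  refine (Det.rset.seq (Det.upTo (T := 1)
    (fun q => m.setR 4 (score inp (m.rarr 0) q (m.nvar 16) (m.nvar 14))) ?_ (N := m.nvar 2) ?_
      (by decide) ?_)).mono (by omega) rfl
  · simp [score, RExp.val, NExp.val]
  · simp
  · intro q hq
    refine Det.rset.mono le_rfl ?_
    simp only [Mem.setR_setN, Mem.setR_setR_same]
    congr 2
    simp [score, RExp.val, NExp.val, ranked, Finset.sum_range_succ]

open Classical in
/-- The last maximum of a function on `{0, …, q - 1}`, with its value; a given pair if `q = 0`. -/
noncomputable def lastMax (g : ℕ → ℝ) (d : ℕ × ℝ) : ℕ → ℕ × ℝ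
  | 0 => d
  | q + 1 => if q = 0 ∨ (lastMax g d q).2 ≤ g q then (q, g q) else lastMax g d q

theorem lastMax_spec (g : ℕ → ℝ) (d : ℕ × ℝ) (q : ℕ) (hq : 0 < q) :
    (lastMax g d q).1 < q ∧ (lastMax g d q).2 = g (lastMax g d q).1 ∧
      ∀ j < q, g j ≤ g (lastMax g d q).1 := by
  induction q with
  | zero => omega
  | succ q ih =>
    rw [lastMax]
    split_ifs with h
    · refine ⟨by simp, rfl, fun j hj => ?_⟩
      rcases Nat.lt_succ_iff_lt_or_eq.1 hj with hj | rfl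
      · obtain ⟨-, h2, h3⟩ := ih (by omega)
        rcases h with rfl | h
        · omega
        · exact (h3 j hj).trans (h2 ▸ h)
      · rfl
    · push Not at h
      obtain ⟨h1, h2, h3⟩ := ih (by omega)
      refine ⟨h1.trans (by omega), h2, fun j hj => ?_⟩
      rcases Nat.lt_succ_iff_lt_or_eq.1 hj with hj | rfl
      · exact h3 j hj
      · exact h2 ▸ h.2.le

/-- The scratch values are left existential because later results do not depend on them. If variable
18 holds 0, variable 19 keeps its old content: this is how a randomly drawn facet survives. -/
theorem det_chooseBest (m : Mem) :
    ∃ r r' p, Det inp chooseBest m (m.nvar 18 * (m.nvar 2 * 4 + 15) + 3)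
      (((((m.setR 4 r).setR 5 r').setN 15 p).setN 19
        (lastMax (score inp (m.rarr 0) (m.nvar 2) (m.nvar 16))
          (m.nvar 19, m.rvar 5) (m.nvar 18)).1).setN 14 (m.nvar 18)) := by
  set g := score inp (m.rarr 0) (m.nvar 2) (m.nvar 16) with hg
  set d := (m.nvar 19, m.rvar 5) with hd
  refine ⟨_, _, _, Det.mono (Det.upTo (T := m.nvar 2 * 4 + 12)
    (fun q => ((((m.setR 4 (if q = 0 then m.rvar 4 else g (q - 1))).setR 5 (lastMax g d q).2).setN 15
      (if q = 0 then m.nvar 15 else m.nvar 2)).setN 19 (lastMax g d q).1)) ?_ (N := m.nvar 18) ?_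
      (by decide) ?_) (by ring_nf; omega) rfl⟩
  · apply Mem.ext
    · funext w; simp [lastMax, hd]
    · rfl
    · funext w; simp [lastMax, hd]
    · rfl
  · simp
  · intro q hq
    refine Det.mono (T := m.nvar 2 * 4 + 5 + (3 + 1) + 1) ((det_totalWeight _).mono (by simp) rfl
      |>.seq (Det.cond (fun hb => ?_) (fun hb => ?_))) (by omega) rfl
    · simp [BExp.holds, NExp.val, RExp.val] at hb
      refine (Det.nset.seq Det.rset).mono le_rfl ?_
      have hb' : q = 0 ∨ (lastMax g d q).2 ≤ g q := by
        rcases Nat.eq_zero_or_pos q with h | h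
        · exact Or.inl h
        · exact Or.inr (hb h)
      apply Mem.ext
      · funext w; simp [lastMax, NExp.val, hb']; grind
      · rfl
      · funext w; simp [lastMax, NExp.val, RExp.val, hb', ← hg]; grind
      · rfl
    · simp [BExp.holds, NExp.val, RExp.val] at hb
      refine Det.skip.mono (by omega) ?_
      have hb' : ¬ (q = 0 ∨ (lastMax g d q).2 ≤ g q) := by
        push Not
        exact ⟨by omega, hb.2⟩
      apply Mem.ext
      · funext w; simp [lastMax, hb']; grind
      · rfl
      · funext w; simp [lastMax, hb', ← hg]; grind
      · rfl

theorem det_markTop (m : Mem) :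
    Det inp markTop m (m.nvar 2 * 4 + 3)
      ((m.setA 4 (fun i => if ∃ p < m.nvar 2, inp (m.nvar 16) (m.nvar 19) p = i then 1
        else m.narr 4 i)).setN 15 (m.nvar 2)) := by
  classical
  refine (Det.upTo (T := 1) (fun q => m.setA 4
    (fun i => if ∃ p < q, inp (m.nvar 16) (m.nvar 19) p = i then 1
        else m.narr 4 i)) ?_ ?_ (by decide) ?_).mono le_rfl ?_
  · simp
  · simp
  · intro q hq
    refine Det.nstore.mono le_rfl ?_
    simp only [NExp.val, ranked, Mem.setA_setN, Mem.setA_setA_same]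
    congr 2
    funext i
    rcases eq_or_ne i (inp (m.nvar 16) (m.nvar 19) q) with rfl | hi
    · rw [if_pos ⟨q, Nat.lt_succ_self q, rfl⟩]
      simp
    · have : (∃ p ≤ q, inp (m.nvar 16) (m.nvar 19) p = i) ↔
          ∃ p < q, inp (m.nvar 16) (m.nvar 19) p = i := by
        constructor
        · rintro ⟨p, hp, h⟩
          exact ⟨p, lt_of_le_of_ne hp (by rintro rfl; exact hi h.symm), h⟩
        · rintro ⟨p, hp, h⟩
          exact ⟨p, by omega, h⟩
      simp [Function.update_of_ne hi, this]
  · congr! 3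

theorem det_reweight (m : Mem) :
    Det inp reweight m (m.nvar 0 * 6 + 3)
      (((m.setRA 0 (fun i => if i < m.nvar 0 then
          m.rarr 0 i * (1 - m.rarr 1 i * (m.narr 4 i - m.rarr 2 i)) else m.rarr 0 i)).setA 4
        (fun i => if i < m.nvar 0 then 0 else m.narr 4 i)).setN 17 (m.nvar 0)) := by
  refine Det.upTo (T := 3) (fun q => ((m.setRA 0 (fun i => if i < q then
          m.rarr 0 i * (1 - m.rarr 1 i * (m.narr 4 i - m.rarr 2 i)) else m.rarr 0 i)).setA 4
        (fun i => if i < q then 0 else m.narr 4 i))) ?_ ?_ (by decide) ?_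
  · simp
  · simp
  · intro q hq
    refine (Det.rstore.seq Det.nstore).mono le_rfl ?_
    apply Mem.ext
    · funext w; simp
    · funext a
      simp [NExp.val]
      split_ifs
      · funext i
        rcases eq_or_ne i q with rfl | hi
        · simp
        · have : i ≤ q ↔ i < q := by omega
          simp [Function.update_of_ne hi, this]
      · rfl
    · rfl
    · funext a
      simp [NExp.val, RExp.val]
      split_ifs
      · funext i
        rcases eq_or_ne i q with rfl | hi
        · simp
        · have : i ≤ q ↔ i < q := by omega
          simp [Function.update_of_ne hi, this]
      · rfl

theorem det_extract (m : Mem) :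
    Det inp extract m 5
      (((m.setN 16 (m.narr 2 (m.nvar 12))).setN 3 (m.nvar 3 - 1)).setA 2
        (Function.update (m.narr 2) (m.nvar 12) (m.narr 2 (m.nvar 3 - 1)))) := by
  refine (Det.nset.seq (Det.nset.seq Det.nstore)).mono le_rfl ?_
  simp [NExp.val]

theorem det_initWeights (m : Mem) :
    Det inp initWeights m (m.nvar 0 * 9 + 5)
      ((((((m.setR 3 ((m.rvar 0 - m.rvar 1) / 32)).setRA 0
        (fun i => if i < m.nvar 0 then (if 1 ≤ m.narr 0 i then 1 else -1) else m.rarr 0 i)).setRA 1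
        (fun i => if i < m.nvar 0 then (if 1 ≤ m.narr 0 i then (m.rvar 0 - m.rvar 1) / 32
          else -((m.rvar 0 - m.rvar 1) / 32)) else m.rarr 1 i)).setRA 2
        (fun i => if i < m.nvar 0 then (if 1 ≤ m.narr 0 i then m.rvar 0
          else m.rvar 1) else m.rarr 2 i))).setN 17 (m.nvar 0)) := by
  set η := (m.rvar 0 - m.rvar 1) / 32 with hη
  refine (Det.rset.seq (Det.upTo (T := 6)
    (fun q => ((((m.setR 3 η).setRA 0
        (fun i => if i < q then (if 1 ≤ m.narr 0 i then 1 else -1) else m.rarr 0 i)).setRA 1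
        (fun i => if i < q then (if 1 ≤ m.narr 0 i then η else -η) else m.rarr 1 i)).setRA 2
        (fun i => if i < q then (if 1 ≤ m.narr 0 i then m.rvar 0
          else m.rvar 1) else m.rarr 2 i))) ?_ (N := m.nvar 0) ?_
      (by decide) ?_)).mono (by omega) rfl
  · apply Mem.ext
    · rfl
    · rfl
    · funext w; simp [RExp.val, NExp.val, hη]
    · funext a; simp; grind
  · simp
  · intro q hq
    refine Det.cond (T := 5) (fun hb => (Det.rstore.seq (Det.rstore.seq Det.rstore)).mono
      le_rfl ?_) (fun hb => (Det.rstore.seq (Det.rstore.seq Det.rstore)).mono le_rfl ?_) <;>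
    · simp [BExp.holds, NExp.val] at hb
      apply Mem.ext
      · funext w; simp
      · rfl
      · rfl
      · funext a
        simp [NExp.val, RExp.val]
        split_ifs <;> first
          | rfl
          | omega
          | (funext i
             rcases eq_or_ne i q with rfl | hi
             · simp [hb]
             · have : i ≤ q ↔ i < q := by omega
               simp [Function.update_of_ne hi, this])

end RandRAM

namespace RandRAM

open scoped ENNReal

variable {inp : ℕ → ℕ → ℕ → ℕ}

/-! ### Sampling voters -/

/-- The largest expectation that is guaranteed. -/
noncomputable def wp (inp : ℕ → ℕ → ℕ → ℕ) (c : Prog) (T : ℕ) (Q : Mem → ℝ≥0∞) (m : Mem) : ℝ≥0∞ :=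
  sSup {x | Tri inp c m T Q x}

theorem Tri.wp {c : Prog} {m : Mem} {T : ℕ} {Q : Mem → ℝ≥0∞} : Tri inp c m T Q (wp inp c T Q m) :=
  fun l T' Q' h' => sSup_le fun _ hx => hx l T' Q' h'

theorem Tri.le_wp {c : Prog} {m : Mem} {T : ℕ} {Q : Mem → ℝ≥0∞} {x : ℝ≥0∞}
    (h : Tri inp c m T Q x) : x ≤ RandRAM.wp inp c T Q m := le_sSup h

/-- Each drawn value may have its own bound `x k`. The sequence rule wants one intermediate
expectation for all of them, and `wp` provides it. -/
theorem Tri.draw_seq {v : ℕ} {e : NExp} {c : Prog} {m : Mem} {T : ℕ} {Q : Mem → ℝ≥0∞}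
    {x : ℕ → ℝ≥0∞} (h : ∀ k ≤ e.val inp m, Tri inp c (m.setN v k) T Q (x k)) :
    Tri inp (.seq (.draw v e) c) m (T + 2) Q
      ((∑ k ∈ Finset.range (e.val inp m + 1), x k) / ((e.val inp m : ℝ≥0∞) + 1)) := by
  refine (Tri.seq (Q₁ := RandRAM.wp inp c T Q) Tri.draw fun m' => Tri.wp).mono (by omega)
    (fun _ => le_rfl) ?_
  gcongr with k hk
  exact (h k (Nat.lt_succ_iff.1 (Finset.mem_range.1 hk))).le_wp

/-- The memory after a vote of member number `a` of the list under facet `j`, if `c = 0`. -/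
def afterVote (inp : ℕ → ℕ → ℕ → ℕ) (m : Mem) (a c j : ℕ) : Mem :=
  let m' := (((m.setN 12 a).setN 13 c).setN 14 j).setN 16 (m.narr 2 (m.nvar 11 + a))
  if c = 0 then (m'.setA 3 (fun i => m.narr 3 i +
      tally inp (m.nvar 2) (m.narr 2 (m.nvar 11 + a)) j i)).setN 15 (m.nvar 2) else m'

/-- The memory after a sampling step. -/
def afterSample (inp : ℕ → ℕ → ℕ → ℕ) (m : Mem) (a c j : ℕ) : Mem :=
  (afterVote inp m a c j).setN 11 (m.nvar 11 + m.nvar 6)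

theorem tri_sampleVoter (m : Mem) (Q : Mem → ℝ≥0∞) :
    Tri inp sampleVoter m (m.nvar 2 * 4 + 14) Q
      ((∑ a ∈ Finset.range (m.nvar 5 + 1), (∑ c ∈ Finset.range (m.nvar 7 + 1),
        (∑ j ∈ Finset.range (m.nvar 1 - 1 + 1), Q (afterSample inp m a c j)) /
          (((m.nvar 1 - 1 : ℕ) : ℝ≥0∞) + 1)) / ((m.nvar 7 : ℝ≥0∞) + 1)) /
            ((m.nvar 5 : ℝ≥0∞) + 1)) := by
  refine (Tri.draw_seq fun a ha => Tri.draw_seq fun c hc => Tri.draw_seq fun j hj =>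
    Det.seq_tri Det.nset (m₁ := (((m.setN 12 a).setN 13 c).setN 14 j).setN 16
      (m.narr 2 (m.nvar 11 + a))) (Det.seq_tri (T₁ := m.nvar 2 * 4 + 4)
      (m₁ := afterVote inp m a c j) (Det.cond ?_ ?_)
    (Det.nset.mono le_rfl (m'' := afterSample inp m a c j) ?_ Q))).mono (by omega)
    (fun _ => le_rfl) le_rfl
  · intro hb
    have hc0 : c = 0 := by simpa [BExp.holds, NExp.val] using hb
    exact (det_castVotes _).mono (by simp) (by simp [hc0, afterVote])
  · intro hb
    have hc0 : c ≠ 0 := by simpa [BExp.holds, NExp.val] using hb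
    exact Det.skip.mono (by omega) (by simp [hc0, afterVote])
  · simp only [afterSample, afterVote, NExp.val]
    split_ifs <;> simp

/-- The memories differ only in the vote counts and in auxiliary variables. -/
structure SameBallot (m m' : Mem) : Prop where
  nvar : ∀ v < 10, m'.nvar v = m.nvar v
  narr : ∀ a ≠ 3, m'.narr a = m.narr a
  rvar : m'.rvar = m.rvar
  rarr : m'.rarr = m.rarr

theorem SameBallot.refl (m : Mem) : SameBallot m m := ⟨fun _ _ => rfl, fun _ _ => rfl, rfl, rfl⟩

theorem SameBallot.trans {m m' m'' : Mem} (h : SameBallot m m') (h' : SameBallot m' m'') :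
    SameBallot m m'' :=
  ⟨fun v hv => (h'.nvar v hv).trans (h.nvar v hv), fun a ha => (h'.narr a ha).trans (h.narr a ha),
    h'.rvar.trans h.rvar, h'.rarr.trans h.rarr⟩

theorem sameBallot_afterSample (m : Mem) (a c j : ℕ) :
    SameBallot m (afterSample inp m a c j) := by
  unfold afterSample afterVote
  refine ⟨fun v hv => ?_, fun a ha => ?_, ?_, ?_⟩
  · have : v ≠ 11 ∧ v ≠ 12 ∧ v ≠ 13 ∧ v ≠ 14 ∧ v ≠ 15 ∧ v ≠ 16 := by omega
    split_ifs <;> simp [this]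
  · split_ifs <;> simp [ha]
  · split_ifs <;> simp
  · split_ifs <;> simp

theorem sameBallot_setN (m : Mem) {v : ℕ} (hv : 10 ≤ v) (x : ℕ) : SameBallot m (m.setN v x) :=
  ⟨fun w hw => by simp [show w ≠ v by omega], fun _ _ => rfl, rfl, rfl⟩

/-- The number of votes for `i` in the sample `ω`; voter number `q` is taken from the position
`h + q g + a` of the list `X`, where `ω q = (a, c, j)`. -/
def sampleVotes (inp : ℕ → ℕ → ℕ → ℕ) (X : ℕ → ℕ) (l g h : ℕ) {r : ℕ}
    (ω : Fin r → ℕ × ℕ × ℕ) (i : ℕ) : ℕ :=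
  ∑ q : Fin r, if (ω q).2.1 = 0 then tally inp l (X (h + q * g + (ω q).1)) (ω q).2.2 i else 0

theorem ENNReal_average_mul {R B F : ℕ} (k : ℕ → ℕ → ℕ → ℕ) (y u v w : ℝ≥0∞) :
    (∑ a ∈ Finset.range R, (∑ c ∈ Finset.range B, (∑ j ∈ Finset.range F, (k a c j : ℝ≥0∞) * y) / u)
      / v) / w = ((∑ a ∈ Finset.range R, ∑ c ∈ Finset.range B, ∑ j ∈ Finset.range F, k a c j : ℕ) :
        ℝ≥0∞) * (y / u / v / w) := by
  simp only [div_eq_mul_inv, ← Finset.sum_mul]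
  push_cast
  ring

/-- Counting by the first coordinate; it matches the three nested averages of one sampling step. -/
theorem card_eq_sum_tails {r R B F : ℕ} (G : Finset (Fin (r + 1) → ℕ × ℕ × ℕ))
    (hG : ∀ ω ∈ G, (ω 0).1 < R ∧ (ω 0).2.1 < B ∧ (ω 0).2.2 < F) :
    G.card = ∑ a ∈ Finset.range R, ∑ c ∈ Finset.range B, ∑ j ∈ Finset.range F,
      ((G.filter fun ω => ω 0 = (a, c, j)).image Fin.tail).card := by
  have h : ∀ o, ((G.filter fun ω => ω 0 = o).image Fin.tail).card =
      (G.filter fun ω => ω 0 = o).card := by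
    intro o
    refine Finset.card_image_of_injOn fun ω hω ω' hω' heq => ?_
    simp only [Finset.coe_filter, Set.mem_ofPred_eq] at hω hω'
    rw [← Fin.cons_self_tail ω, ← Fin.cons_self_tail ω', heq, hω.2, hω'.2]
  simp only [h]
  rw [Finset.card_eq_sum_card_fiberwise (f := fun ω => ω 0)
    (t := Finset.range R ×ˢ Finset.range B ×ˢ Finset.range F)]
  · rw [Finset.sum_product]
    simp only [Finset.sum_product]
  · intro ω hω
    simpa using hG ω hω

/-- All outcome sequences are equally likely, so the probability of a set `G` of sequences is a
count. Induction on the number of voters: after the outcome `(a, c, j)` of the first one, the good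
continuations are the tails of those sequences in `G` that begin with it. -/
theorem reach_samples {l R g B f T : ℕ} {X : ℕ → ℕ} (hT : l * 4 + 16 ≤ T) (r : ℕ) :
    ∀ (G : Finset (Fin r → ℕ × ℕ × ℕ)),
    (∀ ω ∈ G, ∀ q, (ω q).1 ≤ R ∧ (ω q).2.1 ≤ B ∧ (ω q).2.2 ≤ f - 1) → ∀ m : Mem,
    m.nvar 1 = f → m.nvar 2 = l → m.nvar 4 = m.nvar 10 + r → m.nvar 5 = R → m.nvar 6 = g →
    m.nvar 7 = B → m.narr 2 = X →
    Reach inp (.loop (.nle (.plus (.var 10) (.const 1)) (.var 4))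
        (.seq sampleVoter (.nset 10 (.plus (.var 10) (.const 1))))) m (r * (T + 1) + 1)
      (G.card * ((((R : ℝ≥0∞) + 1) * ((B : ℝ≥0∞) + 1) * (((f - 1 : ℕ) : ℝ≥0∞) + 1))⁻¹) ^ r)
      (fun m' => SameBallot m m' ∧ ∃ ω ∈ G, ∀ i,
        m'.narr 3 i = m.narr 3 i + sampleVotes inp X l g (m.nvar 11) ω i) := by
  induction r with
  | zero =>
    intro G hG m h1 h2 h4 h5 h6 h7 hX Q x hx
    rcases G.eq_empty_or_nonempty with rfl | ⟨ω, hω⟩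
    · simpa using Tri.zero _ _ _ _
    · have hc : (G.card : ℝ≥0∞) ≤ 1 := by
        exact_mod_cast Finset.card_le_one.2 fun a _ b _ => Subsingleton.elim a b
      refine (Tri.loop_done (by simp [BExp.holds, NExp.val, h4])).mono (by omega)
        (fun _ => le_rfl) (x := Q m) ?_
      refine le_trans ?_ (hx m ⟨SameBallot.refl m, ω, hω, by simp [sampleVotes]⟩)
      simpa using mul_le_mul_left hc x
  | succ r ih =>
    intro G hG m h1 h2 h4 h5 h6 h7 hX Q x hx
    refine (Tri.loop_step (T₁ := T) (T₂ := r * (T + 1) + 1)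
      (Q₁ := RandRAM.wp inp _ (r * (T + 1) + 1) Q) ?_ (Tri.mono ?_ (hT) (fun _ => le_rfl)
        le_rfl) fun m' => Tri.wp).mono (by ring_nf; omega) (fun _ => le_rfl) le_rfl
    · simp [BExp.holds, NExp.val, h4]
    refine (Tri.seq (tri_sampleVoter m _) fun m' => Tri.nset).mono (by omega)
        (fun _ => le_rfl) ?_
    rw [h1, h5, h7]
    refine le_trans ?_ (ENNReal.div_le_div_right (Finset.sum_le_sum fun a ha =>
      ENNReal.div_le_div_right (Finset.sum_le_sum fun c hc =>
      ENNReal.div_le_div_right (Finset.sum_le_sum fun j hj => Tri.le_wp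
        (ih ((G.filter fun ω => ω 0 = (a, c, j)).image Fin.tail) ?_ _ ?_ ?_ ?_ ?_ ?_ ?_ ?_ Q x ?_))
          _) _) _)
    · simp only [mul_assoc]
      rw [ENNReal_average_mul, ← card_eq_sum_tails]
      · rw [pow_succ, ENNReal.mul_inv, ENNReal.mul_inv]
        · simp only [div_eq_mul_inv]
          apply le_of_eq
          ring
        all_goals simp
      · intro ω hω
        have := hG ω hω 0
        omega
    · intro ω hω q
      obtain ⟨ω', hω', rfl⟩ := Finset.mem_image.1 hω
      exact hG ω' (Finset.mem_filter.1 hω').1 q.succ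
    all_goals have hs := sameBallot_afterSample (inp := inp) m a c j
    · simp [hs.nvar, h1]
    · simp [hs.nvar, h2]
    · have : (afterSample inp m a c j).nvar 10 = m.nvar 10 := by
        unfold afterSample afterVote; split_ifs <;> simp
      simp [hs.nvar, h4, NExp.val, this]; omega
    · simp [hs.nvar, h5]
    · simp [hs.nvar, h6]
    · simp [hs.nvar, h7]
    · simp [hs.narr, hX]
    · rintro m' ⟨hm', ω, hω, hv⟩
      obtain ⟨ω', hω', rfl⟩ := Finset.mem_image.1 hω
      obtain ⟨hω', h0⟩ := Finset.mem_filter.1 hω'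
      refine hx m' ⟨(hs.trans (sameBallot_setN _ le_rfl _)).trans hm', ω', hω', fun i => ?_⟩
      have h11 : (afterSample inp m a c j).nvar 11 = m.nvar 11 + g := by
        unfold afterSample afterVote; split_ifs <;> simp [h6]
      have h3 : (afterSample inp m a c j).narr 3 i = m.narr 3 i +
          if c = 0 then tally inp l (X (m.nvar 11 + a)) j i else 0 := by
        unfold afterSample afterVote; split_ifs <;> simp [h2, hX]
      rw [hv i, sampleVotes, sampleVotes, Fin.sum_univ_succ, ← add_assoc]
      simp only [Mem.narr_setN, h3, Mem.nvar_setN, h0, Fin.tail, Fin.val_zero, Fin.val_succ]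
      simp only [h11, show ((11 : ℕ) = 10) = False by simp, if_false, zero_mul, add_zero]
      congr 1
      refine Finset.sum_congr rfl fun q _ => ?_
      rw [show m.nvar 11 + g + (q : ℕ) * g = m.nvar 11 + ((q : ℕ) + 1) * g by ring]

end RandRAM

namespace RandRAM

open scoped ENNReal

variable {inp : ℕ → ℕ → ℕ → ℕ}

/-! ### Ballots -/

/-- The list, its indicator array, and the input are as they should be between two ballots. -/
structure Listed {n : ℕ} (f l : ℕ) (α β : ℝ) (A : Finset (Fin n)) (m : Mem) : Prop where
  size : m.nvar 0 = n
  facets : m.nvar 1 = f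
  depth : m.nvar 2 = l
  length : m.nvar 3 = A.card
  indicator : ∀ i : Fin n, m.narr 0 i = if i ∈ A then 1 else 0
  list_mem : ∀ q < A.card, ∃ i ∈ A, m.narr 2 q = i.val
  list_surj : ∀ i ∈ A, ∃ q < A.card, m.narr 2 q = i.val
  marks : ∀ i, m.narr 4 i = 0
  upper : m.rvar 0 = α
  lower : m.rvar 1 = β

theorem reach_ballotCore {m : Mem} {n f l k R g B : ℕ} (hn : m.nvar 0 = n)
    (hf : m.nvar 1 = f) (hl : m.nvar 2 = l) (hk : m.nvar 4 = k) (hR : m.nvar 5 = R)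
    (hg : m.nvar 6 = g) (hB : m.nvar 7 = B) (G : Finset (Fin k → ℕ × ℕ × ℕ))
    (hG : ∀ ω ∈ G, ∀ q, (ω q).1 ≤ R ∧ (ω q).2.1 ≤ B ∧ (ω q).2.2 ≤ f - 1) :
    Reach inp ballotCore m (n * 14 + k * (l * 4 + 17) + 18)
      (G.card * ((((R : ℝ≥0∞) + 1) * ((B : ℝ≥0∞) + 1) * (((f - 1 : ℕ) : ℝ≥0∞) + 1))⁻¹) ^ k)
      (fun m' => ∃ ω ∈ G, ∃ P : ℕ → Prop, ∃ _ : DecidablePred P,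
        (∀ i < n, P i ↔ m.nvar 9 ≤ (if 1 ≤ m.narr 0 i then m.nvar 8 else 0) +
          sampleVotes inp (m.narr 2) l g 0 ω i) ∧
        (∀ v < 10, v ≠ 3 → m'.nvar v = m.nvar v) ∧
        m'.nvar 3 = (listing P (m.narr 2) n).2 ∧
        (∀ i < n, m'.narr 0 i = if P i then 1 else 0) ∧
        m'.narr 2 = (listing P (m.narr 2) n).1 ∧
        m'.narr 4 = m.narr 4 ∧ m'.rvar = m.rvar) := by
  subst hn hf hl hk hR hg hB
  set m₁ := (m.setA 3 (fun i => if i < m.nvar 0 then (if 1 ≤ m.narr 0 i then m.nvar 8 else 0)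
        else m.narr 3 i)).setN 17 (m.nvar 0) with hm₁
  have hs := reach_samples (inp := inp) (T := m.nvar 2 * 4 + 16) (R := m.nvar 5) (g := m.nvar 6)
    (B := m.nvar 7) (X := m.narr 2) le_rfl _ G hG ((m₁.setN 11 0).setN 10 0)
      (by simp [hm₁]) (by simp [hm₁]) (by simp [hm₁])
      (by simp [hm₁]) (by simp [hm₁]) (by simp [hm₁]) (by simp [hm₁])
  refine Reach.mono (Det.seq_reach (det_initVotes m) (Det.seq_reach Det.nset
    (Reach.seq (Det.seq_reach Det.nset hs) (p₂ := 1) (T₂ := m.nvar 0 * 9 + 5)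
    fun m' hm' => ?_))) (by ring_nf; omega) (by rw [mul_one]) fun _ h => h
  obtain ⟨hm', ω, hω, hv⟩ := hm'
  have hnv : ∀ v < 10, m'.nvar v = m.nvar v := by
    intro v hv'
    rw [hm'.nvar v hv']
    have : v ≠ 10 ∧ v ≠ 11 ∧ v ≠ 17 := by omega
    simp [hm₁, this]
  have hna : ∀ a, a ≠ 3 → m'.narr a = m.narr a := by
    intro a ha
    rw [hm'.narr a ha]
    simp [hm₁, ha]
  refine Reach.mono (det_collect m').reach (by rw [hnv 0 (by norm_num)]) le_rfl ?_
  rintro m'' rfl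
  rw [hnv 0 (by norm_num), hnv 9 (by norm_num), hna 2 (by norm_num)]
  refine ⟨ω, hω, fun i => m.nvar 9 ≤ m'.narr 3 i, inferInstance, fun i hi => ?_,
    fun v hv hv3 => ?_, ?_, fun i hi => ?_, ?_, ?_, ?_⟩
  · dsimp only
    rw [hv i]
    simp [hm₁, hi]
  · rw [← hnv v hv]
    simp [hv3, show v ≠ 17 by omega]
  · simp
  · simp [hi]
  · simp
  · simp [hna]
  · simp [hm'.rvar, hm₁]

theorem Listed.listing {n f l : ℕ} {α β : ℝ} {A : Finset (Fin n)} {m m' : Mem} {P : ℕ → Prop}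
    [DecidablePred P] (h : Listed f l α β A m) (hnv : ∀ v < 3, m'.nvar v = m.nvar v)
    (hlen : m'.nvar 3 = (listing P (m.narr 2) n).2)
    (hind : ∀ i < n, m'.narr 0 i = if P i then 1 else 0)
    (hlist : m'.narr 2 = (RandRAM.listing P (m.narr 2) n).1)
    (hmark : m'.narr 4 = m.narr 4) (hr : m'.rvar = m.rvar) (A' : Finset (Fin n))
    (hA : ∀ i : Fin n, i ∈ A' ↔ P i) : Listed f l α β A' m' := by
  have hc : A'.card = (RandRAM.listing P (m.narr 2) n).2 := by
    rw [listing_card]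
    rw [← Finset.card_map Fin.valEmbedding]
    congr 1
    ext i
    simp only [Finset.mem_map, Fin.valEmbedding_apply, Finset.mem_filter, Finset.mem_range]
    constructor
    · rintro ⟨j, hj, rfl⟩
      exact ⟨j.2, (hA j).1 hj⟩
    · rintro ⟨hi, hP⟩
      exact ⟨⟨i, hi⟩, (hA _).2 hP, rfl⟩
  refine ⟨?_, ?_, ?_, ?_, fun i => ?_, fun q hq => ?_, fun i hi => ?_, fun i => ?_, ?_, ?_⟩
  · rw [hnv 0 (by norm_num), h.size]
  · rw [hnv 1 (by norm_num), h.facets]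
  · rw [hnv 2 (by norm_num), h.depth]
  · rw [hlen, hc]
  · rw [hind i i.2]
    simp [hA]
  · obtain ⟨h1, h2⟩ := listing_mem P (m.narr 2) n q (hc ▸ hq)
    exact ⟨⟨_, h1⟩, (hA _).2 h2, by rw [hlist]⟩
  · obtain ⟨r, hr, h⟩ := listing_surj P (m.narr 2) n i i.2 ((hA i).1 hi)
    exact ⟨r, hc ▸ hr, by rw [hlist, h]⟩
  · rw [hmark, h.marks]
  · rw [hr, h.upper]
  · rw [hr, h.lower]

/-- A time bound for a ballot. -/
def ballotTime (n : ℕ) : ℕ := 16 * n ^ 2 + 48 * n + 30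

/-- The value `x` may depend on the unknown community. Such guesses replace the missing rounding, at
the price of a factor $1/(2n+1)$ each. -/
theorem Reach.guess_seq {n : ℕ} {c : Prog} {m : Mem} (hm : m.nvar 0 = n) {v x : ℕ}
    (hx : x ≤ 2 * n) {T : ℕ} {p : ℝ≥0∞} {P : Mem → Prop} (h : Reach inp c (m.setN v x) T p P) :
    Reach inp (.seq (guess v) c) m (T + 2) ((((2 * n : ℕ) : ℝ≥0∞) + 1)⁻¹ * p) P := by
  have := Reach.draw (inp := inp) (v := v) (e := .plus (.var 0) (.var 0)) (m := m) (a := x)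
    (by simp [NExp.val, hm]; omega)
  rw [show NExp.val inp m (.plus (.var 0) (.var 0)) = 2 * n by simp [NExp.val, hm]; ring] at this
  refine (this.seq (T₂ := T) fun m' hm' => ?_).mono (by omega) le_rfl fun _ h => h
  rw [hm']
  exact h

/-- The guessed parameters are the number `k` of voters, the range `R` of the random offset in the
list, the step `g` between voters, the range `B` of the coin that must show 0 for a vote to count,
the bonus `b` of the listed members, and the threshold `τ`. Every kind of ballot used below is one
choice of these six numbers. -/
theorem reach_ballot {n f l : ℕ} {α β : ℝ} {A : Finset (Fin n)} {m : Mem}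
    (h : Listed f l α β A m) (hl : l ≤ 2 * n) {k R g B b τ : ℕ} (hk : k ≤ 2 * n) (hR : R ≤ 2 * n)
    (hg : g ≤ 2 * n) (hB : B ≤ 2 * n) (hb : b ≤ 2 * n) (hτ : τ ≤ 2 * n)
    (G : Finset (Fin k → ℕ × ℕ × ℕ))
    (hG : ∀ ω ∈ G, ∀ q, (ω q).1 ≤ R ∧ (ω q).2.1 ≤ B ∧ (ω q).2.2 ≤ f - 1) :
    Reach inp ballot m (ballotTime n) ((((2 * n : ℕ) : ℝ≥0∞) + 1)⁻¹ ^ 6 *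
      (G.card * ((((R : ℝ≥0∞) + 1) * ((B : ℝ≥0∞) + 1) * (((f - 1 : ℕ) : ℝ≥0∞) + 1))⁻¹) ^ k))
      (fun m' => ∃ ω ∈ G, Listed f l α β (Finset.univ.filter fun i : Fin n =>
        τ ≤ (if i ∈ A then b else 0) + sampleVotes inp (m.narr 2) l g 0 ω i) m') := by
  have e0 := h.size
  set m₁ := (((((m.setN 4 k).setN 5 R).setN 6 g).setN 7 B).setN 8 b).setN 9 τ with hm₁
  have hcore := reach_ballotCore (inp := inp) (m := m₁) (n := n) (f := f) (l := l) (k := k) (R := R)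
    (g := g) (B := B) (by simp [hm₁, h.size]) (by simp [hm₁, h.facets]) (by simp [hm₁, h.depth])
    (by simp [hm₁]) (by simp [hm₁]) (by simp [hm₁]) (by simp [hm₁]) G hG
  refine (Reach.guess_seq h.size hk <| Reach.guess_seq (by simp [h.size]) hR <|
    Reach.guess_seq (by simp [h.size]) hg <| Reach.guess_seq (by simp [h.size]) hB <|
    Reach.guess_seq (by simp [h.size]) hb <| Reach.guess_seq (by simp [h.size]) hτ <|
    hcore).mono ?_ (le_of_eq (by ring)) ?_
  · unfold ballotTime
    nlinarith [Nat.mul_le_mul hk hl]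
  · rintro m' ⟨ω, hω, P, _, hP, hnv, hlen, hind, hlist, hmark, hr⟩
    refine ⟨ω, hω, h.listing (P := P) (fun v hv => ?_) ?_ hind ?_ ?_ ?_ _ fun i => ?_⟩
    · rw [hnv v (by omega) (by omega)]
      simp [hm₁, show v ≠ 4 ∧ v ≠ 5 ∧ v ≠ 6 ∧ v ≠ 7 ∧ v ≠ 8 ∧ v ≠ 9 by omega]
    · simpa [hm₁] using hlen
    · simpa [hm₁] using hlist
    · simpa [hm₁] using hmark
    · simpa [hm₁] using hr
    · rw [hP i i.2]
      have h1 : 1 ≤ (if i ∈ A then 1 else 0) ↔ i ∈ A := by split_ifs <;> simp_all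
      simp [hm₁, h.indicator, h1]

/-- For termination all guesses are arbitrary, not lucky. What has to be preserved is that the list
has at most `n` entries, since this bounds the time of the assignment phase. -/
theorem reach_ballot_true {n f l : ℕ} {m : Mem} (h0 : m.nvar 0 = n) (h1 : m.nvar 1 = f)
    (h2 : m.nvar 2 = l) (hl : l ≤ 2 * n) :
    Reach inp ballot m (ballotTime n) 1
      (fun m' => m'.nvar 0 = n ∧ m'.nvar 1 = f ∧ m'.nvar 2 = l ∧ m'.nvar 3 ≤ n) := by
  have hdraw : ∀ (c : Prog) (m : Mem), m.nvar 0 = n → m.nvar 1 = f → m.nvar 2 = l → ∀ v, 2 < v →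
      ∀ T P, (∀ m' : Mem, m'.nvar 0 = n → m'.nvar 1 = f → m'.nvar 2 = l → m'.nvar v ≤ 2 * n →
        (∀ w ≠ v, m'.nvar w = m.nvar w) →
        Reach inp c m' T 1 P) → Reach inp (.seq (guess v) c) m (T + 2) 1 P := by
    intro c m h0 h1 h2 v hv T P h
    refine (Reach.draw_all.seq fun m' hm' => h m' ?_ ?_ ?_ ?_ ?_).mono (by omega) (by simp)
      fun _ h => h
    all_goals obtain ⟨a, ha, rfl⟩ := hm'
    · simp [h0, show 0 ≠ v by omega]
    · simp [h1, show 1 ≠ v by omega]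
    · simp [h2, show 2 ≠ v by omega]
    · simp [NExp.val, h0] at ha; simp; omega
    · intro w hw; simp [hw]
  have hcore : ∀ m : Mem, m.nvar 0 = n → m.nvar 1 = f → m.nvar 2 = l → m.nvar 4 ≤ 2 * n →
      Reach inp ballotCore m (ballotTime n - 12) 1
      (fun m' => m'.nvar 0 = n ∧ m'.nvar 1 = f ∧ m'.nvar 2 = l ∧ m'.nvar 3 ≤ n) := by
    intro m h0 h1 h2 h4
    -- With all outcome sequences admitted, their number cancels the probability of each one.
    refine (reach_ballotCore h0 h1 h2 rfl rfl rfl rfl (Fintype.piFinset fun _ =>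
      Finset.range (m.nvar 5 + 1) ×ˢ Finset.range (m.nvar 7 + 1) ×ˢ Finset.range (f - 1 + 1))
      ?_).mono ?_ ?_ ?_
    · intro ω hω q
      have := (Fintype.mem_piFinset.1 hω) q
      simp only [Finset.mem_product, Finset.mem_range] at this
      omega
    · have : 14 * n + m.nvar 4 * (l * 4 + 17) + 18 + 12 ≤ ballotTime n := by
        unfold ballotTime
        nlinarith [Nat.mul_le_mul h4 hl]
      omega
    · rw [Fintype.card_piFinset]
      simp only [Finset.card_product, Finset.card_range, Finset.prod_const, Finset.card_univ,
        Fintype.card_fin]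
      push_cast
      rw [← mul_pow, ← mul_assoc, ENNReal.mul_inv_cancel, one_pow]
      · simp
      · finiteness
    · rintro m' ⟨ω, -, P, _, -, hnv, hlen, -⟩
      refine ⟨by rw [hnv 0 (by simp) (by simp), h0], by rw [hnv 1 (by simp) (by simp), h1],
        by rw [hnv 2 (by simp) (by simp), h2], ?_⟩
      rw [hlen]
      exact listing_le _ _ _
  refine (hdraw _ m h0 h1 h2 4 (by simp) (ballotTime n - 12 + 10) _ fun m₁ h0 h1 h2 h4 _ =>
    hdraw _ m₁ h0 h1 h2 5 (by simp) (ballotTime n - 12 + 8) _ fun m₂ h0 h1 h2 _ e₂ =>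
    hdraw _ m₂ h0 h1 h2 6 (by simp) (ballotTime n - 12 + 6) _ fun m₃ h0 h1 h2 _ e₃ =>
    hdraw _ m₃ h0 h1 h2 7 (by simp) (ballotTime n - 12 + 4) _ fun m₄ h0 h1 h2 _ e₄ =>
    hdraw _ m₄ h0 h1 h2 8 (by simp) (ballotTime n - 12 + 2) _ fun m₅ h0 h1 h2 _ e₅ =>
    hdraw _ m₅ h0 h1 h2 9 (by simp) (ballotTime n - 12) _ fun m₆ h0 h1 h2 _ e₆ =>
    hcore m₆ h0 h1 h2 ?_).mono ?_ le_rfl fun _ h => h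
  · rw [e₆ 4 (by simp), e₅ 4 (by simp), e₄ 4 (by simp), e₃ 4 (by simp), e₂ 4 (by simp)]
    exact h4
  · unfold ballotTime; omega

end RandRAM

namespace RandRAM

open scoped ENNReal

/-! ### Ballots on affinity systems -/

variable {n f : ℕ}

/-- The number of members of `A` having `i` among the topmost `l` elements of the ranking chosen
by `ρ`. -/
def supportCount (π : MultiAffinity n f) (l : ℕ) (ρ : Fin n → Fin f) (A : Finset (Fin n))
    (i : Fin n) : ℕ :=
  (A.filter fun s => ((π s (ρ s)).symm i).val < l).card

theorem inputTable_fin (π : MultiAffinity n f) (s : Fin n) (j : Fin f) (p : Fin n) :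
    inputTable π s j p = (π s j p).val := by
  simp [inputTable]

theorem tally_inputTable (π : MultiAffinity n f) {l : ℕ} (hl : l ≤ n) (s : Fin n) (j : Fin f)
    (i : Fin n) :
    tally (inputTable π) l s j i = if ((π s j).symm i).val < l then 1 else 0 := by
  unfold tally
  have h : ((Finset.range l).filter fun p => inputTable π s j p = i) =
      (Finset.range l).filter fun p => p = ((π s j).symm i).val := by
    refine Finset.filter_congr fun p hp => ?_
    have hp' : p < n := (Finset.mem_range.1 hp).trans_le hl
    rw [show inputTable π s j p = (π s j ⟨p, hp'⟩).val from inputTable_fin π s j ⟨p, hp'⟩,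
      ← Fin.ext_iff, ← Equiv.eq_symm_apply, Fin.ext_iff]
  rw [h, Finset.filter_eq']
  split_ifs <;> simp_all

theorem Listed.exists_equiv {l : ℕ} {α β : ℝ} {A : Finset (Fin n)} {m : Mem}
    (h : Listed f l α β A m) :
    ∃ e : Fin A.card ≃ {x // x ∈ A}, ∀ q : Fin A.card, m.narr 2 q = (e q).1.val := by
  choose g hg hgm using h.list_mem
  refine ⟨Equiv.ofBijective (fun q : Fin A.card => (⟨g q q.2, hg q q.2⟩ : {x // x ∈ A})) ?_,
    fun q => hgm q q.2⟩
  rw [Fintype.bijective_iff_surjective_and_card]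
  refine ⟨fun ⟨i, hi⟩ => ?_, by simp⟩
  obtain ⟨q, hq, h⟩ := h.list_surj i hi
  exact ⟨⟨q, hq⟩, Subtype.ext (Fin.ext ((hgm q hq).symm.trans h))⟩

theorem ofReal_inv_nat_succ (k : ℕ) : ((k : ℝ≥0∞) + 1)⁻¹ = ENNReal.ofReal (1 / ((k : ℝ) + 1)) := by
  rw [one_div, ENNReal.ofReal_inv_of_pos (by positivity), ENNReal.ofReal_add (by positivity)
    zero_le_one, ENNReal.ofReal_natCast, ENNReal.ofReal_one]

theorem reach_ballot_real (π : MultiAffinity n f) {l : ℕ} {α β : ℝ} {A : Finset (Fin n)} {m : Mem}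
    (h : Listed f l α β A m) (hf : 1 ≤ f) (hl : l ≤ n) {k R g B b τ : ℕ} (hk : k ≤ 2 * n)
    (hR : R ≤ 2 * n)
    (hg : g ≤ 2 * n) (hB : B ≤ 2 * n) (hb : b ≤ 2 * n) (hτ : τ ≤ 2 * n)
    (G : Finset (Fin k → ℕ × ℕ × ℕ))
    (hG : ∀ ω ∈ G, ∀ q, (ω q).1 ≤ R ∧ (ω q).2.1 ≤ B ∧ (ω q).2.2 < f) :
    Reach (inputTable π) ballot m (ballotTime n) (ENNReal.ofReal ((1 / (2 * n + 1)) ^ 6 *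
      (G.card / (((R : ℝ) + 1) * ((B : ℝ) + 1) * f) ^ k)))
      (fun m' => ∃ ω ∈ G, Listed f l α β (Finset.univ.filter fun i : Fin n =>
        τ ≤ (if i ∈ A then b else 0) + sampleVotes (inputTable π) (m.narr 2) l g 0 ω i) m') := by
  refine (reach_ballot h (by omega) hk hR hg hB hb hτ G fun ω hω q => ?_).mono le_rfl
    (le_of_eq ?_) fun _ h => h
  · have := hG ω hω q
    omega
  · rw [ENNReal.mul_inv, ENNReal.mul_inv]
    · simp only [ofReal_inv_nat_succ]
      rw [← ENNReal.ofReal_mul (by positivity), ← ENNReal.ofReal_mul (by positivity),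
        ← ENNReal.ofReal_pow (by positivity), ← ENNReal.ofReal_pow (by positivity),
        ← ENNReal.ofReal_natCast G.card, ← ENNReal.ofReal_mul (by positivity),
        ← ENNReal.ofReal_mul (by positivity)]
      congr 1
      rw [Nat.cast_sub hf]
      push_cast
      rw [sub_add_cancel, one_div_mul_one_div, one_div_mul_one_div, one_div_pow _ k, mul_one_div]
    all_goals simp

/-- No voters and threshold 0. This creates the list of all members at the start and fills the
ballots that are not needed. -/
theorem reach_ballot_trivial (π : MultiAffinity n f) {l : ℕ} {α β : ℝ} {A : Finset (Fin n)}
    {m : Mem} (h : Listed f l α β A m) (hf : 1 ≤ f) (hl : l ≤ n) :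
    Reach (inputTable π) ballot m (ballotTime n) (ENNReal.ofReal ((1 / (2 * n + 1)) ^ 6))
      (Listed f l α β (Finset.univ : Finset (Fin n))) := by
  refine (reach_ballot_real π h hf hl (k := 0) (R := 0) (g := 0) (B := 0) (b := 0) (τ := 0)
    (by omega) (by omega) (by omega) (by omega) (by omega) (by omega) Finset.univ
    (fun ω _ q => q.elim0)).mono le_rfl (le_of_eq (by simp)) ?_
  rintro m' ⟨ω, -, h⟩
  simpa using h

/-- Step 0 and offset range `A.card - 1` make every voter a uniform element of the list, and coin
range 0 lets all of them vote. A prescribed voter with a prescribed facet then has probability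
$1/(|A|f)$. -/
theorem reach_ballot_random (π : MultiAffinity n f) {l : ℕ} {α β : ℝ} {A : Finset (Fin n)}
    {m : Mem} (h : Listed f l α β A m) (hf : 1 ≤ f) (hl : l ≤ n) (hA : A.Nonempty) {k b τ : ℕ}
    (hk : k ≤ 2 * n) (hb : b ≤ 2 * n) (hτ : τ ≤ 2 * n) (ρ : Fin n → Fin f)
    (X : Finset (Fin k → Fin n)) (hX : ∀ x ∈ X, ∀ q, x q ∈ A) :
    Reach (inputTable π) ballot m (ballotTime n) (ENNReal.ofReal ((1 / (2 * n + 1)) ^ 6 *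
      (X.card / ((A.card : ℝ) * f) ^ k)))
      (fun m' => ∃ x ∈ X, Listed f l α β (Finset.univ.filter fun i : Fin n =>
        τ ≤ (if i ∈ A then b else 0) +
          (Finset.univ.filter fun q => ((π (x q) (ρ (x q))).symm i).val < l).card) m') := by
  classical
  obtain ⟨e, he⟩ := h.exists_equiv
  have hcard : A.card ≤ n := by simpa using A.card_le_univ
  have hpos : 0 < A.card := hA.card_pos
  let idx : Fin n → ℕ := fun i => if hi : i ∈ A then (e.symm ⟨i, hi⟩).val else 0
  have hidx : ∀ i ∈ A, idx i < A.card ∧ m.narr 2 (idx i) = i.val := by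
    intro i hi
    simp only [idx, hi, dif_pos]
    exact ⟨(e.symm ⟨i, hi⟩).2, by rw [he (e.symm ⟨i, hi⟩)]; simp⟩
  let F : (Fin k → Fin n) → Fin k → ℕ × ℕ × ℕ := fun x q => (idx (x q), 0, (ρ (x q)).val)
  have hF : (X.image F).card = X.card := by
    refine Finset.card_image_of_injOn fun x hx y hy hxy => funext fun q => ?_
    have := congrArg Prod.fst (congrFun hxy q)
    simp only [F] at this
    apply Fin.ext
    rw [← (hidx _ (hX x hx q)).2, ← (hidx _ (hX y hy q)).2, this]
  refine (reach_ballot_real π h hf hl (k := k) (R := A.card - 1) (g := 0) (B := 0) (b := b) (τ := τ)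
    hk (by omega) (by omega) (by omega) hb hτ (X.image F) ?_).mono le_rfl (le_of_eq ?_) ?_
  · intro ω hω q
    obtain ⟨x, hx, rfl⟩ := Finset.mem_image.1 hω
    have := (hidx _ (hX x hx q)).1
    exact ⟨by simp only [F]; omega, le_rfl, (ρ (x q)).2⟩
  · rw [hF, Nat.cast_sub hpos]
    simp
  · rintro m' ⟨ω, hω, hm'⟩
    obtain ⟨x, hx, rfl⟩ := Finset.mem_image.1 hω
    refine ⟨x, hx, ?_⟩
    convert hm' using 5 with i
    rw [sampleVotes, Finset.card_filter]
    refine Finset.sum_congr rfl fun q _ => ?_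
    simp only [F, mul_zero, zero_add, if_true, (hidx _ (hX x hx q)).2]
    rw [tally_inputTable π hl]

/-- Step 1 and offset range 0 walk through the list once. With `B = 1` a fair coin for each member
decides whether it votes, so that a prescribed electorate `A'` can be hit; with `B = 0` everybody
votes. -/
theorem reach_ballot_all (π : MultiAffinity n f) {l : ℕ} {α β : ℝ} {A : Finset (Fin n)}
    {m : Mem} (h : Listed f l α β A m) (hn : 1 ≤ n) (hf : 1 ≤ f) (hl : l ≤ n) {τ B : ℕ}
    (hτ : τ ≤ 2 * n) (hB : B ≤ 1) (ρ : Fin n → Fin f) (A' : Finset (Fin n)) (hA' : A' ⊆ A)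
    (hBA : B = 0 → A' = A) :
    Reach (inputTable π) ballot m (ballotTime n) (ENNReal.ofReal ((1 / (2 * n + 1)) ^ 6 *
      (1 / (((B : ℝ) + 1) * f) ^ A.card)))
      (Listed f l α β (Finset.univ.filter fun i : Fin n => τ ≤ supportCount π l ρ A' i)) := by
  classical
  obtain ⟨e, he⟩ := h.exists_equiv
  have hcard : A.card ≤ n := by simpa using A.card_le_univ
  refine (reach_ballot_real π h hf hl (k := A.card) (R := 0) (g := 1) (B := B) (b := 0) (τ := τ)
    (by omega) (by omega) (by omega) (by omega) (by omega) hτ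
    {fun q => (0, (if (e q).1 ∈ A' then 0 else 1), (ρ (e q).1).val)} ?_).mono le_rfl
      (le_of_eq (by simp)) ?_
  · intro ω hω q
    rw [Finset.mem_singleton.1 hω]
    refine ⟨le_rfl, ?_, (ρ _).2⟩
    dsimp only
    split_ifs with hq
    · exact Nat.zero_le _
    · rcases Nat.eq_zero_or_pos B with h0 | h0
      · exact absurd (hBA h0 ▸ (e q).2) hq
      · exact h0
  · rintro m' ⟨ω, hω, hm'⟩
    rw [Finset.mem_singleton.1 hω] at hm'
    convert hm' using 4 with i
    rw [sampleVotes, supportCount, ite_self, zero_add]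
    have h1 : ∀ q : Fin A.card, (if (if (e q).1 ∈ A' then 0 else 1) = 0 then
        tally (inputTable π) l (m.narr 2 (0 + q * 1 + 0)) (ρ (e q).1) i else 0) =
        if (e q).1 ∈ A' ∧ ((π (e q).1 (ρ (e q).1)).symm i).val < l then 1 else 0 := by
      intro q
      rw [show 0 + (q : ℕ) * 1 + 0 = q by ring, he, tally_inputTable π hl]
      split_ifs <;> simp_all
    rw [Finset.sum_congr rfl fun q _ => h1 q]
    rw [Equiv.sum_comp e (fun s : {x // x ∈ A} =>
      if s.1 ∈ A' ∧ ((π s.1 (ρ s.1)).symm i).val < l then 1 else 0),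
      Finset.sum_coe_sort A (fun s => if s ∈ A' ∧ ((π s (ρ s)).symm i).val < l then 1 else 0),
      ← Finset.card_filter]
    congr 1
    ext s
    simp only [Finset.mem_filter]
    constructor
    · rintro ⟨h1, h2⟩; exact ⟨hA' h1, h1, h2⟩
    · rintro ⟨-, h1, h2⟩; exact ⟨h1, h2⟩

end RandRAM

namespace RandRAM

open scoped ENNReal

variable {inp : ℕ → ℕ → ℕ → ℕ}

/-! ### The assignment of facets -/

/-- The facet chosen by `chooseBest`. -/
noncomputable def bestFacet (inp : ℕ → ℕ → ℕ → ℕ) (m : Mem) : ℕ :=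
  (lastMax (score inp (m.rarr 0) (m.nvar 2) (m.narr 2 (m.nvar 12))) (m.nvar 19, m.rvar 5)
    (m.nvar 18)).1

open Classical in
theorem det_assignCore (m : Mem) :
    ∃ m', Det inp assignCore m
      (m.nvar 18 * (m.nvar 2 * 4 + 15) + m.nvar 2 * 4 + m.nvar 0 * 6 + 20) m' ∧
      (∀ v, v = 0 ∨ v = 1 ∨ v = 2 ∨ v = 18 → m'.nvar v = m.nvar v) ∧
      m'.nvar 3 = m.nvar 3 - 1 ∧ m'.narr 0 = m.narr 0 ∧
      m'.narr 1 = Function.update (m.narr 1) (m.narr 2 (m.nvar 12)) (bestFacet inp m) ∧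
      m'.narr 2 = Function.update (m.narr 2) (m.nvar 12) (m.narr 2 (m.nvar 3 - 1)) ∧
      (∀ i, m'.narr 4 i = if i < m.nvar 0 then 0 else
        if ∃ p < m.nvar 2, inp (m.narr 2 (m.nvar 12)) (bestFacet inp m) p = i then 1
          else m.narr 4 i) ∧
      (∀ i < m.nvar 0, m'.rarr 0 i = m.rarr 0 i * (1 - m.rarr 1 i *
        ((if ∃ p < m.nvar 2, inp (m.narr 2 (m.nvar 12)) (bestFacet inp m) p = i then 1
          else (m.narr 4 i : ℝ)) - m.rarr 2 i))) ∧
      m'.rarr 1 = m.rarr 1 ∧ m'.rarr 2 = m.rarr 2 := by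
  set m₁ := (((m.setN 16 (m.narr 2 (m.nvar 12))).setN 3 (m.nvar 3 - 1)).setA 2
        (Function.update (m.narr 2) (m.nvar 12) (m.narr 2 (m.nvar 3 - 1)))) with hm₁
  obtain ⟨r, r', p, h₂⟩ := det_chooseBest (inp := inp) m₁
  have hb : (lastMax (score inp (m₁.rarr 0) (m₁.nvar 2) (m₁.nvar 16))
          (m₁.nvar 19, m₁.rvar 5) (m₁.nvar 18)).1 = bestFacet inp m := by
    simp [hm₁, bestFacet]
  rw [hb] at h₂
  refine ⟨_, ((det_extract m).seq (h₂.seq (Det.nstore.seq ((det_markTop _).seq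
    (det_reweight _))))).mono ?_ rfl, ?_, ?_, ?_, ?_, ?_, ?_, ?_, ?_, ?_⟩
  · simp [hm₁]; omega
  · rintro v (rfl | rfl | rfl | rfl) <;> simp [hm₁]
  · simp [hm₁]
  · simp [hm₁]
  · simp [hm₁, NExp.val]
  · simp [hm₁]
  · intro i; simp [hm₁]
  · intro i hi
    simp only [Mem.rarr_setN, Mem.rarr_setA, Mem.rarr_setRA, if_true, Mem.nvar_setN, Mem.nvar_setA,
      Mem.narr_setN, Mem.narr_setA, hm₁, Mem.rarr_setR,
      Mem.nvar_setR, Mem.narr_setR, NExp.val]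
    simp [hi]
  · simp [hm₁]
  · simp [hm₁]

/-- The assignment phase halts. -/
theorem reach_assignAll_true {n f l : ℕ} {m : Mem} (h0 : m.nvar 0 = n) (h1 : m.nvar 1 = f)
    (h2 : m.nvar 2 = l) (hl : l ≤ 2 * n) (h3 : m.nvar 3 ≤ n) :
    Reach inp assignAll m (n * (f * (n * 8 + 15) + n * 14 + 25) + n * 9 + 20) 1
      (fun _ => True) := by
  refine (Reach.seq Reach.draw_all (p₂ := 1) (T₂ := n * (f * (n * 8 + 15) + n * 14 + 25) + n * 9 + 8)
    fun m₁ hm₁ => ?_).mono (by omega) (by simp) fun _ h => h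
  obtain ⟨F, hF, rfl⟩ := hm₁
  simp only [NExp.val, h1] at hF
  refine (Det.seq_reach (det_initWeights _) (T₂ := n * (f * (n * 8 + 15) + n * 14 + 25) + 1)
    ?_).mono (by simp [h0]; omega) le_rfl fun _ h => h
  refine Reach.mono (Reach.loop (N := m.nvar 3) (T := f * (n * 8 + 15) + n * 14 + 24)
    (fun q m' => m'.nvar 0 = n ∧ m'.nvar 1 = f ∧ m'.nvar 2 = l ∧ m'.nvar 18 = F ∧
      m'.nvar 3 = m.nvar 3 - q) ?_ ?_ ?_) ?_ le_rfl fun _ _ => trivial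
  · rintro q hq m' ⟨e0, e1, e2, e18, e3⟩
    refine ⟨by simp [BExp.holds, NExp.val]; omega, ?_⟩
    refine (Reach.draw_all.seq (p₂ := 1) (T₂ := f * (n * 8 + 15) + n * 14 + 22)
      fun m₂ hm₂ => ?_).mono (by omega) (by simp) fun _ h => h
    obtain ⟨a, -, rfl⟩ := hm₂
    refine (Reach.draw_all.seq (p₂ := 1) (T₂ := f * (n * 8 + 15) + n * 14 + 20)
      fun m₃ hm₃ => ?_).mono (by omega) (by simp) fun _ h => h
    obtain ⟨b, -, rfl⟩ := hm₃
    obtain ⟨m'', hdet, hnv, hn3, -⟩ := det_assignCore (inp := inp) ((m'.setN 12 a).setN 19 b)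
    refine hdet.reach.mono ?_ le_rfl ?_
    · simp only [Mem.nvar_setN]
      norm_num
      rw [e0, e2, e18]
      nlinarith [Nat.mul_le_mul hF (show l * 4 + 15 ≤ n * 8 + 15 by omega)]
    · rintro _ rfl
      refine ⟨?_, ?_, ?_, ?_, ?_⟩
      · rw [hnv 0 (by simp)]; simp [e0]
      · rw [hnv 1 (by simp)]; simp [e1]
      · rw [hnv 2 (by simp)]; simp [e2]
      · rw [hnv 18 (by simp)]; simp [e18]
      · rw [hn3]; simp [e3]; omega
  · rintro m' ⟨-, -, -, -, e3⟩
    simp [BExp.holds, NExp.val, e3]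
  · simp [h0, h1, h2]
  · have := Nat.mul_le_mul_right (f * (n * 8 + 15) + n * 14 + 25) h3
    rw [show f * (n * 8 + 15) + n * 14 + 24 + 1 = f * (n * 8 + 15) + n * 14 + 25 by ring]
    omega

/-- The whole program halts in time. -/
theorem communityProg_halts {n f : ℕ} (hn : 1 ≤ n) (hf : 1 ≤ f) (π : MultiAffinity n f)
    (α β θ : ℝ) :
    ∀ c ∈ (exec communityProg π α β θ (600 * f * n ^ 2)).support, c.1 = [] := by
  refine Reach.halts (P := fun _ => True) ?_
  have hb : ∀ (c : Prog) (l : ℕ), l ≤ 2 * n → ∀ (T : ℕ),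
      (∀ m : Mem, m.nvar 0 = n ∧ m.nvar 1 = f ∧ m.nvar 2 = l ∧ m.nvar 3 ≤ n →
        Reach (inputTable π) c m T 1 (fun _ => True)) →
      ∀ m : Mem, m.nvar 0 = n ∧ m.nvar 1 = f ∧ m.nvar 2 = l ∧ m.nvar 3 ≤ n →
        Reach (inputTable π) (.seq ballot c) m (ballotTime n + T + 1) 1 (fun _ => True) :=
    fun c l hl T h m hm => (Reach.seq (reach_ballot_true hm.1 hm.2.1 hm.2.2.1 hl) h).mono
      le_rfl (by simp) fun _ h => h
  refine (Reach.draw_all.seq (p₂ := 1) (T₂ := 4 * ballotTime n +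
    (n * (f * (n * 8 + 15) + n * 14 + 25) + n * 9 + 20) + 4) fun m hm => ?_).mono ?_ (by simp)
      fun _ h => h
  · obtain ⟨l, hl, rfl⟩ := hm
    have hl' : l ≤ 2 * n := by
      simp [NExp.val, initMem] at hl
      omega
    refine (hb _ l hl' _ (hb _ l hl' _ (hb _ l hl' _ (hb _ l hl' _ fun m hm =>
      reach_assignAll_true hm.1 hm.2.1 hm.2.2.1 hl' hm.2.2.2))) _ ?_).mono (by omega) le_rfl
        fun _ h => h
    simp [initMem]
  · unfold ballotTime
    have h1 : n ≤ n ^ 2 := by nlinarith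
    have h2 : n ^ 2 ≤ f * n ^ 2 := Nat.le_mul_of_pos_left _ hf
    have h3 : f * n ≤ f * n ^ 2 := Nat.mul_le_mul_left f h1
    nlinarith

end RandRAM

/-! ### One round of the facet assignment, and the assignment loop -/

namespace RandRAM

open scoped ENNReal

variable {n f : ℕ}

/-- The sign of the constraint for the member `i`. -/
noncomputable def side (S : Finset (Fin n)) (i : Fin n) : ℝ := if i ∈ S then 1 else -1

/-- The bound in the constraint for the member `i`. -/
noncomputable def level (S : Finset (Fin n)) (α β : ℝ) (i : Fin n) : ℝ := if i ∈ S then α else β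

/-- The contribution of the member `s` with facet `j` to the constraint for the member `i`. -/
noncomputable def gain (π : MultiAffinity n f) (l : ℕ) (S : Finset (Fin n)) (α β : ℝ)
    (s : Fin n) (j : Fin f) (i : Fin n) : ℝ :=
  side S i * ((if ((π s j).symm i).val < l then 1 else 0) - level S α β i)

/-- The weight of the constraint for the member `i` once the members in `D` have got their facets
from `ρ`. -/
noncomputable def weight (π : MultiAffinity n f) (l : ℕ) (S : Finset (Fin n)) (α β : ℝ)
    (D : Finset (Fin n)) (ρ : Fin n → Fin f) (i : Fin n) : ℝ :=
  ∏ s ∈ D, (1 - (α - β) / 32 * gain π l S α β s (ρ s) i)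

/-- The weighted total contribution of `s` with facet `j`. -/
noncomputable def merit (π : MultiAffinity n f) (l : ℕ) (S : Finset (Fin n)) (α β : ℝ)
    (w : Fin n → ℝ) (s : Fin n) (j : Fin f) : ℝ :=
  ∑ i, w i * gain π l S α β s j i

/-- The memory during the assignment phase: the members in `R` still have no facet. -/
structure Assigning (π : MultiAffinity n f) (l F : ℕ) (α β : ℝ) (S R : Finset (Fin n))
    (ρ : Fin n → Fin f) (m : Mem) : Prop where
  size : m.nvar 0 = n
  facets : m.nvar 1 = f
  depth : m.nvar 2 = l
  length : m.nvar 3 = R.card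
  bound : m.nvar 18 = F
  subset : R ⊆ S
  indicator : ∀ i : Fin n, m.narr 0 i = if i ∈ S then 1 else 0
  list_mem : ∀ q < R.card, ∃ i ∈ R, m.narr 2 q = i.val
  list_surj : ∀ i ∈ R, ∃ q < R.card, m.narr 2 q = i.val
  marks : ∀ i, m.narr 4 i = 0
  chosen : ∀ s ∈ S, s ∉ R → m.narr 1 s = (ρ s).val
  weights : ∀ i : Fin n, m.rarr 0 i = side S i * weight π l S α β (S \ R) ρ i
  rates : ∀ i : Fin n, m.rarr 1 i = side S i * ((α - β) / 32)
  levels : ∀ i : Fin n, m.rarr 2 i = level S α β i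

variable {π : MultiAffinity n f} {l F : ℕ} {α β : ℝ} {S R : Finset (Fin n)} {ρ : Fin n → Fin f}
  {m : Mem}

theorem Assigning.exists_equiv (h : Assigning π l F α β S R ρ m) :
    ∃ e : Fin R.card ≃ {x // x ∈ R}, ∀ q : Fin R.card, m.narr 2 q = (e q).1.val := by
  choose g hg hgm using h.list_mem
  refine ⟨Equiv.ofBijective (fun q : Fin R.card => (⟨g q q.2, hg q q.2⟩ : {x // x ∈ R})) ?_,
    fun q => hgm q q.2⟩
  rw [Fintype.bijective_iff_surjective_and_card]
  refine ⟨fun ⟨i, hi⟩ => ?_, by simp⟩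
  obtain ⟨q, hq, h⟩ := h.list_surj i hi
  exact ⟨⟨q, hq⟩, Subtype.ext (Fin.ext ((hgm q hq).symm.trans h))⟩

theorem exists_top_iff (π : MultiAffinity n f) {l : ℕ} (hl : l ≤ n) (s : Fin n) (j : Fin f)
    (i : Fin n) :
    (∃ p < l, inputTable π s j p = i) ↔ ((π s j).symm i).val < l := by
  constructor
  · rintro ⟨p, hp, h⟩
    rw [show inputTable π s j p = (π s j ⟨p, hp.trans_le hl⟩).val from
      inputTable_fin π s j ⟨p, hp.trans_le hl⟩, ← Fin.ext_iff, ← Equiv.eq_symm_apply] at h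
    rw [← h]
    exact hp
  · intro h
    exact ⟨_, h, by rw [inputTable_fin]; simp⟩

theorem score_inputTable (π : MultiAffinity n f) {l : ℕ} (hl : l ≤ n) (u : ℕ → ℝ) (s : Fin n)
    (j : Fin f) :
    score (inputTable π) u l s j = ∑ i : Fin n, u i * if ((π s j).symm i).val < l then 1 else 0 := by
  rw [← Equiv.sum_comp (π s j)]
  simp only [Equiv.symm_apply_apply, mul_ite, mul_one, mul_zero]
  have h : ∀ p : Fin n, (if p.val < l then u (π s j p) else 0) =
      (fun p => if p < l then u (inputTable π s j p) else 0) p.val := by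
    intro p
    simp only [inputTable_fin]
  rw [Finset.sum_congr rfl fun p _ => h p,
    Fin.sum_univ_eq_sum_range (fun p => if p < l then u (inputTable π s j p) else 0) n,
    ← Finset.sum_filter, score]
  refine Finset.sum_congr ?_ fun _ _ => rfl
  ext p
  simp only [Finset.mem_filter, Finset.mem_range]
  omega

/-- The subtracted sum does not involve the facet. Hence maximizing the score, a sum over only `l`
positions of a ranking, maximizes the weighted gain over all `n` constraints. -/
theorem merit_eq_score (h : Assigning π l F α β S R ρ m) (hl : l ≤ n) (s : Fin n) (j : Fin f) :
    merit π l S α β (weight π l S α β (S \ R) ρ) s j = score (inputTable π) (m.rarr 0) l s j -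
      ∑ i, weight π l S α β (S \ R) ρ i * side S i * level S α β i := by
  rw [score_inputTable π hl, merit, ← Finset.sum_sub_distrib]
  refine Finset.sum_congr rfl fun i _ => ?_
  rw [h.weights, gain]
  ring

/-- The two modes of the assignment phase: for `F = 0` no rankings are compared and the drawn facet
`b` is used; for `F = f` the choice is greedy and `b` is irrelevant. -/
theorem bestFacet_spec (h : Assigning π l F α β S R ρ m) (hl : l ≤ n) (hf : 1 ≤ f)
    (hF : F = 0 ∨ F = f) (s : Fin n) (b : Fin f) (hs : m.narr 2 (m.nvar 12) = s.val)
    (hb : m.nvar 19 = b) :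
    ∃ j : Fin f, bestFacet (inputTable π) m = j ∧ (F = 0 → j = b) ∧
      (F = f → ∀ j', merit π l S α β (weight π l S α β (S \ R) ρ) s j' ≤
        merit π l S α β (weight π l S α β (S \ R) ρ) s j) := by
  rw [bestFacet, hs, hb, h.depth, h.bound]
  rcases hF with rfl | rfl
  · exact ⟨b, rfl, fun _ => rfl, fun h => by omega⟩
  · obtain ⟨h1, h2, h3⟩ := lastMax_spec (score (inputTable π) (m.rarr 0) l s) (b, m.rvar 5) F hf
    refine ⟨⟨_, h1⟩, rfl, fun h => by omega, fun _ j' => ?_⟩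
    rw [merit_eq_score h hl, merit_eq_score h hl]
    exact sub_le_sub_right (h3 j' j'.2) _

theorem weight_update (π : MultiAffinity n f) (l : ℕ) (α β : ℝ) (ρ : Fin n → Fin f) (hRS : R ⊆ S)
    {s : Fin n} (hs : s ∈ R) (j : Fin f) (i : Fin n) :
    weight π l S α β (S \ R.erase s) (Function.update ρ s j) i =
      weight π l S α β (S \ R) ρ i * (1 - (α - β) / 32 * gain π l S α β s j i) := by
  rw [Finset.sdiff_erase (hRS hs), weight, weight, Finset.prod_insert (by simp [hs]),
    Function.update_self, mul_comm]
  congr 1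
  refine Finset.prod_congr rfl fun s' hs' => ?_
  rw [Function.update_of_ne]
  rintro rfl
  exact (Finset.mem_sdiff.1 hs').2 hs

theorem Assigning.next (h : Assigning π l F α β S R ρ m) (hl : l ≤ n) (hf : 1 ≤ f)
    (hF : F = 0 ∨ F = f) (s : Fin n) (hs : s ∈ R) (b : Fin f) (h12 : m.nvar 12 < R.card)
    (hs2 : m.narr 2 (m.nvar 12) = s.val) (hb : m.nvar 19 = b) :
    ∃ (j : Fin f) (m' : Mem), (F = 0 → j = b) ∧
      (F = f → ∀ j', merit π l S α β (weight π l S α β (S \ R) ρ) s j' ≤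
        merit π l S α β (weight π l S α β (S \ R) ρ) s j) ∧
      Det (inputTable π) assignCore m (f * (n * 8 + 15) + n * 14 + 20) m' ∧
      Assigning π l F α β S (R.erase s) (Function.update ρ s j) m' := by
  obtain ⟨j, hj, hj0, hjf⟩ := bestFacet_spec h hl hf hF s b hs2 hb
  obtain ⟨m', hdet, hnv, h3, ha0, ha1, ha2, ha4, hr0, hr1, hr2⟩ :=
    det_assignCore (inp := inputTable π) m
  obtain ⟨e, he⟩ := h.exists_equiv
  have hes : e ⟨m.nvar 12, h12⟩ = ⟨s, hs⟩ := Subtype.ext (Fin.ext ((he _).symm.trans hs2))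
  have hcard : (R.erase s).card = R.card - 1 := Finset.card_erase_of_mem hs
  have hne : ∀ q (hq : q < R.card), q ≠ m.nvar 12 → (e ⟨q, hq⟩).1 ≠ s := by
    intro q hq hne heq
    apply hne
    have : e ⟨q, hq⟩ = e ⟨m.nvar 12, h12⟩ := by rw [hes]; exact Subtype.ext heq
    simpa using e.injective this
  rw [hs2, hj] at ha1 ha4 hr0
  rw [h.depth] at ha4 hr0
  refine ⟨j, m', hj0, hjf, hdet.mono ?_ rfl, ?_, ?_, ?_, ?_, ?_, (Finset.erase_subset _ _).trans h.subset,
    ?_, ?_, ?_, ?_, ?_, ?_, ?_, ?_⟩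
  · rw [h.bound, h.depth, h.size]
    have hFf : F ≤ f := by omega
    nlinarith [Nat.mul_le_mul hFf (show l * 4 + 15 ≤ n * 8 + 15 by omega)]
  · rw [hnv 0 (by simp), h.size]
  · rw [hnv 1 (by simp), h.facets]
  · rw [hnv 2 (by simp), h.depth]
  · rw [h3, h.length, hcard]
  · rw [hnv 18 (by simp), h.bound]
  · rw [ha0]; exact h.indicator
  · intro q hq
    rw [hcard] at hq
    rw [ha2, h.length]
    -- The gap left by `s` has been filled with the last entry of the list.
    rcases eq_or_ne q (m.nvar 12) with rfl | hqa
    · refine ⟨(e ⟨R.card - 1, by omega⟩).1, Finset.mem_erase.2 ⟨hne _ (by omega) (by omega),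
        (e _).2⟩, ?_⟩
      rw [Function.update_self]
      exact he ⟨R.card - 1, by omega⟩
    · refine ⟨(e ⟨q, by omega⟩).1, Finset.mem_erase.2 ⟨hne _ (by omega) hqa, (e _).2⟩, ?_⟩
      rw [Function.update_of_ne hqa]
      exact he ⟨q, by omega⟩
  · intro i hi
    obtain ⟨his, hiR⟩ := Finset.mem_erase.1 hi
    obtain ⟨q, hq⟩ := e.surjective ⟨i, hiR⟩
    have hqi : m.narr 2 q = i.val := by rw [he, hq]
    have hqa : (q : ℕ) ≠ m.nvar 12 := by
      intro hq'
      rw [hq', hs2] at hqi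
      exact his (Fin.ext hqi.symm)
    rw [hcard, ha2, h.length]
    have := q.2
    rcases eq_or_ne (q : ℕ) (R.card - 1) with hq1 | hq1
    · exact ⟨m.nvar 12, by omega, by rw [Function.update_self, ← hq1, hqi]⟩
    · exact ⟨q, by omega, by rw [Function.update_of_ne hqa, hqi]⟩
  · intro i
    rw [ha4, h.size]
    split_ifs with h1 h2
    · rfl
    · obtain ⟨p, hp, h2⟩ := h2
      rw [show inputTable π s j p = (π s j ⟨p, hp.trans_le hl⟩).val from
        inputTable_fin π s j ⟨p, hp.trans_le hl⟩] at h2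
      exact absurd (h2 ▸ (π s j ⟨p, hp.trans_le hl⟩).2) h1
    · exact h.marks i
  · intro s' hs' hs'R
    rw [ha1]
    rcases eq_or_ne s' s with rfl | hne'
    · simp
    · rw [Function.update_of_ne (by simpa [Fin.ext_iff] using hne'), Function.update_of_ne hne']
      exact h.chosen s' hs' fun h' => hs'R (Finset.mem_erase.2 ⟨hne', h'⟩)
  · intro i
    rw [hr0 i (by rw [h.size]; exact i.2), h.weights, h.rates, h.levels, h.marks,
      weight_update π l α β ρ h.subset hs, gain]
    simp only [exists_top_iff π hl, Nat.cast_zero]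
    ring
  · rw [hr1]; exact h.rates
  · rw [hr2]; exact h.levels

/-- A round averages over a uniform remaining member `s` and a uniform default facet `b`. The bound
`v s b` has to hold for every facet `j` that the current mode permits, because ties between best
facets are not controlled. -/
theorem tri_assignOne (h : Assigning π l F α β S R ρ m) (hl : l ≤ n) (hf : 1 ≤ f)
    (hF : F = 0 ∨ F = f) (hR : R.Nonempty) {Q : Mem → ℝ≥0∞} (v : Fin n → Fin f → ℝ≥0∞)
    (hv : ∀ s ∈ R, ∀ b j : Fin f, (F = 0 → j = b) →
      (F = f → ∀ j', merit π l S α β (weight π l S α β (S \ R) ρ) s j' ≤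
        merit π l S α β (weight π l S α β (S \ R) ρ) s j) → ∀ m',
      Assigning π l F α β S (R.erase s) (Function.update ρ s j) m' → v s b ≤ Q m') :
    Tri (inputTable π) assignOne m (f * (n * 8 + 15) + n * 14 + 24) Q
      ((∑ s ∈ R, (∑ b, v s b) / f) / R.card) := by
  obtain ⟨e, he⟩ := h.exists_equiv
  have hR' := hR.card_pos
  refine (Tri.draw_seq (x := fun k => (∑ b ∈ Finset.range (f - 1 + 1),
      if hk : k < R.card then (if hb : b < f then v (e ⟨k, hk⟩).1 ⟨b, hb⟩ else 0) else 0) /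
        (((f - 1 : ℕ) : ℝ≥0∞) + 1)) fun k hk => ?_).mono
    (T := f * (n * 8 + 15) + n * 14 + 22 + 2) (by omega) (fun _ => le_rfl) ?_
  · have hk' : k < R.card := by simp [NExp.val, h.length] at hk; omega
    have hf1 : NExp.val (inputTable π) (m.setN 12 k) (.minus (.var 1) (.const 1)) = f - 1 := by
      simp [NExp.val, h.facets]
    refine (Tri.draw_seq (x := fun b => if hk : k < R.card then
      (if hb : b < f then v (e ⟨k, hk⟩).1 ⟨b, hb⟩ else 0) else 0) fun b hb => ?_).mono
      (T := f * (n * 8 + 15) + n * 14 + 20 + 2) (by omega) (fun _ => le_rfl) (by rw [hf1])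
    have hb' : b < f := by rw [hf1] at hb; omega
    rw [dif_pos hk', dif_pos hb']
    have h' : Assigning π l F α β S R ρ ((m.setN 12 k).setN 19 b) := by
      refine ⟨?_, ?_, ?_, ?_, ?_, h.subset, h.indicator, h.list_mem, h.list_surj, h.marks,
        h.chosen, h.weights, h.rates, h.levels⟩
      · simp [h.size]
      · simp [h.facets]
      · simp [h.depth]
      · simp [h.length]
      · simp [h.bound]
    obtain ⟨j, m', hj0, hjf, hdet, hm'⟩ := h'.next hl hf hF (e ⟨k, hk'⟩).1 (e ⟨k, hk'⟩).2 ⟨b, hb'⟩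
      (by simpa using hk') (by simpa using he ⟨k, hk'⟩) (by simp)
    exact (hdet Q).mono le_rfl (fun _ => le_rfl) (hv _ (e ⟨k, hk'⟩).2 _ j hj0 hjf m' hm')
  · rw [show NExp.val (inputTable π) m (.minus (.var 3) (.const 1)) = R.card - 1 by
      simp [NExp.val, h.length]]
    have e1 : ((R.card - 1 : ℕ) : ℝ≥0∞) + 1 = R.card := by
      rw [← Nat.cast_add_one, Nat.sub_add_cancel hR']
    have e2 : ((f - 1 : ℕ) : ℝ≥0∞) + 1 = f := by
      rw [← Nat.cast_add_one, Nat.sub_add_cancel hf]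
    rw [e1, e2, Nat.sub_add_cancel hR', Nat.sub_add_cancel hf]
    simp only [Finset.sum_range]
    simp only [Fin.is_lt, dif_pos, Fin.eta]
    rw [Equiv.sum_comp e (fun s : {x // x ∈ R} => (∑ b, v s.1 b) / (f : ℝ≥0∞)),
      Finset.sum_coe_sort R (fun s => (∑ b, v s b) / (f : ℝ≥0∞))]

/-- The assignment loop, analysed by a value function. -/
theorem tri_assignLoop (hl : l ≤ n) (hf : 1 ≤ f) (hF : F = 0 ∨ F = f) {Q : Mem → ℝ≥0∞}
    (v : Finset (Fin n) → (Fin n → Fin f) → ℝ≥0∞)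
    (hdone : ∀ ρ m, Assigning π l F α β S ∅ ρ m → v ∅ ρ ≤ Q m)
    (hstep : ∀ R ρ, R.Nonempty → R ⊆ S → ∀ c : Fin n → Fin f → Fin f,
      (F = 0 → ∀ s b, c s b = b) →
      (F = f → ∀ s b j', merit π l S α β (weight π l S α β (S \ R) ρ) s j' ≤
        merit π l S α β (weight π l S α β (S \ R) ρ) s (c s b)) →
      v R ρ ≤ (∑ s ∈ R, (∑ b, v (R.erase s) (Function.update ρ s (c s b))) / f) / R.card)
    (N : ℕ) : ∀ (R : Finset (Fin n)) (ρ : Fin n → Fin f) (m : Mem), R.card = N →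
      Assigning π l F α β S R ρ m →
      Tri (inputTable π) (.loop (.nle (.const 1) (.var 3)) assignOne) m
        (N * (f * (n * 8 + 15) + n * 14 + 25) + 1) Q (v R ρ) := by
  classical
  induction N with
  | zero =>
    intro R ρ m hR hm
    rw [Finset.card_eq_zero] at hR
    subst hR
    exact (Tri.loop_done (by simp [BExp.holds, NExp.val, hm.length])).mono (by omega)
      (fun _ => le_rfl) (hdone ρ m hm)
  | succ N ih =>
    intro R ρ m hR hm
    have hRne : R.Nonempty := Finset.card_pos.1 (by omega)
    set w := weight π l S α β (S \ R) ρ with hw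
    -- Among the permitted facets take the one that is worst for `v`; the actual choice of the
    -- program is at least as good.
    have hex : ∀ s b, ∃ c : Fin f, ((F = 0 → c = b) ∧
        (F = f → ∀ j', merit π l S α β w s j' ≤ merit π l S α β w s c)) ∧
        ∀ j, ((F = 0 → j = b) ∧
        (F = f → ∀ j', merit π l S α β w s j' ≤ merit π l S α β w s j)) →
        v (R.erase s) (Function.update ρ s c) ≤ v (R.erase s) (Function.update ρ s j) := by
      intro s b
      have hne : (Finset.univ.filter fun j : Fin f => (F = 0 → j = b) ∧
        (F = f → ∀ j', merit π l S α β w s j' ≤ merit π l S α β w s j)).Nonempty := by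
        rcases hF with h0 | h0
        · exact ⟨b, by simp; omega⟩
        · obtain ⟨j, -, hj⟩ := Finset.exists_max_image Finset.univ (merit π l S α β w s)
            ⟨b, Finset.mem_univ b⟩
          exact ⟨j, by simp; exact ⟨by omega, fun _ j' => hj j' (Finset.mem_univ _)⟩⟩
      obtain ⟨c, hc, hmin⟩ := Finset.exists_min_image _
        (fun j => v (R.erase s) (Function.update ρ s j)) hne
      exact ⟨c, (Finset.mem_filter.1 hc).2, fun j hj =>
        hmin j (Finset.mem_filter.2 ⟨Finset.mem_univ _, hj⟩)⟩
    choose c hc hmin using hex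
    refine (Tri.loop_step (T₁ := f * (n * 8 + 15) + n * 14 + 24)
      (T₂ := N * (f * (n * 8 + 15) + n * 14 + 25) + 1)
      (by simp [BExp.holds, NExp.val, hm.length, hR])
      (tri_assignOne hm hl hf hF hRne (fun s b => v (R.erase s) (Function.update ρ s (c s b)))
        fun s hs b j h0 h1 m' hm' => (hmin s b j ⟨h0, h1⟩).trans
          (ih _ _ m' (by rw [Finset.card_erase_of_mem hs, hR]; rfl) hm').le_wp)
      fun m' => Tri.wp).mono (by ring_nf; omega) (fun _ => le_rfl)
      (hstep R ρ hRne hm.subset c (fun h0 s b => (hc s b).1 h0) fun h1 s b => (hc s b).2 h1)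

end RandRAM

/-! ### Online decisions in random order -/

namespace RandomOrder

set_option linter.unusedSectionVars false

open Finset

variable {σ κ ι : Type*} [DecidableEq σ] [Fintype ι]

theorem exp_le_one_add_add_sq {x : ℝ} (hx : |x| ≤ 1) : Real.exp x ≤ 1 + x + x ^ 2 := by
  have h := (abs_le.1 (Real.abs_exp_sub_one_sub_id_le hx)).2
  linarith

/-- The mean of a function. -/
noncomputable def mean (y : σ → ℝ) (R : Finset σ) : ℝ := (∑ s ∈ R, y s) / R.card

/-- Deleting a uniformly random element leaves the mean unchanged on average and moves it by at most
$1/(|R|-1)$, as the values spread over a range of length 1. The linear term of $e^x\le1+x+x^2$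
cancels, and the quadratic one gives the factor on the right. -/
theorem sum_exp_mean_erase_le {y : σ → ℝ} {R : Finset σ} (hR : 2 ≤ R.card)
    (hy : ∀ s ∈ R, ∀ s' ∈ R, y s - y s' ≤ 1) {c : ℝ} (hc : |c| ≤ R.card - 1) :
    ∑ s ∈ R, Real.exp (c * mean y (R.erase s)) ≤
      R.card * Real.exp (c * mean y R + c ^ 2 * (1 / ((R.card : ℝ) - 1) ^ 2)) := by
  have hN : (2 : ℝ) ≤ R.card := by exact_mod_cast hR
  set N : ℝ := (R.card : ℝ) with hNdef
  have hN1 : 0 < N - 1 := by linarith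
  set M := mean y R with hM
  have hsum : ∑ s ∈ R, y s = N * M := by
    rw [hM, mean, ← hNdef]; field_simp
  let d : σ → ℝ := fun s => (M - y s) / (N - 1)
  have hmean : ∀ s ∈ R, mean y (R.erase s) = M + d s := by
    intro s hs
    have h1 : ∑ x ∈ R.erase s, y x = N * M - y s := by
      rw [← hsum, ← Finset.add_sum_erase R y hs]; ring
    rw [mean, h1, Finset.card_erase_of_mem hs, Nat.cast_sub (by omega), ← hNdef]
    simp only [d, Nat.cast_one]
    field_simp
    ring
  have hd : ∀ s ∈ R, |d s| ≤ 1 / (N - 1) := by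
    intro s hs
    rw [abs_div, abs_of_pos hN1]
    gcongr
    have h1 : N * (M - y s) = ∑ s' ∈ R, (y s' - y s) := by
      rw [Finset.sum_sub_distrib, hsum, Finset.sum_const, nsmul_eq_mul]; ring
    have h2 : ∑ s' ∈ R, (y s' - y s) ≤ ∑ _s' ∈ R, (1 : ℝ) :=
      Finset.sum_le_sum fun s' hs' => hy s' hs' s hs
    have h3 : ∑ _s' ∈ R, (-1 : ℝ) ≤ ∑ s' ∈ R, (y s' - y s) :=
      Finset.sum_le_sum fun s' hs' => by linarith [hy s hs s' hs']
    simp only [Finset.sum_const, nsmul_eq_mul] at h2 h3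
    rw [abs_le]
    constructor <;> nlinarith
  have hd0 : ∑ s ∈ R, d s = 0 := by
    simp only [d]
    rw [← Finset.sum_div, Finset.sum_sub_distrib, hsum, Finset.sum_const, nsmul_eq_mul]
    simp [← hNdef]
  calc ∑ s ∈ R, Real.exp (c * mean y (R.erase s))
      ≤ ∑ s ∈ R, Real.exp (c * M) * (1 + c * d s + c ^ 2 * (1 / (N - 1) ^ 2)) := by
        refine Finset.sum_le_sum fun s hs => ?_
        rw [hmean s hs, mul_add, Real.exp_add]
        gcongr
        have h1 : |c * d s| ≤ 1 := by
          rw [abs_mul]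
          calc |c| * |d s| ≤ (N - 1) * (1 / (N - 1)) := by
                gcongr
                exact hd s hs
            _ = 1 := by field_simp
        refine (exp_le_one_add_add_sq h1).trans ?_
        have h2 : d s ^ 2 ≤ 1 / (N - 1) ^ 2 := by
          rw [← sq_abs, ← one_div_pow]
          gcongr
          exact hd s hs
        nlinarith [mul_le_mul_of_nonneg_left h2 (sq_nonneg c)]
    _ = Real.exp (c * M) * (N * (1 + c ^ 2 * (1 / (N - 1) ^ 2))) := by
        rw [← Finset.mul_sum, Finset.sum_add_distrib, Finset.sum_add_distrib, ← Finset.mul_sum, hd0]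
        simp only [Finset.sum_const, nsmul_eq_mul, ← hNdef]
        ring
    _ ≤ Real.exp (c * M) * (N * Real.exp (c ^ 2 * (1 / (N - 1) ^ 2))) := by
        gcongr
        linarith [Real.add_one_le_exp (c ^ 2 * (1 / (N - 1) ^ 2))]
    _ = _ := by rw [Real.exp_add]; ring

/-- The admitted deviation of the mean of `N` of `t` random elements. -/
noncomputable def dev (γ : ℝ) (t N : ℕ) : ℝ := γ / 16 * √(t / N)

/-- The parameter of the exponential moment. -/
noncomputable def rate (γ : ℝ) (t N : ℕ) : ℝ := dev γ t N * N / 4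

/-- One term of `devPot`. -/
noncomputable def devTerm (γ : ℝ) (t N : ℕ) (y : σ → ℝ) (R : Finset σ) : ℝ :=
  Real.exp (rate γ t N * (-mean y R - dev γ t N) +
    rate γ t N ^ 2 * ∑ k ∈ Ico N R.card, 1 / (k : ℝ) ^ 2)

/-- An upper bound for the probability that some mean of the remaining elements deviates. -/
noncomputable def devPot (γ : ℝ) (t : ℕ) (y : ι → σ → ℝ) (R : Finset σ) : ℝ :=
  ∑ N ∈ Icc 1 R.card with dev γ t N ≤ 1, ∑ i, devTerm γ t N (y i) R

theorem devPot_nonneg (γ : ℝ) (t : ℕ) (y : ι → σ → ℝ) (R : Finset σ) : 0 ≤ devPot γ t y R :=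
  Finset.sum_nonneg fun _ _ => Finset.sum_nonneg fun _ _ => (Real.exp_pos _).le

theorem dev_nonneg {γ : ℝ} (hγ : 0 ≤ γ) (t N : ℕ) : 0 ≤ dev γ t N := by
  unfold dev; positivity

/-- When the remaining set shrinks by one, the sum $\sum_{k=N}^{|R|-1}1/k^2$ loses its last term
$1/(|R|-1)^2$, which is exactly the growth of the exponential moment. The assumption on `dev` keeps
the rate below $|R|-1$. -/
theorem sum_devTerm_erase_le {γ : ℝ} (hγ : 0 ≤ γ) (t N : ℕ) {y : σ → ℝ} {R : Finset σ} (hN : 1 ≤ N)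
    (hNR : N + 1 ≤ R.card) (hdev : dev γ t N ≤ 1)
    (hy : ∀ s ∈ R, ∀ s' ∈ R, y s - y s' ≤ 1) :
    ∑ s ∈ R, devTerm γ t N y (R.erase s) ≤ R.card * devTerm γ t N y R := by
  set c := rate γ t N with hc
  have hNR' : (N : ℝ) + 1 ≤ R.card := by exact_mod_cast hNR
  have hN' : (1 : ℝ) ≤ N := by exact_mod_cast hN
  have hc0 : 0 ≤ c := by rw [hc, rate]; have := dev_nonneg hγ t N; positivity
  have hc1 : |(-c)| ≤ (R.card : ℝ) - 1 := by
    rw [abs_neg, abs_of_nonneg hc0, hc, rate]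
    have := dev_nonneg hγ t N
    nlinarith
  have hV : ∑ k ∈ Ico N R.card, 1 / (k : ℝ) ^ 2 = ∑ k ∈ Ico N (R.card - 1), 1 / (k : ℝ) ^ 2 +
      1 / ((R.card : ℝ) - 1) ^ 2 := by
    obtain ⟨r, hr⟩ : ∃ r, R.card = r + 1 := ⟨R.card - 1, by omega⟩
    rw [hr, Finset.sum_Ico_succ_top (by omega)]
    simp
  set V := ∑ k ∈ Ico N (R.card - 1), 1 / (k : ℝ) ^ 2 with hVdef
  have h := sum_exp_mean_erase_le (by omega) hy hc1
  calc ∑ s ∈ R, devTerm γ t N y (R.erase s)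
      = Real.exp (-c * dev γ t N + c ^ 2 * V) * ∑ s ∈ R, Real.exp (-c * mean y (R.erase s)) := by
        rw [Finset.mul_sum]
        refine Finset.sum_congr rfl fun s hs => ?_
        rw [devTerm, Finset.card_erase_of_mem hs, ← Real.exp_add, ← hc, ← hVdef]
        congr 1
        ring
    _ ≤ Real.exp (-c * dev γ t N + c ^ 2 * V) * (R.card *
        Real.exp (-c * mean y R + (-c) ^ 2 * (1 / ((R.card : ℝ) - 1) ^ 2))) := by gcongr
    _ = R.card * devTerm γ t N y R := by
        rw [devTerm, hV, ← hc, mul_left_comm, ← Real.exp_add]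
        congr 2
        ring

/-- The terms with $N<|R|$ do not grow on average; the nonnegative term with $N=|R|$, if present,
disappears after the deletion. -/
theorem sum_devPot_erase_le {γ : ℝ} (hγ : 0 ≤ γ) (t : ℕ) {y : ι → σ → ℝ} {R : Finset σ}
    (hy : ∀ i, ∀ s ∈ R, ∀ s' ∈ R, y i s - y i s' ≤ 1) :
    ∑ s ∈ R, devPot γ t y (R.erase s) ≤ R.card * devPot γ t y R := by
  have h1 : ∀ s ∈ R, devPot γ t y (R.erase s) =
      ∑ N ∈ Icc 1 (R.card - 1) with dev γ t N ≤ 1, ∑ i, devTerm γ t N (y i) (R.erase s) := by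
    intro s hs
    rw [devPot, Finset.card_erase_of_mem hs]
  rw [Finset.sum_congr rfl h1, Finset.sum_comm, devPot, Finset.mul_sum]
  calc ∑ N ∈ Icc 1 (R.card - 1) with dev γ t N ≤ 1,
        ∑ s ∈ R, ∑ i, devTerm γ t N (y i) (R.erase s)
      ≤ ∑ N ∈ Icc 1 (R.card - 1) with dev γ t N ≤ 1, R.card * ∑ i, devTerm γ t N (y i) R := by
        refine Finset.sum_le_sum fun N hN => ?_
        simp only [Finset.mem_filter, Finset.mem_Icc] at hN
        rw [Finset.sum_comm, Finset.mul_sum]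
        exact Finset.sum_le_sum fun i _ => sum_devTerm_erase_le hγ t N hN.1.1 (by omega) hN.2 (hy i)
    _ ≤ _ := by
        refine Finset.sum_le_sum_of_subset_of_nonneg ?_ fun N _ _ => ?_
        · intro N hN
          simp only [Finset.mem_filter, Finset.mem_Icc] at hN ⊢
          exact ⟨⟨hN.1.1, by omega⟩, hN.2⟩
        · exact mul_nonneg (Nat.cast_nonneg _) (Finset.sum_nonneg fun _ _ => (Real.exp_pos _).le)

/-- In the term with $N=|R|$ the variance sum is empty, so a value below 1 says directly that the
mean exceeds $-$`dev`. If `dev` is larger than 1, there is no such term, but the claim is trivial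
since the values are at least $-1$. -/
theorem neg_mean_le_dev {γ : ℝ} (hγ : 0 < γ) {t : ℕ} {y : ι → σ → ℝ} {R : Finset σ}
    (ht : 0 < t) (hR : R.Nonempty) (hy : ∀ i, ∀ s ∈ R, -1 ≤ y i s) (h : devPot γ t y R < 1) (i : ι) :
    -mean (y i) R ≤ dev γ t R.card := by
  have hcard : (0 : ℝ) < R.card := by exact_mod_cast hR.card_pos
  rcases lt_or_ge 1 (dev γ t R.card) with h1 | h1
  · have : -(R.card : ℝ) ≤ ∑ s ∈ R, y i s := by
      have := Finset.sum_le_sum fun s (hs : s ∈ R) => hy i s hs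
      simpa using this
    have h2 : -1 ≤ mean (y i) R := by
      rw [mean, le_div_iff₀ hcard]
      linarith
    linarith
  · have h2 : devTerm γ t R.card (y i) R < 1 := by
      refine lt_of_le_of_lt ?_ h
      calc devTerm γ t R.card (y i) R ≤ ∑ i, devTerm γ t R.card (y i) R :=
            Finset.single_le_sum (f := fun i => devTerm γ t R.card (y i) R)
              (fun _ _ => (Real.exp_pos _).le) (Finset.mem_univ i)
        _ ≤ _ := Finset.single_le_sum (f := fun N => ∑ i, devTerm γ t N (y i) R)
              (fun _ _ => Finset.sum_nonneg fun _ _ => (Real.exp_pos _).le)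
              (by simp [h1, Nat.one_le_iff_ne_zero]; exact hR.ne_empty)
    rw [devTerm, Real.exp_lt_one_iff] at h2
    have hrate : 0 < rate γ t R.card := by
      unfold rate dev
      have : (0 : ℝ) < t := by exact_mod_cast ht
      positivity
    simp at h2
    nlinarith

theorem dev_sq {γ : ℝ} {t N : ℕ} (hN : 1 ≤ N) : dev γ t N ^ 2 * N = γ ^ 2 * t / 256 := by
  have : (1 : ℝ) ≤ N := by exact_mod_cast hN
  rw [dev, mul_pow, Real.sq_sqrt (by positivity)]
  field_simp
  ring

/-- With $c=dN/4$ and $\sum_{k\ge N}1/k^2\le2/N$ the exponent is at most $-d^2N/4+d^2N/8$, where $d$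
is the admitted deviation. As $d^2N=\gamma^2t/256$ for every $N$, all terms have the same bound. -/
theorem devPot_init_le {γ : ℝ} (hγ : 0 ≤ γ) {y : ι → σ → ℝ} {S : Finset σ}
    (hy : ∀ i, 0 ≤ ∑ s ∈ S, y i s) :
    devPot γ S.card y S ≤ S.card * Fintype.card ι * Real.exp (-(γ ^ 2 * S.card / 2048)) := by
  have h1 : ∀ N ∈ Icc 1 S.card, ∀ i, devTerm γ S.card N (y i) S ≤
      Real.exp (-(γ ^ 2 * S.card / 2048)) := by
    intro N hN i
    obtain ⟨hN1, hN2⟩ := Finset.mem_Icc.1 hN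
    have hN' : (1 : ℝ) ≤ N := by exact_mod_cast hN1
    rw [devTerm, Real.exp_le_exp]
    have hM : 0 ≤ mean (y i) S := div_nonneg (hy i) (Nat.cast_nonneg _)
    have hV : ∑ k ∈ Ico N S.card, 1 / (k : ℝ) ^ 2 ≤ 2 / (N : ℝ) := by
      have := sum_Ioo_inv_sq_le (α := ℝ) (N - 1) S.card
      have h2 : Ioo (N - 1) S.card = Ico N S.card := by
        ext k; simp only [Finset.mem_Ioo, Finset.mem_Ico]; omega
      rw [h2, Nat.cast_sub hN1] at this
      simpa using this
    have hd := dev_sq (γ := γ) (t := S.card) hN1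
    have hd0 := dev_nonneg hγ S.card N
    have hr0 : 0 ≤ rate γ S.card N := by unfold rate; positivity
    calc rate γ S.card N * (-mean (y i) S - dev γ S.card N) +
          rate γ S.card N ^ 2 * ∑ k ∈ Ico N S.card, 1 / (k : ℝ) ^ 2
        ≤ rate γ S.card N * (- dev γ S.card N) + rate γ S.card N ^ 2 * (2 / (N : ℝ)) := by
          gcongr
          linarith
      _ = -(dev γ S.card N ^ 2 * N) / 8 := by
          unfold rate
          field_simp
          ring_nf
      _ = _ := by rw [hd]; ring
  calc devPot γ S.card y S
      ≤ ∑ N ∈ Icc 1 S.card, ∑ i, devTerm γ S.card N (y i) S :=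
        Finset.sum_le_sum_of_subset_of_nonneg (Finset.filter_subset _ _)
          fun _ _ _ => Finset.sum_nonneg fun _ _ => (Real.exp_pos _).le
    _ ≤ ∑ N ∈ Icc 1 S.card, ∑ _i : ι, Real.exp (-(γ ^ 2 * S.card / 2048)) :=
        Finset.sum_le_sum fun N hN => Finset.sum_le_sum fun i _ => h1 N hN i
    _ = _ := by simp [mul_assoc]

/-- From $\sum_{N\le t}N^{-1/2}\le2\sqrt t$. The deviations needed for small remaining sets are
large, but their sum is still a small multiple of $\gamma t$. -/
theorem sum_dev_le {γ : ℝ} (hγ : 0 ≤ γ) (t : ℕ) : ∑ N ∈ Icc 1 t, dev γ t N ≤ γ * t / 8 := by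
  have h : ∀ m : ℕ, ∑ N ∈ Icc 1 m, 1 / √(N : ℝ) ≤ 2 * √m := by
    intro m
    induction m with
    | zero => simp
    | succ m ih =>
      rw [Finset.sum_Icc_succ_top (by omega)]
      have h1 : 0 < √((m + 1 : ℕ) : ℝ) := Real.sqrt_pos.2 (by positivity)
      have h2 := Real.sq_sqrt (show (0 : ℝ) ≤ ((m + 1 : ℕ) : ℝ) by positivity)
      have h3 := Real.sq_sqrt (show (0 : ℝ) ≤ (m : ℝ) by positivity)
      have h4 : 1 / √((m + 1 : ℕ) : ℝ) ≤ 2 * √((m + 1 : ℕ) : ℝ) - 2 * √m := by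
        rw [div_le_iff₀ h1]
        push_cast at h2 ⊢
        nlinarith [sq_nonneg (√((m : ℝ) + 1) - √m)]
      linarith
  calc ∑ N ∈ Icc 1 t, dev γ t N = γ / 16 * √t * ∑ N ∈ Icc 1 t, 1 / √(N : ℝ) := by
        rw [Finset.mul_sum]
        refine Finset.sum_congr rfl fun N _ => ?_
        rw [dev, Real.sqrt_div (by positivity)]
        ring
    _ ≤ γ / 16 * √t * (2 * √t) := by gcongr; exact h t
    _ = _ := by
        have := Real.mul_self_sqrt (show (0 : ℝ) ≤ t by positivity)
        linear_combination γ / 8 * this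

/-- The product of the weight factors. -/
noncomputable def wt (η : ℝ) (g : σ → κ → ι → ℝ) (D : Finset σ) (ρ : σ → κ) (i : ι) : ℝ :=
  ∏ s ∈ D, (1 - η * g s (ρ s) i)

/-- An upper bound for the probability of failure, given the facets of the elements outside `R`. -/
noncomputable def pot (γ : ℝ) (g : σ → κ → ι → ℝ) (ψ : σ → κ) (S R : Finset σ) (ρ : σ → κ) : ℝ :=
  (∑ i, wt (γ / 32) g (S \ R) ρ i) * (∏ N ∈ Icc 1 R.card, (1 + γ / 32 * dev γ S.card N)) *
    Real.exp (-(3 * γ ^ 2 * S.card / 512)) + devPot γ S.card (fun i s => g s (ψ s) i) R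

variable {γ : ℝ} {g : σ → κ → ι → ℝ} {ψ ρ : σ → κ} {S R : Finset σ}

theorem wt_pos (hγ : 0 ≤ γ) (hγ1 : γ ≤ 1) (hg : ∀ s j i, |g s j i| ≤ 1) (D : Finset σ) (ρ : σ → κ)
    (i : ι) : 0 < wt (γ / 32) g D ρ i := by
  refine Finset.prod_pos fun s _ => ?_
  have := (abs_le.1 (hg s (ρ s) i)).2
  nlinarith

theorem wt_update (hRS : R ⊆ S) {s : σ} (hs : s ∈ R) (ρ : σ → κ) (j : κ) (η : ℝ) (i : ι) :
    wt η g (S \ R.erase s) (Function.update ρ s j) i =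
      wt η g (S \ R) ρ i * (1 - η * g s j i) := by
  rw [Finset.sdiff_erase (hRS hs), wt, wt, Finset.prod_insert (by simp [hs]),
    Function.update_self, mul_comm]
  congr 1
  refine Finset.prod_congr rfl fun s' hs' => ?_
  rw [Function.update_of_ne]
  rintro rfl
  exact (Finset.mem_sdiff.1 hs').2 hs

/-- The greedy choice keeps the bound for the probability of failure. -/
theorem sum_pot_le (hγ : 0 < γ) (hγ1 : γ ≤ 1) (hg : ∀ s j i, |g s j i| ≤ 1)
    (hg' : ∀ s j s' j' i, g s j i - g s' j' i ≤ 1) (hRS : R ⊆ S) (hR : R.Nonempty)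
    (hpot : pot γ g ψ S R ρ < 1) (d : σ → κ)
    (hd : ∀ s j, ∑ i, wt (γ / 32) g (S \ R) ρ i * g s j i ≤
      ∑ i, wt (γ / 32) g (S \ R) ρ i * g s (d s) i) :
    ∑ s ∈ R, pot γ g ψ S (R.erase s) (Function.update ρ s (d s)) ≤ R.card * pot γ g ψ S R ρ := by
  set w := wt (γ / 32) g (S \ R) ρ with hw
  have hw0 : ∀ i, 0 < w i := wt_pos hγ.le hγ1 hg _ _
  have hcard := hR.card_pos
  have hS : 0 < S.card := hcard.trans_le (Finset.card_le_card hRS)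
  have hprod : ∀ r : ℕ, 0 ≤ ∏ N ∈ Icc 1 r, (1 + γ / 32 * dev γ S.card N) := fun r =>
    Finset.prod_nonneg fun N _ => by have := dev_nonneg hγ.le S.card N; positivity
  -- The weight part is nonnegative, so a potential below 1 controls the deviations of the present
  -- remaining set.
  have hdev : devPot γ S.card (fun i s => g s (ψ s) i) R < 1 := by
    refine lt_of_le_of_lt ?_ hpot
    rw [pot]
    have : 0 ≤ (∑ i, w i) * (∏ N ∈ Icc 1 R.card, (1 + γ / 32 * dev γ S.card N)) *
        Real.exp (-(3 * γ ^ 2 * S.card / 512)) :=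
      mul_nonneg (mul_nonneg (Finset.sum_nonneg fun i _ => (hw0 i).le) (hprod _)) (Real.exp_pos _).le
    linarith
  have hmean := neg_mean_le_dev hγ hS hR (fun i s _ => (abs_le.1 (hg s (ψ s) i)).1) hdev
  -- The greedy facet is no worse than $\psi$ for every single $s$. Averaged over $s\in R$,
  -- following $\psi$ multiplies the weight of $i$ by $1-\frac{\gamma}{32}\cdot$(mean gain), at most
  -- the factor that the product in `pot` loses in this round.
  have hstep : ∑ s ∈ R, ∑ i, w i * (1 - γ / 32 * g s (d s) i) ≤
      R.card * ((∑ i, w i) * (1 + γ / 32 * dev γ S.card R.card)) := by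
    calc ∑ s ∈ R, ∑ i, w i * (1 - γ / 32 * g s (d s) i)
        ≤ ∑ s ∈ R, ∑ i, w i * (1 - γ / 32 * g s (ψ s) i) := by
          refine Finset.sum_le_sum fun s _ => ?_
          have h1 : ∀ j, ∑ i, w i * (1 - γ / 32 * g s j i) =
              ∑ i, w i - γ / 32 * ∑ i, w i * g s j i := by
            intro j
            rw [Finset.mul_sum, ← Finset.sum_sub_distrib]
            exact Finset.sum_congr rfl fun i _ => by ring
          rw [h1, h1]
          have := hd s (ψ s)
          gcongr
      _ = ∑ i, w i * (R.card * (1 - γ / 32 * mean (fun s => g s (ψ s) i) R)) := by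
          rw [Finset.sum_comm]
          refine Finset.sum_congr rfl fun i _ => ?_
          rw [← Finset.mul_sum, Finset.sum_sub_distrib, ← Finset.mul_sum, mean]
          congr 1
          have : (R.card : ℝ) ≠ 0 := by positivity
          field_simp
          simp [mul_comm]
      _ ≤ ∑ i, w i * (R.card * (1 + γ / 32 * dev γ S.card R.card)) := by
          gcongr with i _
          · exact (hw0 i).le
          · nlinarith [hmean i]
      _ = _ := by rw [← Finset.sum_mul]; ring
  have hcr : Icc 1 R.card = insert R.card (Icc 1 (R.card - 1)) := by
    ext k; simp only [Finset.mem_insert, Finset.mem_Icc]; omega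
  simp only [pot]
  rw [Finset.sum_add_distrib, mul_add]
  refine add_le_add ?_ (sum_devPot_erase_le hγ.le _ fun i s _ s' _ => hg' _ _ _ _ _)
  have h1 : ∀ s ∈ R, (∑ i, wt (γ / 32) g (S \ R.erase s) (Function.update ρ s (d s)) i) *
      (∏ N ∈ Icc 1 (R.erase s).card, (1 + γ / 32 * dev γ S.card N)) *
      Real.exp (-(3 * γ ^ 2 * S.card / 512)) = (∑ i, w i * (1 - γ / 32 * g s (d s) i)) *
      ((∏ N ∈ Icc 1 (R.card - 1), (1 + γ / 32 * dev γ S.card N)) *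
      Real.exp (-(3 * γ ^ 2 * S.card / 512))) := by
    intro s hs
    rw [Finset.card_erase_of_mem hs, mul_assoc]
    congr 1
    exact Finset.sum_congr rfl fun i _ => wt_update hRS hs ρ _ _ i
  rw [Finset.sum_congr rfl h1, ← Finset.sum_mul, hcr, Finset.prod_insert (by simp)]
  refine (mul_le_mul_of_nonneg_right hstep (mul_nonneg (hprod _) (Real.exp_pos _).le)).trans_eq ?_
  ring

/-- The product is at most $e^{\gamma^2t/256}$, by `sum_dev_le`, against the factor
$e^{-3\gamma^2t/512}$. What is left, $e^{-\gamma^2t/512}$, beats the number of constraints, and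
`devPot` is small by `devPot_init_le`; each part is at most $1/4$. -/
theorem pot_init_le (hγ : 0 < γ) (hψ : ∀ i, 0 ≤ ∑ s ∈ S, g s (ψ s) i) (ρ : σ → κ)
    (hS : S.card ≤ Fintype.card ι)
    (hbig : 2048 * Real.log (4 * (Fintype.card ι : ℝ) ^ 2) ≤ γ ^ 2 * S.card)
    (hpos : 0 < Fintype.card ι) :
    pot γ g ψ S S ρ ≤ 1 / 2 := by
  set n : ℝ := (Fintype.card ι : ℝ) with hn
  have hn1 : 1 ≤ n := by rw [hn]; exact_mod_cast hpos
  set a := γ ^ 2 * S.card with ha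
  have ha0 : 0 ≤ a := by positivity
  have hexp : Real.exp (-(a / 2048)) ≤ 1 / (4 * n ^ 2) := by
    rw [← Real.exp_log (show 0 < 1 / (4 * n ^ 2) by positivity), Real.exp_le_exp, one_div,
      Real.log_inv]
    linarith
  have hdev := devPot_init_le hγ.le (y := fun i s => g s (ψ s) i) hψ
  have hS' : (S.card : ℝ) ≤ n := by rw [hn]; exact_mod_cast hS
  have h1 : devPot γ S.card (fun i s => g s (ψ s) i) S ≤ 1 / 4 := by
    refine hdev.trans ?_
    calc (S.card : ℝ) * n * Real.exp (-(a / 2048)) ≤ n * n * (1 / (4 * n ^ 2)) := by gcongr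
      _ = 1 / 4 := by field_simp
  have hprod : ∏ N ∈ Icc 1 S.card, (1 + γ / 32 * dev γ S.card N) ≤ Real.exp (a / 256) := by
    calc ∏ N ∈ Icc 1 S.card, (1 + γ / 32 * dev γ S.card N)
        ≤ ∏ N ∈ Icc 1 S.card, Real.exp (γ / 32 * dev γ S.card N) :=
          Finset.prod_le_prod (fun N _ => by have := dev_nonneg hγ.le S.card N; positivity)
            fun N _ => by linarith [Real.add_one_le_exp (γ / 32 * dev γ S.card N)]
      _ = Real.exp (γ / 32 * ∑ N ∈ Icc 1 S.card, dev γ S.card N) := by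
          rw [Finset.mul_sum, Real.exp_sum]
      _ ≤ _ := by
          rw [Real.exp_le_exp]
          nlinarith [sum_dev_le hγ.le S.card]
  have h2 : (∑ i, wt (γ / 32) g (S \ S) ρ i) *
      (∏ N ∈ Icc 1 S.card, (1 + γ / 32 * dev γ S.card N)) *
        Real.exp (-(3 * γ ^ 2 * S.card / 512)) ≤ 1 / 4 := by
    have h3 : ∑ i, wt (γ / 32) g (S \ S) ρ i = n := by simp [wt, hn]
    rw [h3]
    calc n * (∏ N ∈ Icc 1 S.card, (1 + γ / 32 * dev γ S.card N)) *
          Real.exp (-(3 * γ ^ 2 * S.card / 512))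
        ≤ n * Real.exp (a / 256) * Real.exp (-(3 * γ ^ 2 * S.card / 512)) := by gcongr
      _ = n * Real.exp (-(a / 512)) := by
          rw [mul_assoc, ← Real.exp_add]
          congr 2
          rw [ha]; ring
      _ ≤ n * Real.exp (-(a / 2048)) := by
          gcongr
          linarith
      _ ≤ n * (1 / (4 * n ^ 2)) := by gcongr
      _ ≤ 1 / 4 := by
          rw [mul_one_div, div_le_div_iff₀ (by positivity) (by norm_num)]
          nlinarith
  rw [pot]
  linarith

theorem exp_le_one_sub {x : ℝ} (hx : |x| ≤ 1 / 2) : Real.exp (-x - 2 * x ^ 2) ≤ 1 - x := by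
  obtain ⟨h1, h2⟩ := abs_le.1 hx
  have h3 : 0 < 1 - x := by linarith
  rw [← Real.le_log_iff_exp_le h3]
  have h := Real.one_sub_inv_le_log_of_pos h3
  refine le_trans ?_ h
  have h4 : 1 - (1 - x)⁻¹ = -x / (1 - x) := by field_simp; ring
  rw [h4, le_div_iff₀ h3]
  nlinarith [sq_nonneg x]

/-- A violated constraint has a large weight: $1-x\ge e^{-x-2x^2}$ gives the exponent
$\frac{\gamma}{32}\cdot\frac{\gamma t}{4}-2(\frac{\gamma}{32})^2t=\frac{3\gamma^2t}{512}$. This is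
where the normalization in `pot` comes from. -/
theorem lt_of_pot_lt_one (hγ : 0 < γ) (hγ1 : γ ≤ 1) (hg : ∀ s j i, |g s j i| ≤ 1)
    (h : pot γ g ψ S ∅ ρ < 1) (i : ι) : -(γ / 4 * S.card) < ∑ s ∈ S, g s (ρ s) i := by
  by_contra! hcon
  have hw0 : ∀ i, 0 < wt (γ / 32) g S ρ i := wt_pos hγ.le hγ1 hg _ _
  have h1 : (∑ i, wt (γ / 32) g S ρ i) * Real.exp (-(3 * γ ^ 2 * S.card / 512)) < 1 := by
    refine lt_of_le_of_lt ?_ h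
    rw [pot]
    simpa using devPot_nonneg γ S.card (fun i s => g s (ψ s) i) ∅
  have h2 : Real.exp (3 * γ ^ 2 * S.card / 512) ≤ wt (γ / 32) g S ρ i := by
    calc Real.exp (3 * γ ^ 2 * S.card / 512)
        ≤ Real.exp (∑ s ∈ S, (-(γ / 32 * g s (ρ s) i) - 2 * (γ / 32) ^ 2)) := by
          rw [Real.exp_le_exp, Finset.sum_sub_distrib, Finset.sum_neg_distrib, ← Finset.mul_sum,
            Finset.sum_const, nsmul_eq_mul]
          nlinarith
      _ = ∏ s ∈ S, Real.exp (-(γ / 32 * g s (ρ s) i) - 2 * (γ / 32) ^ 2) := Real.exp_sum _ _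
      _ ≤ _ := by
          refine Finset.prod_le_prod (fun _ _ => (Real.exp_pos _).le) fun s _ => ?_
          have hgs := hg s (ρ s) i
          have h3 : |γ / 32 * g s (ρ s) i| ≤ γ / 32 := by
            rw [abs_mul, abs_of_pos (by positivity : 0 < γ / 32)]
            nlinarith
          refine le_trans ?_ (exp_le_one_sub (h3.trans (by linarith)))
          rw [Real.exp_le_exp]
          have := sq_le_sq' (abs_le.1 h3).1 (abs_le.1 h3).2
          linarith
  have h3 : wt (γ / 32) g S ρ i ≤ ∑ i, wt (γ / 32) g S ρ i :=
    Finset.single_le_sum (fun i _ => (hw0 i).le) (Finset.mem_univ i)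
  have h4 : (1 : ℝ) ≤ (∑ i, wt (γ / 32) g S ρ i) * Real.exp (-(3 * γ ^ 2 * S.card / 512)) := by
    calc (1 : ℝ) = Real.exp (3 * γ ^ 2 * S.card / 512) * Real.exp (-(3 * γ ^ 2 * S.card / 512)) := by
          rw [← Real.exp_add]; simp
      _ ≤ _ := by gcongr; exact h2.trans h3
  linarith

end RandomOrder

/-! ### Success of the assignment phase: guessed and greedy facets -/

namespace RandRAM

open scoped ENNReal

variable {n f : ℕ} {π : MultiAffinity n f} {l : ℕ} {α β : ℝ} {S : Finset (Fin n)} {m : Mem}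

theorem Listed.assigning (h : Listed f l α β S m) (F : ℕ) (ρ : Fin n → Fin f) :
    ∃ m', Det (inputTable π) initWeights (m.setN 18 F) (n * 9 + 5) m' ∧
      Assigning π l F α β S S ρ m' := by
  refine ⟨_, (det_initWeights (m.setN 18 F)).mono (by simp [h.size]) rfl, ?_, ?_, ?_, ?_, ?_,
    subset_rfl, ?_, ?_, ?_, ?_, ?_, ?_, ?_, ?_⟩
  · simp [h.size]
  · simp [h.facets]
  · simp [h.depth]
  · simp [h.length]
  · simp
  · simpa using h.indicator
  · simpa using h.list_mem
  · simpa using h.list_surj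
  · simpa using h.marks
  · exact fun s hs hs' => absurd hs hs'
  · intro i
    by_cases hi : i ∈ S <;> simp [h.size, h.indicator, hi, side, weight]
  · intro i
    by_cases hi : i ∈ S <;> simp [h.size, h.indicator, hi, side, h.upper, h.lower]
  · intro i
    by_cases hi : i ∈ S <;> simp [h.size, h.indicator, hi, level, h.upper, h.lower]

/-- The output is the set `S` with the facets `ρ`. -/
def Assigned (S : Finset (Fin n)) (ρ : Fin n → Fin f) (m : Mem) : Prop :=
  (∀ i : Fin n, m.narr 0 i = if i ∈ S then 1 else 0) ∧ ∀ s ∈ S, m.narr 1 s = (ρ s).val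

/-- A time bound for the assignment phase. -/
def assignTime (n f : ℕ) : ℕ := n * (f * (n * 8 + 15) + n * 14 + 25) + n * 9 + 20

/-- `v R ρ` serves as a lower bound for the conditional probability of success when the members in
`R` are still to come; `hstep` says that it does not exceed its average after one round. The factor
$1/(f+1)$ is the price of drawing the mode `F`. -/
theorem reach_assignAll (h : Listed f l α β S m) (hl : l ≤ n) (hf : 1 ≤ f) {F : ℕ}
    (hF : F = 0 ∨ F = f) (P : (Fin n → Fin f) → Prop)
    (v : Finset (Fin n) → (Fin n → Fin f) → ℝ≥0∞)
    (hdone : ∀ ρ, v ∅ ρ ≤ 1) (hP : ∀ ρ, v ∅ ρ ≠ 0 → P ρ)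
    (hstep : ∀ R ρ, R.Nonempty → R ⊆ S → ∀ c : Fin n → Fin f → Fin f,
      (F = 0 → ∀ s b, c s b = b) →
      (F = f → ∀ s b j', merit π l S α β (weight π l S α β (S \ R) ρ) s j' ≤
        merit π l S α β (weight π l S α β (S \ R) ρ) s (c s b)) →
      v R ρ ≤ (∑ s ∈ R, (∑ b, v (R.erase s) (Function.update ρ s (c s b))) / f) / R.card)
    (ρ : Fin n → Fin f) :
    Reach (inputTable π) assignAll m (assignTime n f) (ENNReal.ofReal (1 / (f + 1)) * v S ρ)
      (fun m' => ∃ ρ, P ρ ∧ Assigned S ρ m') := by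
  have hFf : F ≤ f := by omega
  have hcard : S.card ≤ n := by simpa using S.card_le_univ
  obtain ⟨m₁, hdet, hm₁⟩ := h.assigning (π := π) F ρ
  have hdraw := Reach.draw (inp := inputTable π) (v := 18) (e := .var 1) (m := m) (a := F)
    (by simpa [NExp.val, h.facets] using hFf)
  rw [show NExp.val (inputTable π) m (.var 1) = f from h.facets, ofReal_inv_nat_succ] at hdraw
  refine (hdraw.seq (T₂ := n * 9 + 5 + (S.card * (f * (n * 8 + 15) + n * 14 + 25) + 1) + 1)
    (p₂ := v S ρ) ?_).mono ?_ le_rfl fun _ h => h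
  · rintro _ rfl
    refine hdet.seq_reach fun Q x hx => ?_
    refine tri_assignLoop hl hf hF (fun R ρ => v R ρ * x) (fun ρ m' hm' => ?_) ?_ S.card S ρ m₁ rfl
      hm₁
    · rcases eq_or_ne (v ∅ ρ) 0 with h0 | h0
      · simp [h0]
      · refine le_trans ?_ (hx m' ⟨ρ, hP ρ h0, hm'.indicator, fun s hs => hm'.chosen s hs (by simp)⟩)
        simpa using mul_le_mul_left (hdone ρ) x
    · intro R ρ hR hRS c h0 h1
      refine (mul_le_mul_left (hstep R ρ hR hRS c h0 h1) x).trans_eq ?_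
      simp only [div_eq_mul_inv, ← Finset.sum_mul]
      ring
  · have := Nat.mul_le_mul_right (f * (n * 8 + 15) + n * 14 + 25) hcard
    unfold assignTime
    omega

/-- Mode `F = 0`: as long as all facets agree with `ψ`, the chance is $f^{-1}$ for each member still
to come, whatever the order. -/
theorem reach_assignAll_guess (h : Listed f l α β S m) (hl : l ≤ n) (hf : 1 ≤ f)
    (ψ : Fin n → Fin f) :
    Reach (inputTable π) assignAll m (assignTime n f)
      (ENNReal.ofReal (1 / (f + 1) * (1 / f) ^ S.card)) (Assigned S ψ) := by
  classical
  have hf0 : (f : ℝ≥0∞) ≠ 0 := by simp; omega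
  refine (reach_assignAll h hl hf (Or.inl rfl) (fun ρ => ∀ s ∈ S, ρ s = ψ s)
    (fun R ρ => if ∀ s ∈ S, s ∉ R → ρ s = ψ s then (f : ℝ≥0∞)⁻¹ ^ R.card else 0) ?_ ?_ ?_
      ψ).mono le_rfl ?_ ?_
  · intro ρ
    split_ifs <;> simp
  · intro ρ hρ
    by_contra hcon
    simp [hcon] at hρ
  · intro R ρ hR hRS c hc _
    split_ifs with hρ
    · have hR0 : (R.card : ℝ≥0∞) ≠ 0 := by simpa using hR.ne_empty
      rw [ENNReal.le_div_iff_mul_le (Or.inl hR0) (Or.inl (by simp))]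
      calc (f : ℝ≥0∞)⁻¹ ^ R.card * R.card = ∑ _s ∈ R, (f : ℝ≥0∞)⁻¹ ^ R.card := by simp [mul_comm]
        _ ≤ _ := by
          refine Finset.sum_le_sum fun s hs => ?_
          rw [ENNReal.le_div_iff_mul_le (Or.inl hf0) (Or.inl (by simp))]
          refine le_trans ?_ (Finset.single_le_sum (f := fun b => if ∀ s' ∈ S, s' ∉ R.erase s →
            Function.update ρ s (c s b) s' = ψ s' then (f : ℝ≥0∞)⁻¹ ^ (R.erase s).card else 0)
            (fun _ _ => zero_le) (Finset.mem_univ (ψ s)))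
          rw [if_pos, Finset.card_erase_of_mem hs]
          · obtain ⟨k, hk⟩ : ∃ k, R.card = k + 1 := ⟨R.card - 1, by have := hR.card_pos; omega⟩
            rw [hk, pow_succ, mul_assoc, ENNReal.inv_mul_cancel hf0 (by simp), mul_one]
            simp
          · intro s' hs' hs'R
            rcases eq_or_ne s' s with rfl | hne
            · simp [hc rfl]
            · rw [Function.update_of_ne hne]
              exact hρ s' hs' fun h' => hs'R (Finset.mem_erase.2 ⟨hne, h'⟩)
    · exact zero_le
  · rw [ENNReal.ofReal_mul (by positivity), if_pos (fun s hs hs' => absurd hs hs'),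
      ENNReal.ofReal_pow (by positivity), one_div (f : ℝ),
      ENNReal.ofReal_inv_of_pos (by exact_mod_cast hf), ENNReal.ofReal_natCast]
  · rintro m' ⟨ρ, hρ, h1, h2⟩
    exact ⟨h1, fun s hs => by rw [h2 s hs, hρ s hs]⟩

theorem abs_gain_le (hβ : 0 ≤ β) (hβα : β < α) (hα : α ≤ 1) (s : Fin n) (j : Fin f) (i : Fin n) :
    |gain π l S α β s j i| ≤ 1 := by
  rw [gain, abs_mul, side, level]
  split_ifs <;> simp [abs_le] <;> constructor <;> linarith

theorem gain_sub_gain_le (s s' : Fin n) (j j' : Fin f) (i : Fin n) :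
    gain π l S α β s j i - gain π l S α β s' j' i ≤ 1 := by
  rw [gain, gain, side, level]
  split_ifs <;> linarith

theorem sum_gain (ρ : Fin n → Fin f) (i : Fin n) :
    ∑ s ∈ S, gain π l S α β s (ρ s) i =
      side S i * (supportCount π l ρ S i - level S α β i * S.card) := by
  simp only [gain, ← Finset.mul_sum, Finset.sum_sub_distrib, supportCount, Finset.card_filter]
  push_cast
  simp [mul_comm]

theorem ofReal_sum_le {ι : Type*} (s : Finset ι) (x : ι → ℝ) :
    ENNReal.ofReal (∑ i ∈ s, x i) ≤ ∑ i ∈ s, ENNReal.ofReal (x i) :=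
  Finset.le_sum_of_subadditive ENNReal.ofReal ENNReal.ofReal_zero.le
    (fun _ _ => ENNReal.ofReal_add_le) s x

/-- Mode `F = f` with one minus the potential as the bound for success. The facets `ψ` occur only in
the analysis; the program never knows them. -/
theorem reach_assignAll_greedy (h : Listed f l α β S m) (hl : l ≤ n) (hf : 1 ≤ f) (hn : 1 ≤ n)
    (hβ : 0 ≤ β) (hβα : β < α) (hα : α ≤ 1) (ψ : Fin n → Fin f)
    (hin : ∀ i ∈ S, α * S.card ≤ supportCount π l ψ S i)
    (hout : ∀ i ∉ S, (supportCount π l ψ S i : ℝ) < β * S.card)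
    (hbig : 2048 * Real.log (4 * (n : ℝ) ^ 2) ≤ (α - β) ^ 2 * S.card) :
    Reach (inputTable π) assignAll m (assignTime n f) (ENNReal.ofReal (1 / (f + 1) * (1 / 2)))
      (fun m' => ∃ ρ : Fin n → Fin f, Assigned S ρ m' ∧
        (∀ i ∈ S, (α - (α - β) / 4) * S.card ≤ supportCount π l ρ S i) ∧
        ∀ i ∉ S, (supportCount π l ρ S i : ℝ) < (β + (α - β) / 4) * S.card) := by
  set γ := α - β with hγdef
  have hγ : 0 < γ := by linarith
  have hγ1 : γ ≤ 1 := by linarith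
  set g := gain π l S α β with hg
  have hcard : S.card ≤ Fintype.card (Fin n) := S.card_le_univ
  refine (reach_assignAll h hl hf (Or.inr rfl)
    (fun ρ => RandomOrder.pot γ g ψ S ∅ ρ < 1)
    (fun R ρ => ENNReal.ofReal (1 - RandomOrder.pot γ g ψ S R ρ)) ?_ ?_ ?_ ψ).mono le_rfl ?_ ?_
  · intro ρ
    rw [← ENNReal.ofReal_one]
    refine ENNReal.ofReal_le_ofReal ?_
    have h1 : 0 ≤ RandomOrder.pot γ g ψ S ∅ ρ := by
      rw [RandomOrder.pot]
      refine add_nonneg (mul_nonneg (mul_nonneg (Finset.sum_nonneg fun i _ =>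
        (RandomOrder.wt_pos hγ.le hγ1 (fun s j i => abs_gain_le hβ hβα hα s j i) _ _ _).le) ?_)
        (Real.exp_pos _).le) (RandomOrder.devPot_nonneg _ _ _ _)
      simp
    linarith
  · intro ρ hρ
    by_contra! hcon
    exact hρ (ENNReal.ofReal_of_nonpos (by linarith))
  · intro R ρ hR hRS c _ hc
    -- Once the potential has reached 1 the bound is 0 and nothing has to be shown, so the
    -- supermartingale property is needed only below 1.
    rcases le_or_gt 1 (RandomOrder.pot γ g ψ S R ρ) with h1 | h1
    · rw [ENNReal.ofReal_of_nonpos (by linarith)]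
      exact zero_le
    have hf' : (0 : ℝ) < f := by exact_mod_cast hf
    have hR' : (0 : ℝ) < R.card := by exact_mod_cast hR.card_pos
    set p : Fin n → Fin f → ℝ := fun s b =>
      RandomOrder.pot γ g ψ S (R.erase s) (Function.update ρ s (c s b)) with hp
    have hsum : ∀ b, ∑ s ∈ R, p s b ≤ R.card * RandomOrder.pot γ g ψ S R ρ := fun b =>
      RandomOrder.sum_pot_le hγ hγ1 (fun s j i => abs_gain_le hβ hβα hα s j i)
        (fun s j s' j' i => gain_sub_gain_le s s' j j' i) hRS hR h1 (fun s => c s b)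
        fun s j => hc rfl s b j
    have key : 1 - RandomOrder.pot γ g ψ S R ρ ≤
        (∑ s ∈ R, (∑ b, (1 - p s b)) / f) / R.card := by
      rw [← Finset.sum_div, Finset.sum_comm, le_div_iff₀ hR', le_div_iff₀ hf']
      calc (1 - RandomOrder.pot γ g ψ S R ρ) * R.card * f
          = ∑ _b : Fin f, (R.card - R.card * RandomOrder.pot γ g ψ S R ρ) := by
            simp; ring
        _ ≤ ∑ b, ∑ s ∈ R, (1 - p s b) := by
            refine Finset.sum_le_sum fun b _ => ?_
            rw [Finset.sum_sub_distrib]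
            have := hsum b
            simp only [Finset.sum_const, nsmul_eq_mul, mul_one]
            linarith
    refine (ENNReal.ofReal_le_ofReal key).trans ?_
    rw [ENNReal.ofReal_div_of_pos hR', ENNReal.ofReal_natCast]
    gcongr
    refine (ofReal_sum_le _ _).trans (Finset.sum_le_sum fun s _ => ?_)
    rw [ENNReal.ofReal_div_of_pos hf', ENNReal.ofReal_natCast]
    gcongr
    exact ofReal_sum_le _ _
  · rw [ENNReal.ofReal_mul (by positivity)]
    gcongr
    have := RandomOrder.pot_init_le (γ := γ) (g := g) (ψ := ψ) (S := S) hγ (fun i => ?_) ψ hcard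
      (by simpa using hbig) (by simpa using Nat.pos_of_ne_zero (by omega))
    · linarith
    · rw [hg, sum_gain, side, level]
      split_ifs with hi
      · linarith [hin i hi]
      · linarith [hout i hi]
  · rintro m' ⟨ρ, hρ, hm'⟩
    refine ⟨ρ, hm', fun i hi => ?_, fun i hi => ?_⟩
    all_goals
      have h1 := RandomOrder.lt_of_pot_lt_one hγ hγ1 (fun s j i => abs_gain_le hβ hβα hα s j i) hρ i
      rw [sum_gain, side, level] at h1
      simp only [hi, if_true, if_false] at h1
      linarith

end RandRAM

namespace RandRAM

open Finset

/-! ### Random samples -/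

section chernoff

variable {V : Type*}

/-- A Chernoff bound for sampling with replacement. -/
theorem card_upper_tail_le {A : Finset V} (hA : A.Nonempty) (p : V → Prop) [DecidablePred p]
    {μ ε : ℝ} (hμ : ((A.filter p).card : ℝ) ≤ μ * A.card) (hε : 0 ≤ ε) (hε1 : ε ≤ 1) (k : ℕ) :
    (((Fintype.piFinset fun _ : Fin k => A).filter fun x =>
      (μ + ε) * k ≤ (univ.filter fun q => p (x q)).card).card : ℝ) ≤
        A.card ^ k * Real.exp (-(k * ε ^ 2 / 4)) := by
  have hA0 : (0 : ℝ) < A.card := by exact_mod_cast hA.card_pos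
  set ν : ℝ := (A.filter p).card / A.card with hν
  have hνμ : ν ≤ μ := by rw [hν, div_le_iff₀ hA0]; exact hμ
  have hν0 : 0 ≤ ν := by positivity
  have hν1 : ν ≤ 1 := by
    rw [hν, div_le_one hA0]; exact_mod_cast card_filter_le _ _
  let y : V → ℝ := fun s => (if p s then 1 else 0) - ν
  have hy : ∀ s, |y s| ≤ 1 := by
    intro s
    simp only [y]
    split_ifs <;> rw [abs_le] <;> constructor <;> linarith
  have hysum : ∑ s ∈ A, y s = 0 := by
    simp only [y]
    rw [sum_sub_distrib, sum_const, nsmul_eq_mul, ← natCast_card_filter, hν]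
    field_simp
    ring
  have hmgf : ∑ s ∈ A, Real.exp (ε / 2 * y s) ≤ A.card * Real.exp ((ε / 2) ^ 2) := by
    calc ∑ s ∈ A, Real.exp (ε / 2 * y s)
        ≤ ∑ s ∈ A, (1 + ε / 2 * y s + (ε / 2) ^ 2) := by
          refine sum_le_sum fun s _ => ?_
          have h1 : |ε / 2 * y s| ≤ 1 := by
            rw [abs_mul, abs_of_nonneg (by positivity : 0 ≤ ε / 2)]
            nlinarith [hy s, abs_nonneg (y s)]
          have h2 : y s ^ 2 ≤ 1 := by
            rw [← sq_abs]; nlinarith [hy s, abs_nonneg (y s)]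
          refine (RandomOrder.exp_le_one_add_add_sq h1).trans ?_
          nlinarith [sq_nonneg (ε / 2)]
      _ = A.card * (1 + (ε / 2) ^ 2) := by
          rw [sum_add_distrib, sum_add_distrib, ← mul_sum, hysum]
          simp; ring
      _ ≤ _ := by
          gcongr
          linarith [Real.add_one_le_exp ((ε / 2) ^ 2)]
  have hprod : ∑ x ∈ Fintype.piFinset (fun _ : Fin k => A), Real.exp (ε / 2 * ∑ q, y (x q)) ≤
      (A.card * Real.exp ((ε / 2) ^ 2)) ^ k := by
    have h1 : ∀ x : Fin k → V, Real.exp (ε / 2 * ∑ q, y (x q)) =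
        ∏ q, Real.exp (ε / 2 * y (x q)) := by
      intro x; rw [mul_sum, Real.exp_sum]
    simp only [h1]
    rw [sum_prod_piFinset A (fun _ s => Real.exp (ε / 2 * y s))]
    simp only [prod_const, card_univ, Fintype.card_fin]
    gcongr
  set B := (Fintype.piFinset fun _ : Fin k => A).filter fun x =>
      (μ + ε) * k ≤ (univ.filter fun q => p (x q)).card with hB
  -- Exponential Markov inequality with parameter $\varepsilon/2$: the gain $\varepsilon^2/2$ per
  -- voter exceeds the moment $\varepsilon^2/4$ by $\varepsilon^2/4$.
  have hmarkov : (B.card : ℝ) * Real.exp (ε / 2 * (ε * k)) ≤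
      (A.card * Real.exp ((ε / 2) ^ 2)) ^ k := by
    refine le_trans ?_ hprod
    rw [← nsmul_eq_mul, ← sum_const]
    refine (sum_le_sum fun x hx => ?_).trans (sum_le_sum_of_subset_of_nonneg (filter_subset _ _)
      fun _ _ _ => (Real.exp_pos _).le)
    rw [Real.exp_le_exp]
    have h1 : ∑ q, y (x q) = (univ.filter fun q => p (x q)).card - ν * k := by
      simp only [y]
      rw [sum_sub_distrib, ← natCast_card_filter]
      simp [mul_comm]
    have h2 := (mem_filter.1 hx).2
    rw [h1]
    have hk : (0 : ℝ) ≤ k := Nat.cast_nonneg k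
    gcongr
    nlinarith
  rw [← le_div_iff₀ (Real.exp_pos _)] at hmarkov
  refine hmarkov.trans_eq ?_
  rw [mul_pow, ← Real.exp_nat_mul, mul_div_assoc, ← Real.exp_sub]
  congr 2
  ring

theorem card_lower_tail_le {A : Finset V} (hA : A.Nonempty) (p : V → Prop) [DecidablePred p]
    {μ ε : ℝ} (hμ : μ * A.card ≤ ((A.filter p).card : ℝ)) (hε : 0 ≤ ε) (hε1 : ε ≤ 1) (k : ℕ) :
    (((Fintype.piFinset fun _ : Fin k => A).filter fun x =>
      ((univ.filter fun q => p (x q)).card : ℝ) ≤ (μ - ε) * k).card : ℝ) ≤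
        A.card ^ k * Real.exp (-(k * ε ^ 2 / 4)) := by
  have h1 : ((A.filter fun s => ¬ p s).card : ℝ) ≤ (1 - μ) * A.card := by
    have h := card_filter_add_card_filter_not (s := A) p
    have h' : ((A.filter p).card : ℝ) + (A.filter fun s => ¬ p s).card = A.card := by
      exact_mod_cast h
    linarith
  refine le_trans ?_ (card_upper_tail_le hA (fun s => ¬ p s) h1 hε hε1 k)
  refine Nat.cast_le.2 (card_le_card fun x hx => mem_filter.2 ⟨(mem_filter.1 hx).1, ?_⟩)
  have h2 := (mem_filter.1 hx).2
  have h := card_filter_add_card_filter_not (s := (univ : Finset (Fin k))) (fun q => p (x q))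
  have h' : ((univ.filter fun q => p (x q)).card : ℝ) + (univ.filter fun q => ¬ p (x q)).card = k := by
    rw [← Nat.cast_add, h]; simp
  linarith

end chernoff

/-! ### Errors of a sampled vote, and approximate electorates -/

variable {n f : ℕ}

/-- The votes of a sample. -/
def votesOf (π : MultiAffinity n f) (l : ℕ) (ρ : Fin n → Fin f) {k : ℕ} (x : Fin k → Fin n)
    (i : Fin n) : ℕ :=
  (univ.filter fun q => ((π (x q) (ρ (x q))).symm i).val < l).card

theorem votesOf_le (π : MultiAffinity n f) (l : ℕ) (ρ : Fin n → Fin f) {k : ℕ} (x : Fin k → Fin n)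
    (i : Fin n) : votesOf π l ρ x i ≤ k := by
  simpa [votesOf] using card_filter_le (univ : Finset (Fin k))
    (fun q => ((π (x q) (ρ (x q))).symm i).val < l)

/-- The members of `U` which a sample wrongly puts into `S` or outside `S`. -/
def errors (π : MultiAffinity n f) (l : ℕ) (ρ : Fin n → Fin f) (S U : Finset (Fin n)) (τ : ℕ)
    {k : ℕ} (x : Fin k → Fin n) : Finset (Fin n) :=
  U.filter fun i => ¬ (i ∈ S ↔ τ ≤ votesOf π l ρ x i)

/-- The support for the members of `U` inside and outside `S` differs clearly. -/
def Separated (π : MultiAffinity n f) (l : ℕ) (ρ : Fin n → Fin f) (S U A : Finset (Fin n))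
    (μ ε : ℝ) : Prop :=
  ∀ i ∈ U, (i ∈ S → (μ + ε) * A.card ≤ supportCount π l ρ A i) ∧
    (i ∉ S → (supportCount π l ρ A i : ℝ) ≤ (μ - ε) * A.card)

variable {π : MultiAffinity n f} {l : ℕ} {ρ : Fin n → Fin f} {S U A : Finset (Fin n)} {μ ε : ℝ}

/-- A misjudged member of `U` has a vote count on the wrong side of $\mu k$, hence off its
expectation by at least $\varepsilon k$; one of the two Chernoff tails applies. -/
theorem card_error_le (hA : A.Nonempty) (h : Separated π l ρ S U A μ ε) (hε : 0 ≤ ε) (hε1 : ε ≤ 1)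
    (k : ℕ) {i : Fin n} (hi : i ∈ U) :
    (((Fintype.piFinset fun _ : Fin k => A).filter fun x =>
      i ∈ errors π l ρ S U ⌈μ * k⌉₊ x).card : ℝ) ≤ A.card ^ k * Real.exp (-(k * ε ^ 2 / 4)) := by
  by_cases hS : i ∈ S
  · refine le_trans ?_ (card_lower_tail_le hA (fun s => ((π s (ρ s)).symm i).val < l)
      ((h i hi).1 hS) hε hε1 k)
    gcongr with x hx
    intro h2
    simp only [errors, mem_filter, hS, true_iff, not_le, Nat.lt_ceil] at h2
    rw [add_sub_cancel_right]
    exact h2.2.le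
  · refine le_trans ?_ (card_upper_tail_le hA (fun s => ((π s (ρ s)).symm i).val < l)
      ((h i hi).2 hS) hε hε1 k)
    gcongr with x hx
    intro h2
    simp only [errors, mem_filter, hS, false_iff, not_not, Nat.ceil_le] at h2
    rw [sub_add_cancel]
    exact h2.2

/-- Most samples make few errors. -/
theorem exists_many_samples (hA : A.Nonempty) (h : Separated π l ρ S U A μ ε) (hε : 0 ≤ ε)
    (hε1 : ε ≤ 1) (k : ℕ) {c : ℝ} (hc : 0 < c)
    (hk : U.card * Real.exp (-(k * ε ^ 2 / 4)) ≤ c / 2) :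
    ∃ X : Finset (Fin k → Fin n), (∀ x ∈ X, (∀ q, x q ∈ A) ∧
      ((errors π l ρ S U ⌈μ * k⌉₊ x).card : ℝ) < c) ∧ (A.card : ℝ) ^ k / 2 ≤ X.card := by
  set Y := Fintype.piFinset fun _ : Fin k => A with hY
  set err : (Fin k → Fin n) → Finset (Fin n) := errors π l ρ S U ⌈μ * k⌉₊ with herr
  refine ⟨Y.filter fun x => ((err x).card : ℝ) < c, fun x hx => ⟨?_, (mem_filter.1 hx).2⟩, ?_⟩
  · exact Fintype.mem_piFinset.1 (mem_filter.1 hx).1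
  have hYc : (Y.card : ℝ) = A.card ^ k := by simp [hY]
  have hsplit := card_filter_add_card_filter_not (s := Y) (fun x => ((err x).card : ℝ) < c)
  have hsplit' : ((Y.filter fun x => ((err x).card : ℝ) < c).card : ℝ) +
      (Y.filter fun x => ¬ ((err x).card : ℝ) < c).card = A.card ^ k := by
    rw [← hYc]; exact_mod_cast hsplit
  -- The expected number of errors is at most `c / 2`, so by Markov at least half of the samples
  -- make fewer than `c`.
  have htotal : ∑ x ∈ Y, ((err x).card : ℝ) ≤ A.card ^ k * (c / 2) := by
    calc ∑ x ∈ Y, ((err x).card : ℝ)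
        = ∑ x ∈ Y, ∑ i ∈ U, if i ∈ err x then (1 : ℝ) else 0 := by
          refine sum_congr rfl fun x _ => ?_
          rw [← natCast_card_filter]
          congr 2
          ext i
          simp only [herr, errors, mem_filter]
          tauto
      _ = ∑ i ∈ U, ((Y.filter fun x => i ∈ err x).card : ℝ) := by
          rw [sum_comm]
          exact sum_congr rfl fun i _ => (natCast_card_filter _ _).symm
      _ ≤ ∑ _i ∈ U, (A.card : ℝ) ^ k * Real.exp (-(k * ε ^ 2 / 4)) :=
          sum_le_sum fun i hi => card_error_le hA h hε hε1 k hi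
      _ = A.card ^ k * (U.card * Real.exp (-(k * ε ^ 2 / 4))) := by simp; ring
      _ ≤ _ := by gcongr
  have hmarkov : ((Y.filter fun x => ¬ ((err x).card : ℝ) < c).card : ℝ) * c ≤
      ∑ x ∈ Y, ((err x).card : ℝ) := by
    rw [← nsmul_eq_mul, ← sum_const]
    exact (sum_le_sum fun x hx => not_lt.1 (mem_filter.1 hx).2).trans
      (sum_le_sum_of_subset_of_nonneg (filter_subset _ _) fun _ _ _ => Nat.cast_nonneg _)
  have h1 : ((Y.filter fun x => ¬ ((err x).card : ℝ) < c).card : ℝ) ≤ A.card ^ k / 2 := by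
    have := hmarkov.trans htotal
    rw [← mul_le_mul_iff_left₀ hc]
    linarith
  linarith

/-- Some sample of voters from `S` supports nearly all members of `S`. -/
theorem exists_cover (hS : S.Nonempty) {α : ℝ}
    (h : ∀ i ∈ S, α * S.card ≤ supportCount π l ρ S i) (k : ℕ) :
    ∃ x : Fin k → Fin n, (∀ q, x q ∈ S) ∧
      ((S.filter fun i => ¬ 1 ≤ votesOf π l ρ x i).card : ℝ) ≤ Real.exp (-(α * k)) * S.card := by
  set Y := Fintype.piFinset fun _ : Fin k => S with hY
  have hS0 : (0 : ℝ) < S.card := by exact_mod_cast hS.card_pos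
  have hYne : Y.Nonempty := Fintype.piFinset_nonempty.2 fun _ => hS
  have hYc : (Y.card : ℝ) = S.card ^ k := by simp [hY]
  -- Each voter from `S` passes over `i` with probability at most $1-\alpha\le e^{-\alpha}$,
  -- independently of the others.
  have hmiss : ∀ i ∈ S, ((Y.filter fun x => ¬ 1 ≤ votesOf π l ρ x i).card : ℝ) ≤
      Real.exp (-(α * k)) * S.card ^ k := by
    intro i hi
    have h1 : (Y.filter fun x => ¬ 1 ≤ votesOf π l ρ x i) =
        Fintype.piFinset fun _ : Fin k => S.filter fun s => ¬ ((π s (ρ s)).symm i).val < l := by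
      ext x
      simp only [hY, mem_filter, Fintype.mem_piFinset, votesOf, not_le, Nat.lt_one_iff, card_eq_zero,
        filter_eq_empty_iff, mem_univ, true_implies]
      constructor
      · rintro ⟨h1, h2⟩ q
        exact ⟨h1 q, @h2 q⟩
      · intro h1
        exact ⟨fun q => (h1 q).1, fun {q} => (h1 q).2⟩
    rw [h1, Fintype.card_piFinset]
    simp only [prod_const, card_univ, Fintype.card_fin]
    push_cast
    have h2 : ((S.filter fun s => ¬ ((π s (ρ s)).symm i).val < l).card : ℝ) ≤
        Real.exp (-α) * S.card := by
      have h3 := card_filter_add_card_filter_not (s := S) (fun s => ((π s (ρ s)).symm i).val < l)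
      have h3' : (supportCount π l ρ S i : ℝ) +
        (S.filter fun s => ¬ ((π s (ρ s)).symm i).val < l).card = S.card := by exact_mod_cast h3
      have := h i hi
      nlinarith [Real.add_one_le_exp (-α)]
    calc ((S.filter fun s => ¬ ((π s (ρ s)).symm i).val < l).card : ℝ) ^ k
        ≤ (Real.exp (-α) * S.card) ^ k := by gcongr
      _ = _ := by
        rw [mul_pow, ← Real.exp_nat_mul]
        congr 2
        ring
  have htotal : ∑ x ∈ Y, ((S.filter fun i => ¬ 1 ≤ votesOf π l ρ x i).card : ℝ) ≤
      ∑ _x ∈ Y, Real.exp (-(α * k)) * S.card := by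
    calc ∑ x ∈ Y, ((S.filter fun i => ¬ 1 ≤ votesOf π l ρ x i).card : ℝ)
        = ∑ i ∈ S, ((Y.filter fun x => ¬ 1 ≤ votesOf π l ρ x i).card : ℝ) := by
          simp only [natCast_card_filter]
          exact sum_comm
      _ ≤ ∑ _i ∈ S, Real.exp (-(α * k)) * S.card ^ k := sum_le_sum hmiss
      _ = _ := by
        rw [sum_const, sum_const, nsmul_eq_mul, nsmul_eq_mul, hYc]
        ring
  obtain ⟨x, hx, hle⟩ := exists_le_of_sum_le hYne htotal
  exact ⟨x, Fintype.mem_piFinset.1 hx, hle⟩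

/-- The number of members with a vote. -/
theorem card_voted_le (hl : l ≤ n) {k : ℕ} (x : Fin k → Fin n) :
    (univ.filter fun i => 1 ≤ votesOf π l ρ x i).card ≤ k * l := by
  have h1 : (univ.filter fun i => 1 ≤ votesOf π l ρ x i) ⊆ univ.biUnion fun q : Fin k =>
      univ.filter fun i => ((π (x q) (ρ (x q))).symm i).val < l := by
    intro i hi
    obtain ⟨q, hq⟩ := card_pos.1 (mem_filter.1 hi).2
    simp only [mem_filter, mem_univ, true_and] at hq
    simp only [mem_biUnion, mem_univ, mem_filter, true_and]
    exact ⟨q, hq⟩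
  refine (card_le_card h1).trans (card_biUnion_le.trans ?_)
  have h2 : ∀ q : Fin k, (univ.filter fun i => ((π (x q) (ρ (x q))).symm i).val < l).card = l := by
    intro q
    rw [← card_map (π (x q) (ρ (x q))).symm.toEmbedding]
    have : (univ.filter fun i => ((π (x q) (ρ (x q))).symm i).val < l).map
        (π (x q) (ρ (x q))).symm.toEmbedding = univ.filter fun i : Fin n => i.val < l := by
      ext i
      simp only [mem_map_equiv, Equiv.symm_symm, mem_filter, mem_univ, true_and,
        Equiv.symm_apply_apply]
    rw [this, Fin.card_filter_val_lt]
    exact min_eq_right hl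
  simp [h2]

theorem supportCount_le_add (A B : Finset (Fin n)) (i : Fin n) :
    supportCount π l ρ A i ≤ supportCount π l ρ B i + (A \ B).card := by
  unfold supportCount
  refine (card_le_card (t := (B.filter fun s => ((π s (ρ s)).symm i).val < l) ∪ (A \ B)) ?_).trans
    (card_union_le _ _)
  intro s hs
  simp only [mem_filter, mem_union, mem_sdiff] at hs ⊢
  tauto

/-- Dropping few members of the community from the electorate. -/
theorem separated_inter {α β : ℝ} (hβ : 0 ≤ β) (hβα : β < α) (hα : α ≤ 1)
    (hin : ∀ i ∈ S, α * S.card ≤ supportCount π l ρ S i)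
    (hout : ∀ i ∉ S, (supportCount π l ρ S i : ℝ) < β * S.card)
    (hU : ((S \ U).card : ℝ) ≤ (α - β) / 16 * S.card) :
    Separated π l ρ S U (S ∩ U) ((α + β) / 2) ((α - β) / 4) := by
  have hcard : ((S ∩ U).card : ℝ) + (S \ U).card = S.card := by
    exact_mod_cast card_inter_add_card_sdiff S U
  have ht : (0 : ℝ) ≤ S.card := Nat.cast_nonneg _
  have ht' : (0 : ℝ) ≤ (S \ U).card := Nat.cast_nonneg _
  intro i _
  refine ⟨fun hi => ?_, fun hi => ?_⟩
  · have h1 := supportCount_le_add (π := π) (l := l) (ρ := ρ) S (S ∩ U) i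
    rw [sdiff_inter_self_left] at h1
    have h1' : (supportCount π l ρ S i : ℝ) ≤ supportCount π l ρ (S ∩ U) i + (S \ U).card := by
      exact_mod_cast h1
    have := hin i hi
    nlinarith
  · have h1 : supportCount π l ρ (S ∩ U) i ≤ supportCount π l ρ S i :=
      card_le_card (filter_subset_filter _ inter_subset_left)
    have h1' : (supportCount π l ρ (S ∩ U) i : ℝ) ≤ supportCount π l ρ S i := by exact_mod_cast h1
    have := hout i hi
    have h2 : (1 - (α - β) / 16) * S.card ≤ ((S ∩ U).card : ℝ) := by linarith
    -- A smaller electorate raises the relative support of outsiders. The gap between $\beta$ and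
    -- $\beta+\gamma/4$ pays for the lost fraction $\gamma/16$.
    have h3 : β * S.card ≤ ((α + β) / 2 - (α - β) / 4) * ((1 - (α - β) / 16) * S.card) := by
      have : β ≤ ((α + β) / 2 - (α - β) / 4) * (1 - (α - β) / 16) := by nlinarith
      nlinarith
    have h4 : ((α + β) / 2 - (α - β) / 4) * ((1 - (α - β) / 16) * S.card) ≤
        ((α + β) / 2 - (α - β) / 4) * (S ∩ U).card := by
      apply mul_le_mul_of_nonneg_left h2; linarith
    linarith

/-- Replacing the electorate by a similar set. -/
theorem separated_of_close {T : Finset (Fin n)} {α β : ℝ} (hβ : 0 ≤ β) (hβα : β < α) (hα : α ≤ 1)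
    (hin : ∀ i ∈ S, α * S.card ≤ supportCount π l ρ S i)
    (hout : ∀ i ∉ S, (supportCount π l ρ S i : ℝ) < β * S.card)
    (hT : ((S \ T).card : ℝ) + (T \ S).card ≤ (α - β) / 8 * S.card) :
    Separated π l ρ S univ T ((α + β) / 2) ((α - β) / 4) := by
  have hcard : ((S ∩ T).card : ℝ) + (S \ T).card = S.card := by
    exact_mod_cast card_inter_add_card_sdiff S T
  have hcard' : ((S ∩ T).card : ℝ) + (T \ S).card = T.card := by
    rw [inter_comm]; exact_mod_cast card_inter_add_card_sdiff T S
  have ht : (0 : ℝ) ≤ S.card := Nat.cast_nonneg _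
  have h1 : (0 : ℝ) ≤ (S \ T).card := Nat.cast_nonneg _
  have h2 : (0 : ℝ) ≤ (T \ S).card := Nat.cast_nonneg _
  have hTc : (T.card : ℝ) = S.card - (S \ T).card + (T \ S).card := by linarith
  intro i _
  refine ⟨fun hi => ?_, fun hi => ?_⟩
  · have h3 : (supportCount π l ρ S i : ℝ) ≤ supportCount π l ρ T i + (S \ T).card := by
      exact_mod_cast supportCount_le_add S T i
    have := hin i hi
    rw [hTc]
    have h4 : 0 ≤ (α + β) / 2 + (α - β) / 4 := by linarith
    have h5 : (α + β) / 2 + (α - β) / 4 ≤ 1 := by linarith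
    nlinarith
  · have h3 : (supportCount π l ρ T i : ℝ) ≤ supportCount π l ρ S i + (T \ S).card := by
      exact_mod_cast supportCount_le_add T S i
    have := hout i hi
    rw [hTc]
    have h4 : 0 ≤ (α + β) / 2 - (α - β) / 4 := by linarith
    have h5 : (α + β) / 2 - (α - β) / 4 ≤ 1 := by linarith
    nlinarith

end RandRAM

namespace RandRAM

open Finset
open scoped ENNReal

variable {n f : ℕ} {π : MultiAffinity n f} {l : ℕ} {α β : ℝ} {S : Finset (Fin n)}
  {ρ : Fin n → Fin f} {m : Mem}

/-! ### The ballots on the way to a community -/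

/-- The probability of guessing the six parameters of a ballot. -/
noncomputable def guessProb (n : ℕ) : ℝ := (1 / (2 * n + 1)) ^ 6

/-- `S` with the facets `ρ` is a community, with lists of length `l`. -/
structure Supported (π : MultiAffinity n f) (l : ℕ) (α β : ℝ) (S : Finset (Fin n))
    (ρ : Fin n → Fin f) : Prop where
  inside : ∀ i ∈ S, α * S.card ≤ supportCount π l ρ S i
  outside : ∀ i ∉ S, (supportCount π l ρ S i : ℝ) < β * S.card
  nonempty : S.Nonempty
  nonneg : 0 ≤ β
  lt : β < α
  le_one : α ≤ 1

theorem card_le_of_finset_fin (A : Finset (Fin n)) : A.card ≤ n := by simpa using A.card_le_univ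

theorem Supported.filter_eq (h : Supported π l α β S ρ) :
    (univ.filter fun i => ⌈α * S.card⌉₊ ≤ supportCount π l ρ S i) = S := by
  ext i
  simp only [mem_filter, mem_univ, true_and, Nat.ceil_le]
  refine ⟨fun hi => ?_, fun hi => h.inside i hi⟩
  by_contra hcon
  have h1 := h.outside i hcon
  have h2 : β * S.card ≤ α * S.card := by
    have := h.lt; gcongr
  linarith

theorem Supported.ceil_le (h : Supported π l α β S ρ) : ⌈α * S.card⌉₊ ≤ 2 * n := by
  rw [Nat.ceil_le]
  have h1 : (S.card : ℝ) ≤ n := by exact_mod_cast card_le_of_finset_fin S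
  have h2 := h.le_one
  have h3 : (0 : ℝ) ≤ S.card := Nat.cast_nonneg _
  push_cast
  nlinarith

/-- Every member of $V$ is asked once; the coin must say whether it belongs to `S`, and its facet
must be right, with probability $1/(2f)$ in each case. Used when $n$ is small. -/
theorem Supported.direct_all (h : Supported π l α β S ρ) (hm : Listed f l α β (univ : Finset (Fin n)) m) (hf : 1 ≤ f)
    (hn : 1 ≤ n) (hl : l ≤ n) :
    Reach (inputTable π) ballot m (ballotTime n)
      (ENNReal.ofReal (guessProb n * (1 / (2 * f) ^ n))) (Listed f l α β S) := by
  refine (reach_ballot_all π hm hn hf hl h.ceil_le le_rfl ρ S (subset_univ _)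
    (by simp)).mono le_rfl (le_of_eq ?_) fun m' hm' => ?_
  · rw [guessProb, card_univ, Fintype.card_fin]
    norm_num
  · rwa [h.filter_eq] at hm'

/-- The voters drawn are an enumeration of `S`, so the votes are the exact support counts. Used when
`S` has at most $2/\alpha$ members. -/
theorem Supported.direct_sample (h : Supported π l α β S ρ) (hm : Listed f l α β (univ : Finset (Fin n)) m)
    (hf : 1 ≤ f) (hl : l ≤ n) :
    Reach (inputTable π) ballot m (ballotTime n)
      (ENNReal.ofReal (guessProb n * (1 / ((n : ℝ) * f) ^ S.card))) (Listed f l α β S) := by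
  have hS := card_le_of_finset_fin S
  let e := S.equivFin.symm
  refine (reach_ballot_random π hm hf hl ⟨h.nonempty.choose, mem_univ _⟩ (k := S.card) (b := 0)
    (by omega) (by omega) h.ceil_le ρ {fun q => (e q).1} (fun _ _ _ => mem_univ _)).mono le_rfl
      (le_of_eq ?_) fun m' hm' => ?_
  · rw [guessProb, card_univ, Fintype.card_fin]
    simp
  · obtain ⟨x, hx, hm'⟩ := hm'
    rw [mem_singleton] at hx
    convert hm' using 1
    refine h.filter_eq.symm.trans (filter_congr fun i _ => ?_)
    have : (univ.filter fun q => ((π (x q) (ρ (x q))).symm i).val < l).card =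
        supportCount π l ρ S i := by
      rw [supportCount, card_filter, card_filter, hx,
        Equiv.sum_comp e (fun s : {x // x ∈ S} =>
          if ((π s.1 (ρ s.1)).symm i).val < l then 1 else 0),
        sum_coe_sort S (fun s => if ((π s (ρ s)).symm i).val < l then 1 else 0)]
    rw [ite_self, zero_add, this]

/-- One good tuple of voters from `exists_cover` suffices; it is drawn with probability $(nf)^{-k}$,
and everybody with a vote is elected. -/
theorem Supported.cover (h : Supported π l α β S ρ) (hm : Listed f l α β (univ : Finset (Fin n)) m) (hf : 1 ≤ f)
    (hl : l ≤ n) {k : ℕ} (hk : k ≤ n) (hkα : Real.exp (-(α * k)) ≤ (α - β) / 16) :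
    Reach (inputTable π) ballot m (ballotTime n)
      (ENNReal.ofReal (guessProb n * (1 / ((n : ℝ) * f) ^ k)))
      (fun m' => ∃ U : Finset (Fin n), ((S \ U).card : ℝ) ≤ (α - β) / 16 * S.card ∧ U.card ≤ k * l ∧
        Listed f l α β U m') := by
  obtain ⟨x, hxS, hx⟩ := exists_cover h.nonempty h.inside k
  have hn : 1 ≤ n := (h.nonempty.card_pos).trans_le (card_le_of_finset_fin S)
  refine (reach_ballot_random π hm hf hl ⟨h.nonempty.choose, mem_univ _⟩ (k := k) (b := 0) (τ := 1)
    (by omega) (by omega) (by omega) ρ {x} (fun _ _ _ => mem_univ _)).mono le_rfl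
      (le_of_eq ?_) fun m' hm' => ?_
  · rw [guessProb, card_univ, Fintype.card_fin]
    simp
  · obtain ⟨y, hy, hm'⟩ := hm'
    rw [mem_singleton] at hy
    subst hy
    simp only [ite_self, zero_add] at hm'
    refine ⟨_, ?_, card_voted_le (π := π) (ρ := ρ) hl y, hm'⟩
    refine le_trans ?_ (hx.trans (mul_le_mul_of_nonneg_right hkα (Nat.cast_nonneg _)))
    refine Nat.cast_le.2 (card_le_card fun i hi => ?_)
    simp only [mem_sdiff, mem_filter, mem_univ, true_and] at hi ⊢
    exact hi

/-- A voter from `U` lies in `S ∩ U` and uses the right facet with probability at least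
$15|S|/(16Mf)$. Given this for all voters, they are a uniform sample of `S ∩ U`, and at least half
of the samples err on fewer than $\gamma|S|/16$ members of `U`. The members of `S` outside `U` cost
another $\gamma|S|/16$. -/
theorem Supported.restrict (h : Supported π l α β S ρ) {U : Finset (Fin n)}
    (hm : Listed f l α β U m) (hf : 1 ≤ f)
    (hl : l ≤ n) (hU : ((S \ U).card : ℝ) ≤ (α - β) / 16 * S.card) {M k : ℕ} (hUM : U.card ≤ M)
    (hk : k ≤ n) (hk1 : 1 ≤ k)
    (hkM : M * Real.exp (-(k * (α - β) ^ 2 / 64)) ≤ (α - β) * S.card / 32) :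
    Reach (inputTable π) ballot m (ballotTime n)
      (ENNReal.ofReal (guessProb n * (1 / 2 * (15 * S.card / (16 * M * f)) ^ k)))
      (fun m' => ∃ T : Finset (Fin n), ((S \ T).card : ℝ) + (T \ S).card ≤ (α - β) / 8 * S.card ∧
        Listed f l α β T m') := by
  have hlt := h.lt
  have h0 := h.nonneg
  have h1 := h.le_one
  have hS : (0 : ℝ) < S.card := by exact_mod_cast h.nonempty.card_pos
  have hcard : ((S ∩ U).card : ℝ) + (S \ U).card = S.card := by
    exact_mod_cast card_inter_add_card_sdiff S U
  have hA15 : 15 / 16 * (S.card : ℝ) ≤ (S ∩ U).card := by nlinarith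
  have hApos : (0 : ℝ) < (S ∩ U).card := by linarith
  have hA : (S ∩ U).Nonempty := card_pos.1 (by exact_mod_cast hApos)
  have hUne : U.Nonempty := hA.mono inter_subset_right
  have hU0 : (0 : ℝ) < U.card := by exact_mod_cast hUne.card_pos
  have hUM' : (U.card : ℝ) ≤ M := by exact_mod_cast hUM
  have hf0 : (0 : ℝ) < f := by exact_mod_cast hf
  obtain ⟨X, hX, hXcard⟩ := exists_many_samples hA (separated_inter h0 hlt h1 h.inside h.outside hU)
    (by linarith) (by linarith) k (c := (α - β) / 16 * S.card) (by nlinarith) (by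
      calc (U.card : ℝ) * Real.exp (-(k * ((α - β) / 4) ^ 2 / 4))
          ≤ M * Real.exp (-(k * ((α - β) / 4) ^ 2 / 4)) := by gcongr
        _ = M * Real.exp (-(k * (α - β) ^ 2 / 64)) := by congr 2; ring
        _ ≤ _ := hkM
        _ = _ := by ring)
  have hk0 : (1 : ℝ) ≤ k := by exact_mod_cast hk1
  set τ := ⌈(α + β) / 2 * k⌉₊ with hτ
  have hτk : τ ≤ k := by
    rw [hτ, Nat.ceil_le]; nlinarith
  have hτ1 : 1 ≤ τ := by
    rw [hτ, Nat.one_le_ceil_iff]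
    have : 0 < (α + β) / 2 := by linarith
    positivity
  -- The bonus `k` with threshold `k + τ` confines the winners to `U`: an outsider gets at most `k`
  -- votes, and `τ` is positive.
  refine (reach_ballot_random π hm hf hl hUne (k := k) (b := k) (τ := k + τ)
    (by omega) (by omega) (by omega) ρ X (fun x hx q => (mem_inter.1 ((hX x hx).1 q)).2)).mono le_rfl
      ?_ fun m' hm' => ?_
  · apply ENNReal.ofReal_le_ofReal
    rw [guessProb]
    gcongr
    rw [le_div_iff₀ (by positivity)]
    refine le_trans ?_ hXcard
    rw [mul_assoc, ← mul_pow, mul_comm (1 / 2 : ℝ), ← div_eq_mul_one_div]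
    gcongr
    have hM0 : (0 : ℝ) < M := hU0.trans_le hUM'
    calc 15 * (S.card : ℝ) / (16 * M * f) * (U.card * f)
        ≤ 15 * (S.card : ℝ) / (16 * M * f) * (M * f) := by gcongr
      _ = 15 / 16 * S.card := by field_simp
      _ ≤ _ := hA15
  · obtain ⟨x, hx, hm'⟩ := hm'
    refine ⟨_, ?_, hm'⟩
    set T := univ.filter fun i => k + τ ≤ (if i ∈ U then k else 0) +
      (univ.filter fun q => ((π (x q) (ρ (x q))).symm i).val < l).card with hT
    have hTmem : ∀ i, i ∈ T ↔ i ∈ U ∧ τ ≤ votesOf π l ρ x i := by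
      intro i
      have := votesOf_le π l ρ x i
      rw [votesOf] at this ⊢
      simp only [hT, mem_filter, mem_univ, true_and]
      split_ifs with hi
      · simp [hi]
      · simp only [hi, false_and, iff_false]
        omega
    have hsub1 : S \ T ⊆ (S \ U) ∪ (errors π l ρ S U τ x ∩ S) := by
      intro i hi
      simp only [mem_sdiff, hTmem, mem_union, errors, mem_inter, mem_filter] at hi ⊢
      tauto
    have hsub2 : T \ S ⊆ errors π l ρ S U τ x \ S := by
      intro i hi
      simp only [mem_sdiff, hTmem, errors, mem_filter] at hi ⊢
      tauto
    have e1 : ((S \ T).card : ℝ) ≤ (S \ U).card + (errors π l ρ S U τ x ∩ S).card := by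
      exact_mod_cast (card_le_card hsub1).trans (card_union_le _ _)
    have e2 : ((T \ S).card : ℝ) ≤ (errors π l ρ S U τ x \ S).card := by
      exact_mod_cast card_le_card hsub2
    have e3 : ((errors π l ρ S U τ x ∩ S).card : ℝ) + (errors π l ρ S U τ x \ S).card =
        (errors π l ρ S U τ x).card := by
      exact_mod_cast card_inter_add_card_sdiff _ _
    have e4 := (hX x hx).2
    linarith

theorem Supported.close_nonempty (h : Supported π l α β S ρ) {T : Finset (Fin n)}
    (hT : ((S \ T).card : ℝ) + (T \ S).card ≤ (α - β) / 8 * S.card) : T.Nonempty := by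
  rw [nonempty_iff_ne_empty]
  rintro rfl
  have hS : (0 : ℝ) < S.card := by exact_mod_cast h.nonempty.card_pos
  have := h.le_one
  have := h.nonneg
  simp at hT
  nlinarith

/-- Less than one error means none. All of `T` may vote, also members outside `S` with their values
of `ρ`, because `T` is close enough to `S`; so no luck is needed for the voters, only for their
facets. -/
theorem Supported.final_sample (h : Supported π l α β S ρ) {T : Finset (Fin n)}
    (hm : Listed f l α β T m) (hf : 1 ≤ f) (hl : l ≤ n)
    (hT : ((S \ T).card : ℝ) + (T \ S).card ≤ (α - β) / 8 * S.card) {k : ℕ} (hk : k ≤ n)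
    (hkn : n * Real.exp (-(k * (α - β) ^ 2 / 64)) ≤ 1 / 2) :
    Reach (inputTable π) ballot m (ballotTime n)
      (ENNReal.ofReal (guessProb n * (1 / 2 * (1 / f) ^ k))) (Listed f l α β S) := by
  have hlt := h.lt
  have h0 := h.nonneg
  have h1 := h.le_one
  have hTne := h.close_nonempty hT
  have hT0 : (0 : ℝ) < T.card := by exact_mod_cast hTne.card_pos
  have hf0 : (0 : ℝ) < f := by exact_mod_cast hf
  obtain ⟨X, hX, hXcard⟩ := exists_many_samples hTne
    (separated_of_close h0 hlt h1 h.inside h.outside hT)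
    (by linarith) (by linarith) k (c := 1) (by norm_num) (by
      rw [card_univ, Fintype.card_fin]
      refine le_trans (le_of_eq ?_) hkn
      congr 2
      ring)
  set τ := ⌈(α + β) / 2 * k⌉₊ with hτ
  have hτk : τ ≤ k := by
    rw [hτ, Nat.ceil_le]
    have : (0 : ℝ) ≤ k := Nat.cast_nonneg k
    nlinarith
  refine (reach_ballot_random π hm hf hl hTne (k := k) (b := 0) (τ := τ)
    (by omega) (by omega) (by omega) ρ X (fun x hx => (hX x hx).1)).mono le_rfl
      ?_ fun m' hm' => ?_
  · apply ENNReal.ofReal_le_ofReal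
    rw [guessProb]
    gcongr
    rw [le_div_iff₀ (by positivity)]
    refine le_trans (le_of_eq ?_) hXcard
    rw [mul_assoc, ← mul_pow]
    field_simp
  · obtain ⟨x, hx, hm'⟩ := hm'
    convert hm' using 1
    ext i
    simp only [ite_self, zero_add, mem_filter, mem_univ, true_and]
    have h2 := (hX x hx).2
    have h3 : errors π l ρ S univ τ x = ∅ := by
      rw [← card_eq_zero, ← Nat.lt_one_iff]
      exact_mod_cast h2
    by_contra hcon
    have : i ∈ errors π l ρ S univ τ x := mem_filter.2 ⟨mem_univ _, hcon⟩
    simp [h3] at this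

/-- If the sample size would exceed $n$, all members of `T` vote once instead, and no sampling error
occurs. -/
theorem Supported.final_all (h : Supported π l α β S ρ) {T : Finset (Fin n)}
    (hm : Listed f l α β T m) (hf : 1 ≤ f) (hl : l ≤ n)
    (hT : ((S \ T).card : ℝ) + (T \ S).card ≤ (α - β) / 8 * S.card) :
    Reach (inputTable π) ballot m (ballotTime n)
      (ENNReal.ofReal (guessProb n * (1 / f) ^ n)) (Listed f l α β S) := by
  have hlt := h.lt
  have h0 := h.nonneg
  have h1 := h.le_one
  have hTne := h.close_nonempty hT
  have hT0 : (0 : ℝ) < T.card := by exact_mod_cast hTne.card_pos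
  have hTn := card_le_of_finset_fin T
  have hTn' : (T.card : ℝ) ≤ n := by exact_mod_cast hTn
  have hf1 : (1 : ℝ) ≤ f := by exact_mod_cast hf
  have hn : 1 ≤ n := hTne.card_pos.trans_le hTn
  have hsep := separated_of_close h0 hlt h1 h.inside h.outside hT
  refine (reach_ballot_all π hm hn hf hl (τ := ⌈(α + β) / 2 * T.card⌉₊) (B := 0) ?_ (by omega) ρ T
    subset_rfl (fun _ => rfl)).mono le_rfl ?_ fun m' hm' => ?_
  · rw [Nat.ceil_le]; push_cast; nlinarith
  · apply ENNReal.ofReal_le_ofReal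
    rw [guessProb]
    gcongr
    rw [Nat.cast_zero, zero_add, one_mul, ← one_div_pow]
    exact pow_le_pow_of_le_one (by positivity) ((div_le_one (by linarith)).2 hf1) hTn
  · convert hm' using 1
    ext i
    simp only [mem_filter, mem_univ, true_and, Nat.ceil_le]
    obtain ⟨h2, h3⟩ := hsep i (mem_univ i)
    constructor
    · intro hi
      refine le_trans ?_ (h2 hi)
      gcongr
      linarith
    · intro hi
      by_contra hcon
      have := h3 hcon
      nlinarith

/-- The output is as claimed. -/
def Success (π : MultiAffinity n f) (l : ℕ) (α β : ℝ) (S : Finset (Fin n)) (m : Mem) : Prop :=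
  ∃ ρ : Fin n → Fin f, Assigned S ρ m ∧
    (∀ i ∈ S, (α - (α - β) / 4) * S.card ≤ supportCount π l ρ S i) ∧
    ∀ i ∉ S, (supportCount π l ρ S i : ℝ) < (β + (α - β) / 4) * S.card

theorem Supported.assign_guess (h : Supported π l α β S ρ) (hm : Listed f l α β S m) (hf : 1 ≤ f)
    (hl : l ≤ n) :
    Reach (inputTable π) assignAll m (assignTime n f)
      (ENNReal.ofReal (1 / (f + 1) * (1 / f) ^ S.card)) (Success π l α β S) := by
  refine (reach_assignAll_guess hm hl hf ρ).mono le_rfl le_rfl fun m' hm' =>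
    ⟨ρ, hm', fun i hi => ?_, fun i hi => ?_⟩
  all_goals
    have hlt := h.lt
    have hS : (0 : ℝ) ≤ S.card := Nat.cast_nonneg _
  · have := h.inside i hi
    nlinarith
  · have := h.outside i hi
    nlinarith

theorem Supported.assign_greedy (h : Supported π l α β S ρ) (hm : Listed f l α β S m) (hf : 1 ≤ f)
    (hn : 1 ≤ n) (hl : l ≤ n)
    (hbig : 2048 * Real.log (4 * (n : ℝ) ^ 2) ≤ (α - β) ^ 2 * S.card) :
    Reach (inputTable π) assignAll m (assignTime n f)
      (ENNReal.ofReal (1 / (f + 1) * (1 / 2))) (Success π l α β S) :=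
  reach_assignAll_greedy hm hl hf hn h.nonneg h.lt h.le_one ρ h.inside h.outside hbig

/-- The program after the first draw. -/
def mainPart : Prog := .seq ballot <| .seq ballot <| .seq ballot <| .seq ballot assignAll

theorem guessProb_nonneg (n : ℕ) : 0 ≤ guessProb n := by unfold guessProb; positivity

theorem reach_mainPart_direct (hm : Listed f l α β (∅ : Finset (Fin n)) m) (hf : 1 ≤ f) (hl : l ≤ n)
    {p p' : ℝ} (hp : 0 ≤ p)
    (h₁ : ∀ m, Listed f l α β (univ : Finset (Fin n)) m → Reach (inputTable π) ballot m
      (ballotTime n) (ENNReal.ofReal (guessProb n * p)) (Listed f l α β S))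
    (h₂ : ∀ m, Listed f l α β S m → Reach (inputTable π) assignAll m (assignTime n f)
      (ENNReal.ofReal p') (Success π l α β S)) :
    Reach (inputTable π) mainPart m (4 * ballotTime n + assignTime n f + 4)
      (ENNReal.ofReal (guessProb n ^ 4 * (p * p'))) (Success π l α β S) := by
  have hg := guessProb_nonneg n
  refine ((reach_ballot_trivial π hm hf hl).seq fun m₁ hm₁ =>
    (reach_ballot_trivial π hm₁ hf hl).seq fun m₂ hm₂ =>
    (reach_ballot_trivial π hm₂ hf hl).seq fun m₃ hm₃ => (h₁ m₃ hm₃).seq h₂).mono (by omega)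
      (le_of_eq ?_) fun _ h => h
  rw [← guessProb, ← ENNReal.ofReal_mul (by positivity), ← ENNReal.ofReal_mul (by positivity),
    ← ENNReal.ofReal_mul (by positivity), ← ENNReal.ofReal_mul (by positivity)]
  congr 1
  ring

theorem Supported.reach_mainPart (h : Supported π l α β S ρ)
    (hm : Listed f l α β (∅ : Finset (Fin n)) m) (hf : 1 ≤ f) (hl : l ≤ n) {k₁ k₂ : ℕ}
    (hk₁ : k₁ ≤ n) (hkα : Real.exp (-(α * k₁)) ≤ (α - β) / 16) (hk₂ : k₂ ≤ n) (hk1 : 1 ≤ k₂)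
    (hkM : (k₁ * l : ℕ) * Real.exp (-(k₂ * (α - β) ^ 2 / 64)) ≤ (α - β) * S.card / 32)
    {p p' : ℝ} (hp : 0 ≤ p)
    (h₁ : ∀ T : Finset (Fin n), ((S \ T).card : ℝ) + (T \ S).card ≤ (α - β) / 8 * S.card → ∀ m,
      Listed f l α β T m → Reach (inputTable π) ballot m
      (ballotTime n) (ENNReal.ofReal (guessProb n * p)) (Listed f l α β S))
    (h₂ : ∀ m, Listed f l α β S m → Reach (inputTable π) assignAll m (assignTime n f)
      (ENNReal.ofReal p') (Success π l α β S)) :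
    Reach (inputTable π) mainPart m (4 * ballotTime n + assignTime n f + 4)
      (ENNReal.ofReal (guessProb n ^ 4 * ((1 / ((n : ℝ) * f) ^ k₁) *
        (1 / 2 * (15 * S.card / (16 * (k₁ * l : ℕ) * f)) ^ k₂) * (p * p'))))
      (Success π l α β S) := by
  have hg := guessProb_nonneg n
  refine ((reach_ballot_trivial π hm hf hl).seq fun m₁ hm₁ =>
    (h.cover hm₁ hf hl hk₁ hkα).seq fun m₂ ⟨U, hU, hUc, hm₂⟩ =>
    (h.restrict hm₂ hf hl hU hUc hk₂ hk1 hkM).seq fun m₃ ⟨T, hT, hm₃⟩ =>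
    (h₁ T hT m₃ hm₃).seq h₂).mono (by omega)
      (le_of_eq ?_) fun _ h => h
  rw [← guessProb, ← ENNReal.ofReal_mul (by positivity), ← ENNReal.ofReal_mul (by positivity),
    ← ENNReal.ofReal_mul (by positivity), ← ENNReal.ofReal_mul (by positivity)]
  congr 1
  ring

end RandRAM

namespace RandRAM

open Finset
open scoped ENNReal

/-! ### The success probability -/

/-- The relations between the quantities in the exponents of the success probability. -/
structure Rates (n f : ℕ) (α γ δ L E Y W : ℝ) : Prop where
  one_le_n : 1 ≤ n
  one_le_f : 1 ≤ f
  pos : 0 < γ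
  le : γ ≤ α
  le_one : α ≤ 1
  pos_depth : 0 < δ
  two_le : 2 ≤ L
  exp_neg : Real.exp (-L) = γ / 16
  one_le : 1 ≤ E
  rounds_le : L / α ≤ 3 * E
  log_le : Real.log f + 1 ≤ Y
  exp_eq : Real.exp Y = f * δ * L / α
  tail_le : 4 * (δ * L / α) * Real.exp (-(6 * (γ ^ 2 * E))) ≤ γ / 32
  total : W = L / α * Real.log (f * n) + E * Y + Real.log n / γ ^ 2 * Real.log f

/-- Writes the bound as $e^{-CW}$ with $E=\gamma^{-2}\log D$, $D=\theta'L/(\alpha\gamma)$ and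
$Y=\log(f\theta'L/\alpha)$. Everything rests on $L\ge e$ and $\theta'\ge\alpha$, which make all
logarithms involved nonnegative and give $\log D\ge1$. -/
theorem successBound_eq_exp {n f : ℕ} (hn : 1 ≤ n) (hf : 1 ≤ f) {α β θ : ℝ} (hβ : 0 ≤ β)
    (hlt : β < α) (hα : α ≤ 1) (C : ℝ) :
    ∃ L E Y W, Rates n f α (α - β) (max θ α) L E Y W ∧
      successBound C n f α β θ = Real.exp (-(C * W)) := by
  have hn0 : (0 : ℝ) < n := by exact_mod_cast hn
  have hf0 : (0 : ℝ) < f := by exact_mod_cast hf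
  have hα0 : 0 < α := by linarith
  set γ := α - β with hγ
  have hγ0 : 0 < γ := by linarith
  have hγα : γ ≤ α := by linarith
  have hγ1 : γ ≤ 1 := by linarith
  set δ := max θ α
  have hδ : α ≤ δ := le_max_right _ _
  have hδ0 : 0 < δ := by linarith
  set L := Real.log (16 / γ) with hL
  have hLe : Real.log 16 + Real.log (1 / γ) = L := by
    rw [hL, ← Real.log_mul (by norm_num) (by positivity)]
    congr 1; ring
  have h16 : Real.log 16 = 4 * Real.log 2 := by
    rw [show (16 : ℝ) = 2 ^ 4 by norm_num, Real.log_pow]; norm_num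
  have h2 := Real.log_two_gt_d9
  have h2' := Real.log_two_lt_d9
  have hlγ : 0 ≤ Real.log (1 / γ) := Real.log_nonneg (by rw [le_div_iff₀ hγ0]; linarith)
  have hexp := Real.exp_one_lt_d9
  have hexp' := Real.exp_one_gt_d9
  have hLexp : Real.exp 1 ≤ L := by linarith
  have hL0 : 0 < L := by linarith
  have hlogL : 1 ≤ Real.log L := by rwa [Real.le_log_iff_exp_le hL0]
  have hr : 1 ≤ δ / α := by rwa [le_div_iff₀ hα0, one_mul]
  have hlr : 0 ≤ Real.log (δ / α) := Real.log_nonneg hr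
  set D := δ * L / (α * γ) with hD
  have hD0 : 0 < D := by positivity
  have hlogD : Real.log D = Real.log (δ / α) + Real.log L + Real.log (1 / γ) := by
    rw [← Real.log_mul (by positivity) (by positivity),
      ← Real.log_mul (by positivity) (by positivity)]
    congr 1
    rw [hD]; field_simp
  have hlogD1 : 1 ≤ Real.log D := by linarith
  have hDe : Real.exp 1 ≤ D := by rwa [← Real.le_log_iff_exp_le hD0]
  have hγ2 : γ ^ 2 ≤ 1 := by nlinarith
  have hE1 : 1 / γ ^ 2 * Real.log D = Real.log D / γ ^ 2 := by ring
  have hEge : Real.log D ≤ 1 / γ ^ 2 * Real.log D := by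
    rw [hE1, le_div_iff₀ (by positivity)]; nlinarith
  refine ⟨L, 1 / γ ^ 2 * Real.log D, Real.log (f * δ * L / α), _, ⟨hn, hf, hγ0, hγα, hα, hδ0,
    by linarith, ?_, by linarith, ?_, ?_, ?_, ?_, rfl⟩, ?_⟩
  · rw [hL, Real.exp_neg, Real.exp_log (by positivity), inv_div]
  · have h3 : L ≤ 3 * Real.log D := by linarith
    have h4 : γ ^ 2 ≤ α := by nlinarith
    calc L / α ≤ 3 * Real.log D / γ ^ 2 := by gcongr
      _ = _ := by ring
  · rw [show (f : ℝ) * δ * L / α = f * (δ / α) * L by ring,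
      Real.log_mul (by positivity) (by positivity), Real.log_mul (by positivity) (by positivity)]
    linarith
  · rw [Real.exp_log (by positivity)]
  · have h5 : γ ^ 2 * (1 / γ ^ 2 * Real.log D) = Real.log D := by field_simp
    have h6 : Real.exp (-(6 * Real.log D)) = 1 / D ^ 6 := by
      rw [Real.exp_neg, show 6 * Real.log D = ((6 : ℕ) : ℝ) * Real.log D by norm_num,
        ← Real.log_pow, Real.exp_log (by positivity), one_div]
    have h7 : δ * L / α = γ * D := by rw [hD]; field_simp
    rw [h5, h6, h7]
    -- `tail_le` becomes $4\gamma D\cdot D^{-6}\le\gamma/32$.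
    have h8 : 128 ≤ D ^ 5 := by
      calc (128 : ℝ) ≤ 2.7 ^ 5 := by norm_num
        _ ≤ D ^ 5 := by gcongr; linarith
    rw [mul_one_div, div_le_div_iff₀ (by positivity) (by positivity)]
    have : D ^ 6 = D * D ^ 5 := by ring
    rw [this]
    nlinarith [mul_le_mul_of_nonneg_left h8 (mul_pos hγ0 hD0).le]
  · unfold successBound
    simp only
    rw [Real.rpow_def_of_pos (by positivity), Real.rpow_def_of_pos (by positivity),
      Real.rpow_def_of_pos hf0, ← Real.exp_add, ← Real.exp_add]
    congr 1
    ring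

/-- Each success factor is a power of $1/x$. The lemma turns bounds for $\log x$ and for the
exponent into a share of the total $W$; the shares are then added up. -/
theorem exp_neg_le_one_div_pow {x c K A : ℝ} {k : ℕ} (hx : 0 < x) (hc : Real.log x ≤ c)
    (hc0 : 0 ≤ c) (hk : (k : ℝ) ≤ K) (hA : K * c ≤ A) : Real.exp (-A) ≤ (1 / x) ^ k := by
  rw [one_div, inv_pow, Real.exp_neg]
  refine inv_anti₀ (by positivity) ?_
  calc x ^ k = Real.exp (k * Real.log x) := by rw [← Real.log_pow, Real.exp_log (by positivity)]
    _ ≤ Real.exp A := Real.exp_le_exp.2 (((mul_le_mul_of_nonneg_left hc (Nat.cast_nonneg k)).trans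
      (mul_le_mul_of_nonneg_right hk hc0)).trans hA)

theorem exp_neg_le_half {A : ℝ} (hA : 1 ≤ A) : Real.exp (-A) ≤ 1 / 2 := by
  have := exp_neg_le_one_div_pow (x := 2) (c := 1) (K := 1) (A := A) (k := 1) (by norm_num)
    (by linarith [Real.log_two_lt_d9]) (by norm_num) (by norm_num) (by linarith)
  simpa using this

theorem exp_neg_mul_le {A B a b : ℝ} (ha : Real.exp (-A) ≤ a) (hb : Real.exp (-B) ≤ b) :
    Real.exp (-(A + B)) ≤ a * b := by
  rw [neg_add, Real.exp_add]
  exact mul_le_mul ha hb (Real.exp_pos _).le ((Real.exp_pos _).le.trans ha)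

variable {n f : ℕ} {α β γ δ L E Y W : ℝ}

namespace Rates

theorem log_mul (h : Rates n f α γ δ L E Y W) :
    Real.log (f * n) = Real.log f + Real.log n := by
  have h1 := h.one_le_n
  have h2 := h.one_le_f
  rw [Real.log_mul (by positivity) (by positivity)]

theorem mul_log_le (h : Rates n f α γ δ L E Y W) :
    L / α * Real.log (f * n) ≤ W ∧ E * Y ≤ W ∧ Real.log n / γ ^ 2 * Real.log f ≤ W := by
  have h1 := h.pos
  have h2 := h.le
  have h3 := h.two_le
  have h4 := Real.log_natCast_nonneg n
  have h5 := Real.log_natCast_nonneg f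
  have h6 := h.one_le
  have h7 := h.log_le
  have h8 : 0 ≤ L / α * Real.log (f * n) := by
    rw [h.log_mul]
    have : 0 < α := by linarith
    positivity
  have h9 : 0 ≤ E * Y := mul_nonneg (by linarith) (by linarith)
  have h10 : 0 ≤ Real.log n / γ ^ 2 * Real.log f := by positivity
  rw [h.total]
  exact ⟨by linarith, by linarith, by linarith⟩

theorem two_le_div (h : Rates n f α γ δ L E Y W) : 2 ≤ L / α := by
  have h1 := h.pos
  have h2 := h.le
  have h3 := h.two_le
  have h4 := h.le_one
  rw [le_div_iff₀ (by linarith)]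
  nlinarith

theorem log_le_total (h : Rates n f α γ δ L E Y W) :
    2 * (Real.log f + Real.log n) ≤ W ∧ Y ≤ W ∧ 1 ≤ W := by
  obtain ⟨h1, h2, h3⟩ := h.mul_log_le
  have h4 := Real.log_natCast_nonneg n
  have h5 := Real.log_natCast_nonneg f
  have h6 := h.one_le
  have h7 := h.log_le
  rw [h.log_mul] at h1
  have h8 : Y ≤ W := by nlinarith
  exact ⟨(mul_le_mul_of_nonneg_right h.two_le_div (by linarith)).trans h1, h8, by linarith⟩

/-- There are 25 guesses, the depth and six for each of four ballots, and each costs at most $2W$ on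
the logarithmic scale. -/
theorem exp_neg_le_guess (h : Rates n f α γ δ L E Y W) :
    Real.exp (-(50 * W)) ≤ 1 / (2 * n + 1) * guessProb n ^ 4 := by
  have h1 := Real.log_natCast_nonneg n
  have h2 := Real.log_natCast_nonneg f
  obtain ⟨h3, h4, h5⟩ := h.log_le_total
  have hn : (1 : ℝ) ≤ n := by exact_mod_cast h.one_le_n
  have h6 : Real.log (2 * n + 1) ≤ 3 / 2 + Real.log n := by
    calc Real.log (2 * n + 1) ≤ Real.log (2 ^ 2 * n) := Real.log_le_log (by positivity) (by linarith)
      _ = 2 * Real.log 2 + Real.log n := by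
        rw [Real.log_mul (by norm_num) (by positivity), Real.log_pow]; norm_num
      _ ≤ _ := by linarith [Real.log_two_lt_d9]
  refine (exp_neg_le_one_div_pow (x := 2 * (n : ℝ) + 1) (k := 25) (K := 25) (c := 2 * W) (by positivity) ?_ ?_
    (by norm_num) (by linarith)).trans (le_of_eq ?_)
  · linarith
  · linarith
  · rw [guessProb]; ring

theorem exp_neg_le_facets (h : Rates n f α γ δ L E Y W) : Real.exp (-W) ≤ 1 / (f + 1) := by
  have hf : (1 : ℝ) ≤ f := by exact_mod_cast h.one_le_f
  obtain ⟨h3, h4, h5⟩ := h.log_le_total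
  have h6 : Real.log (f + 1) ≤ Real.log f + 1 := by
    calc Real.log (f + 1) ≤ Real.log (2 * f) := Real.log_le_log (by positivity) (by linarith)
      _ = Real.log 2 + Real.log f := Real.log_mul (by norm_num) (by positivity)
      _ ≤ _ := by linarith [Real.log_two_lt_d9]
  simpa using exp_neg_le_one_div_pow (x := f + 1) (k := 1) (K := 1) (c := W) (A := W)
    (by positivity) (by linarith [h.log_le]) (by linarith) (by norm_num) (by linarith)

end Rates

/-! ### The search for the community, by cases -/

variable {π : MultiAffinity n f} {l : ℕ} {S : Finset (Fin n)} {ρ : Fin n → Fin f} {m : Mem}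

/-- Double counting of the votes inside `S`: each of its members casts at most `l` of them and
receives at least $\alpha|S|$. -/
theorem Supported.mul_card_le (h : Supported π l α β S ρ) : α * S.card ≤ l := by
  have hS : (0 : ℝ) < S.card := by exact_mod_cast h.nonempty.card_pos
  have h1 : ∑ i ∈ S, supportCount π l ρ S i ≤ S.card * l := by
    calc ∑ i ∈ S, supportCount π l ρ S i
        = ∑ s ∈ S, ∑ i ∈ S, if ((π s (ρ s)).symm i).val < l then 1 else 0 := by
          rw [sum_comm]
          exact sum_congr rfl fun i _ => card_filter _ _
      _ ≤ ∑ s ∈ S, l := by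
          refine sum_le_sum fun s _ => ?_
          rw [← card_filter]
          calc _ ≤ (Finset.range l).card := by
                refine card_le_card_of_injOn (fun i => ((π s (ρ s)).symm i).val)
                  (fun i hi => by simpa using (mem_filter.1 hi).2) fun i _ j _ hij => ?_
                exact (π s (ρ s)).symm.injective (Fin.ext hij)
            _ = l := card_range l
      _ = S.card * l := by simp
  have h2 : (S.card : ℝ) * (α * S.card) ≤ S.card * l := by
    calc (S.card : ℝ) * (α * S.card) = ∑ _i ∈ S, α * S.card := by simp
      _ ≤ ∑ i ∈ S, (supportCount π l ρ S i : ℝ) := sum_le_sum h.inside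
      _ ≤ S.card * l := by exact_mod_cast h1
  exact le_of_mul_le_mul_left h2 hS

/-- With a long enough list, the community is found with the claimed probability. -/
theorem Supported.exists_reach_of_lt (h : Supported π l α β S ρ)
    (hr : Rates n f α (α - β) δ L E Y W) (hm : Listed f l α β (∅ : Finset (Fin n)) m)
    (hl : l ≤ n) (hE : n < 385 * E) :
    ∃ p, Real.exp (-(10000 * W)) ≤ 1 / (2 * n + 1) * p ∧
      Reach (inputTable π) mainPart m (4 * ballotTime n + assignTime n f + 4)
        (ENNReal.ofReal p) (Success π l α β S) := by
  have hf : (1 : ℝ) ≤ f := by exact_mod_cast hr.one_le_f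
  have hlf := Real.log_natCast_nonneg f
  have hY := hr.log_le
  obtain ⟨-, hEY, -⟩ := hr.mul_log_le
  have hS : (S.card : ℝ) ≤ n := by exact_mod_cast card_le_of_finset_fin S
  -- Here $n<385E$, so factors of the form $(2f)^{-n}$ and $f^{-|S|}$ are covered by the term $EY$
  -- of $W$.
  refine ⟨_, ?_, reach_mainPart_direct (p := 1 / (2 * f) ^ n) hm hr.one_le_f hl (by positivity)
    (fun m' hm' => h.direct_all hm' hr.one_le_f hr.one_le_n hl)
    (fun m' hm' => h.assign_guess hm' hr.one_le_f hl)⟩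
  have h1 : Real.log (2 * f) ≤ Y := by
    rw [Real.log_mul (by norm_num) (by positivity)]
    linarith [Real.log_two_lt_d9]
  have e1 : Real.exp (-(385 * W)) ≤ 1 / (2 * (f : ℝ)) ^ n := by
    rw [← one_div_pow]
    exact exp_neg_le_one_div_pow (by positivity) h1 (by linarith) hE.le (by linarith)
  have e2 : Real.exp (-(385 * W)) ≤ (1 / (f : ℝ)) ^ S.card :=
    exp_neg_le_one_div_pow (c := Y) (by positivity) (by linarith) (by linarith)
      (hS.trans hE.le) (by linarith)
  have := exp_neg_mul_le hr.exp_neg_le_guess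
    (exp_neg_mul_le e1 (exp_neg_mul_le hr.exp_neg_le_facets e2))
  refine (Real.exp_le_exp.2 ?_).trans (this.trans_eq (by ring))
  linarith [hr.log_le_total.2.2]

/-- Here $|S|\le2/\alpha\le L/\alpha$, so drawing all of `S` with its facets is covered by the first
term of $W$. -/
theorem Supported.exists_reach_of_le (h : Supported π l α β S ρ)
    (hr : Rates n f α (α - β) δ L E Y W) (hm : Listed f l α β (∅ : Finset (Fin n)) m)
    (hl : l ≤ n) (ht : α * S.card ≤ 2) :
    ∃ p, Real.exp (-(10000 * W)) ≤ 1 / (2 * n + 1) * p ∧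
      Reach (inputTable π) mainPart m (4 * ballotTime n + assignTime n f + 4)
        (ENNReal.ofReal p) (Success π l α β S) := by
  have hf : (1 : ℝ) ≤ f := by exact_mod_cast hr.one_le_f
  have hn : (1 : ℝ) ≤ n := by exact_mod_cast hr.one_le_n
  have hlf := Real.log_natCast_nonneg f
  have hln := Real.log_natCast_nonneg n
  have hα : 0 < α := by linarith [hr.pos, h.nonneg]
  obtain ⟨hX, -, -⟩ := hr.mul_log_le
  have hS : (S.card : ℝ) ≤ L / α := by
    rw [le_div_iff₀ hα]; linarith [hr.two_le]
  refine ⟨_, ?_, reach_mainPart_direct (p := 1 / ((n : ℝ) * f) ^ S.card) hm hr.one_le_f hl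
    (by positivity) (fun m' hm' => h.direct_sample hm' hr.one_le_f hl)
    (fun m' hm' => h.assign_guess hm' hr.one_le_f hl)⟩
  have e1 : Real.exp (-W) ≤ 1 / ((n : ℝ) * f) ^ S.card := by
    rw [← one_div_pow, mul_comm (n : ℝ)]
    exact exp_neg_le_one_div_pow (by positivity) le_rfl (by rw [hr.log_mul]; linarith) hS hX
  have e2 : Real.exp (-W) ≤ (1 / (f : ℝ)) ^ S.card :=
    exp_neg_le_one_div_pow (by positivity) (by rw [hr.log_mul]; linarith)
      (by rw [hr.log_mul]; linarith) hS hX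
  have := exp_neg_mul_le hr.exp_neg_le_guess
    (exp_neg_mul_le e1 (exp_neg_mul_le hr.exp_neg_le_facets e2))
  refine (Real.exp_le_exp.2 ?_).trans (this.trans_eq (by ring))
  linarith [hr.log_le_total.2.2]

/-- The sample size $\lceil64\log(2n)/\gamma^2\rceil$ makes the expected number of errors at most
$1/2$, and it is covered by the third term of $W$. If it exceeds $n$, all of `T` votes, which needs
even fewer facets. -/
theorem Supported.exists_reach_final (h : Supported π l α β S ρ)
    (hr : Rates n f α (α - β) δ L E Y W) (hl : l ≤ n) (hn3 : 3 ≤ n) :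
    ∃ p, 0 ≤ p ∧ Real.exp (-(130 * W)) ≤ p ∧
      ∀ T : Finset (Fin n), ((S \ T).card : ℝ) + (T \ S).card ≤ (α - β) / 8 * S.card → ∀ m,
        Listed f l α β T m → Reach (inputTable π) ballot m
        (ballotTime n) (ENNReal.ofReal (guessProb n * p)) (Listed f l α β S) := by
  have hf : (1 : ℝ) ≤ f := by exact_mod_cast hr.one_le_f
  have hn : (3 : ℝ) ≤ n := by exact_mod_cast hn3
  have hγ := hr.pos
  have hγ1 : α - β ≤ 1 := hr.le.trans hr.le_one
  have hγ2 : (α - β) ^ 2 ≤ 1 := by nlinarith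
  have hlf := Real.log_natCast_nonneg f
  have hln : 1 ≤ Real.log n := by
    rw [Real.le_log_iff_exp_le (by linarith)]
    linarith [Real.exp_one_lt_d9]
  obtain ⟨-, -, hN⟩ := hr.mul_log_le
  have hN1 : 1 ≤ Real.log n / (α - β) ^ 2 := by
    rw [le_div_iff₀ (by positivity)]; linarith
  have hl2n : Real.log (2 * n) ≤ 2 * Real.log n := by
    rw [Real.log_mul (by norm_num) (by positivity)]
    linarith [Real.log_two_lt_d9]
  set k := ⌈64 * Real.log (2 * n) / (α - β) ^ 2⌉₊ with hk
  have hk1 : 64 * Real.log (2 * n) / (α - β) ^ 2 ≤ k := Nat.le_ceil _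
  have hk2 : (k : ℝ) ≤ 129 * (Real.log n / (α - β) ^ 2) := by
    have h0 : 0 ≤ Real.log (2 * (n : ℝ)) := Real.log_nonneg (by linarith)
    have h1 : 64 * Real.log (2 * n) / (α - β) ^ 2 ≤ 128 * (Real.log n / (α - β) ^ 2) := by
      rw [← mul_div_assoc]; exact div_le_div_of_nonneg_right (by linarith) (sq_nonneg _)
    have := (Nat.ceil_lt_add_one (a := 64 * Real.log (2 * n) / (α - β) ^ 2) (by positivity)).le
    linarith
  rcases le_or_gt k n with hkn | hkn
  · refine ⟨_, by positivity, ?_, fun T hT m hm => h.final_sample (k := k) hm hr.one_le_f hl hT hkn ?_⟩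
    · refine (Real.exp_le_exp.2 (le_of_eq ?_)).trans
        (exp_neg_mul_le (exp_neg_le_half hr.log_le_total.2.2)
          (exp_neg_le_one_div_pow (by positivity) le_rfl hlf hk2 (A := 129 * W) ?_))
      · ring
      · linarith
    · have h1 : Real.log (2 * n) ≤ k * (α - β) ^ 2 / 64 := by
        rw [div_le_iff₀ (by positivity)] at hk1
        linarith
      calc n * Real.exp (-(k * (α - β) ^ 2 / 64)) ≤ n * Real.exp (-Real.log (2 * n)) := by gcongr
        _ = 1 / 2 := by
          rw [Real.exp_neg, Real.exp_log (by positivity)]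
          field_simp
  · refine ⟨_, by positivity, ?_, fun T hT m hm => h.final_all hm hr.one_le_f hl hT⟩
    refine exp_neg_le_one_div_pow (by positivity) le_rfl hlf
      ((Nat.cast_le.2 hkn.le).trans hk2) ?_
    linarith [hr.log_le_total.2.2]

/-- The greedy phase needs $\gamma^2|S|$ to be at least a multiple of $\log n$. Otherwise guessing
all facets costs only $f^{-O(\log n/\gamma^2)}$, the third term of $W$. -/
theorem Supported.exists_reach_assign (h : Supported π l α β S ρ)
    (hr : Rates n f α (α - β) δ L E Y W) (hl : l ≤ n) (hn3 : 3 ≤ n) :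
    ∃ p, Real.exp (-(8193 * W)) ≤ p ∧
      ∀ m, Listed f l α β S m → Reach (inputTable π) assignAll m (assignTime n f)
        (ENNReal.ofReal p) (Success π l α β S) := by
  have hf : (1 : ℝ) ≤ f := by exact_mod_cast hr.one_le_f
  have hn : (3 : ℝ) ≤ n := by exact_mod_cast hn3
  have hγ := hr.pos
  have hlf := Real.log_natCast_nonneg f
  have hln : 1 ≤ Real.log n := by
    rw [Real.le_log_iff_exp_le (by linarith)]
    linarith [Real.exp_one_lt_d9]
  obtain ⟨-, -, hN⟩ := hr.mul_log_le
  have hW := hr.log_le_total.2.2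
  rcases le_or_gt (2048 * Real.log (4 * (n : ℝ) ^ 2)) ((α - β) ^ 2 * S.card) with hbig | hbig
  · refine ⟨_, ?_, fun m hm => h.assign_greedy hm hr.one_le_f hr.one_le_n hl hbig⟩
    exact (Real.exp_le_exp.2 (by linarith)).trans
      (exp_neg_mul_le hr.exp_neg_le_facets (exp_neg_le_half hW))
  · refine ⟨_, ?_, fun m hm => h.assign_guess hm hr.one_le_f hl⟩
    have h1 : Real.log (4 * (n : ℝ) ^ 2) ≤ 4 * Real.log n := by
      rw [show 4 * (n : ℝ) ^ 2 = (2 * n) ^ 2 by ring, Real.log_pow,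
        Real.log_mul (by norm_num) (by positivity)]
      push_cast
      linarith [Real.log_two_lt_d9]
    have h2 : (S.card : ℝ) ≤ 8192 * (Real.log n / (α - β) ^ 2) := by
      rw [← mul_div_assoc, le_div_iff₀ (by positivity)]
      linarith
    refine (Real.exp_le_exp.2 (le_of_eq ?_)).trans
      (exp_neg_mul_le hr.exp_neg_le_facets
        (exp_neg_le_one_div_pow (by positivity) le_rfl hlf h2 (A := 8192 * W) ?_))
    · ring
    · linarith

/-- The sizes are $k_1\approx L/\alpha$ for the cover and $k_2\approx384E$ for the restriction. The
case $n<385E$ is removed first so that both are at most $n$. -/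
theorem Supported.exists_reach (h : Supported π l α β S ρ)
    (hr : Rates n f α (α - β) δ L E Y W) (hm : Listed f l α β (∅ : Finset (Fin n)) m)
    (hl : l ≤ n) (hδ : (l : ℝ) < δ * S.card + 1) :
    ∃ p, Real.exp (-(10000 * W)) ≤ 1 / (2 * n + 1) * p ∧
      Reach (inputTable π) mainPart m (4 * ballotTime n + assignTime n f + 4)
        (ENNReal.ofReal p) (Success π l α β S) := by
  rcases lt_or_ge (n : ℝ) (385 * E) with hE | hE
  · exact h.exists_reach_of_lt hr hm hl hE
  rcases le_or_gt (α * S.card) 2 with ht | ht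
  · exact h.exists_reach_of_le hr hm hl ht
  have hf : (1 : ℝ) ≤ f := by exact_mod_cast hr.one_le_f
  have hlf := Real.log_natCast_nonneg f
  have hln := Real.log_natCast_nonneg n
  have hγ := hr.pos
  have hα : 0 < α := hγ.trans_le hr.le
  have hδ0 := hr.pos_depth
  have hE1 := hr.one_le
  have hL2 := hr.two_le
  have hLα := hr.two_le_div
  have hYf := hr.log_le
  have hS : (0 : ℝ) < S.card := by exact_mod_cast h.nonempty.card_pos
  obtain ⟨hX, hEY, -⟩ := hr.mul_log_le
  obtain ⟨-, hYW, hW⟩ := hr.log_le_total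
  have hn3 : 3 ≤ n := by
    have : (3 : ℝ) ≤ n := by linarith
    exact_mod_cast this
  -- Since $l\ge\alpha|S|>2$, rounding up the depth costs at most a factor 2.
  have hl2 : (l : ℝ) ≤ 2 * δ * S.card := by
    have := h.mul_card_le
    linarith
  have hl0 : (0 : ℝ) < l := by linarith [h.mul_card_le]
  set k₁ := ⌈L / α⌉₊ with hk₁
  have hk₁1 : L / α ≤ k₁ := Nat.le_ceil _
  have hk₁2 : (k₁ : ℝ) ≤ 2 * (L / α) := by
    have := (Nat.ceil_lt_add_one (a := L / α) (by positivity)).le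
    linarith
  have hk₁0 : (0 : ℝ) < k₁ := by linarith
  -- As $384=6\cdot64$, the Chernoff factor $e^{-k_2\gamma^2/64}$ is at most $D^{-6}$, as required
  -- by `tail_le`.
  set k₂ := ⌈384 * E⌉₊ with hk₂
  have hk₂1 : 384 * E ≤ k₂ := Nat.le_ceil _
  have hk₂2 : (k₂ : ℝ) ≤ 385 * E := by
    have := (Nat.ceil_lt_add_one (a := 384 * E) (by linarith)).le
    linarith
  have hkl : ((k₁ * l : ℕ) : ℝ) ≤ 4 * (δ * L / α) * S.card := by
    rw [Nat.cast_mul]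
    calc (k₁ : ℝ) * l ≤ 2 * (L / α) * (2 * δ * S.card) := by gcongr
      _ = _ := by ring
  obtain ⟨p, hp0, hp, h₁⟩ := h.exists_reach_final hr hl hn3
  obtain ⟨p', hp', h₂⟩ := h.exists_reach_assign hr hl hn3
  refine ⟨_, ?_, h.reach_mainPart hm hr.one_le_f hl (k₁ := k₁) (k₂ := k₂) ?_ ?_ ?_ ?_ ?_ hp0 h₁ h₂⟩
  · have e1 : Real.exp (-(2 * W)) ≤ 1 / ((n : ℝ) * f) ^ k₁ := by
      have hn : (3 : ℝ) ≤ n := by exact_mod_cast hn3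
      rw [← one_div_pow, mul_comm (n : ℝ)]
      exact exp_neg_le_one_div_pow (by positivity) le_rfl (by rw [hr.log_mul]; linarith) hk₁2
        (by linarith)
    have e2 : Real.exp (-(1155 * W)) ≤ (15 * S.card / (16 * (k₁ * l : ℕ) * f)) ^ k₂ := by
      have hB : 0 < (f : ℝ) * δ * L / α := by positivity
      -- Hitting a good voter has probability at least the inverse of $5e^Y$, whose logarithm is at
      -- most $3Y$ because $Y\ge1$.
      have h5 : Real.log (5 * (f * δ * L / α)) ≤ 3 * Y := by
        rw [← hr.exp_eq, Real.log_mul (by norm_num) (Real.exp_pos _).ne', Real.log_exp]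
        have h2 : Real.log 5 ≤ 2 := by
          rw [Real.log_le_iff_le_exp (by norm_num)]
          have : (2.7 : ℝ) ^ 2 ≤ Real.exp 1 ^ 2 := by
            gcongr; linarith [Real.exp_one_gt_d9]
          rw [← Real.exp_nat_mul] at this
          norm_num at this ⊢
          linarith
        linarith
      refine (exp_neg_le_one_div_pow (x := 5 * (f * δ * L / α)) (k := k₂) (by positivity) h5
        (by linarith) hk₂2 (by linarith)).trans ?_
      have hkl0 : (0 : ℝ) < (k₁ * l : ℕ) := by rw [Nat.cast_mul]; positivity
      refine pow_le_pow_left₀ (by positivity) ?_ _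
      rw [div_le_div_iff₀ (by positivity) (by positivity), one_mul]
      calc (16 : ℝ) * (k₁ * l : ℕ) * f ≤ 16 * (4 * (δ * L / α) * S.card) * f := by gcongr
        _ = 64 * (S.card * (f * δ * L / α)) := by ring
        _ ≤ 75 * (S.card * (f * δ * L / α)) := by gcongr; norm_num
        _ = _ := by ring
    have := exp_neg_mul_le hr.exp_neg_le_guess (exp_neg_mul_le
      (exp_neg_mul_le e1 (exp_neg_mul_le (exp_neg_le_half hW) e2)) (exp_neg_mul_le hp hp'))
    refine (Real.exp_le_exp.2 ?_).trans (this.trans_eq (by ring))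
    linarith
  · have : (k₁ : ℝ) ≤ n := by linarith [hr.rounds_le]
    exact_mod_cast this
  · rw [← hr.exp_neg]
    apply Real.exp_le_exp.2
    rw [div_le_iff₀ hα] at hk₁1
    linarith
  · exact_mod_cast hk₂2.trans hE
  · have : (1 : ℝ) ≤ k₂ := by linarith
    exact_mod_cast this
  · have h1 : 6 * ((α - β) ^ 2 * E) ≤ k₂ * (α - β) ^ 2 / 64 := by
      have := mul_le_mul_of_nonneg_right hk₂1 (sq_nonneg (α - β))
      linarith
    calc ((k₁ * l : ℕ) : ℝ) * Real.exp (-(k₂ * (α - β) ^ 2 / 64))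
        ≤ 4 * (δ * L / α) * S.card * Real.exp (-(6 * ((α - β) ^ 2 * E))) := by gcongr
      _ = 4 * (δ * L / α) * Real.exp (-(6 * ((α - β) ^ 2 * E))) * S.card := by ring
      _ ≤ (α - β) / 32 * S.card := by gcongr; exact hr.tail_le
      _ = _ := by ring

/-! ### The initial memory, and the theorem -/

theorem listed_initMem (n f l : ℕ) (α β θ : ℝ) :
    Listed f l α β (∅ : Finset (Fin n)) ((initMem n f α β θ).setN 2 l) := by
  constructor <;> simp [initMem]

/-- Positions are below `n` anyway, so the depth may be capped at `n`; this puts it into the range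
of the first guess. -/
theorem multiVotes_eq_supportCount (π : MultiAffinity n f) (θ : ℝ) (S : Finset (Fin n))
    (ρ : Fin n → Fin f) (i : Fin n) :
    multiVotes π θ S (fun s => ρ s) i = supportCount π (min n ⌈θ * S.card⌉₊) ρ S i := by
  rw [multiVotes, supportCount, card_filter, card_filter,
    sum_coe_sort S (fun s => if ((π s (ρ s)).symm i).val < ⌈θ * (S.card : ℝ)⌉₊ then 1 else 0)]
  simp

end RandRAM

open RandRAM

theorem mainTheorem10 :
    ∃ (P : RandRAM.Prog) (K : ℕ) (C : ℝ), 0 < C ∧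
      ∀ (n f : ℕ), 1 ≤ n → 1 ≤ f →
      ∀ (α β θ : ℝ), 0 ≤ β → β < α → α ≤ 1 → 0 < θ →
      ∀ π : MultiAffinity n f,
        (∀ c ∈ (RandRAM.exec P π α β θ (K * f * n ^ 2)).support, c.1 = []) ∧
        ∀ S : Finset (Fin n),
          (∃ ψ : {x // x ∈ S} → Fin f, IsMultiCommunity π α β θ S ψ) →
          ENNReal.ofReal (successBound C n f α β θ) ≤
            (RandRAM.exec P π α β θ (K * f * n ^ 2)).toOuterMeasure
              {c | ∃ ψ' : {x // x ∈ S} → Fin f, RandRAM.Outputs S ψ' c ∧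
                IsMultiCommunity π (α - (α - β) / 4) (β + (α - β) / 4) θ S ψ'} := by
  refine ⟨communityProg, 600, 10000, by norm_num, fun n f hn hf α β θ hβ hlt hα hθ π =>
    ⟨communityProg_halts hn hf π α β θ, ?_⟩⟩
  rintro S ⟨ψ, hψ⟩
  obtain ⟨L, E, Y, W, hr, hW⟩ := successBound_eq_exp hn hf hβ hlt hα (θ := θ) 10000
  rw [hW]
  set l := min n ⌈θ * S.card⌉₊ with hl
  let ρ : Fin n → Fin f := fun s => if h : s ∈ S then ψ ⟨s, h⟩ else ⟨0, hf⟩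
  have hρ : (fun s : {x // x ∈ S} => ρ s) = ψ := by
    funext s; simp [ρ]
  have hvotes : ∀ i, multiVotes π θ S ψ i = supportCount π l ρ S i := fun i => by
    rw [← hρ, multiVotes_eq_supportCount]
  -- For an empty set the second condition, at any member, would say $0<0$.
  have hS : S.Nonempty := by
    rw [Finset.nonempty_iff_ne_empty]
    rintro rfl
    have := hψ.2 ⟨0, hn⟩ (by simp)
    simp at this
    have h0 : (0 : ℝ) ≤ multiVotes π θ ∅ ψ ⟨0, hn⟩ := Nat.cast_nonneg _
    linarith
  have hsup : Supported π l α β S ρ :=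
    ⟨fun i hi => by rw [← hvotes]; exact hψ.1 i hi, fun i hi => by rw [← hvotes]; exact hψ.2 i hi,
      hS, hβ, hlt, hα⟩
  have hld : (l : ℝ) < max θ α * S.card + 1 := by
    calc (l : ℝ) ≤ ⌈θ * S.card⌉₊ := by exact_mod_cast min_le_right _ _
      _ < θ * S.card + 1 := Nat.ceil_lt_add_one (by positivity)
      _ ≤ _ := by gcongr; exact le_max_left _ _
  obtain ⟨p, hp, hreach⟩ := hsup.exists_reach hr (listed_initMem n f l α β θ) (min_le_left _ _) hld
  have hrun : Reach (inputTable π) communityProg (initMem n f α β θ) (600 * f * n ^ 2)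
      (ENNReal.ofReal (1 / (2 * n + 1) * p)) (Success π l α β S) := by
    refine (Reach.guess_seq (v := 2) (n := n) (x := l) (by simp [initMem])
      ((min_le_left _ _).trans (by omega)) hreach).mono ?_ ?_ fun _ h => h
    · unfold ballotTime assignTime
      have h1 : n ≤ n ^ 2 := by nlinarith
      have h2 : n ^ 2 ≤ f * n ^ 2 := Nat.le_mul_of_pos_left _ hf
      have h3 : f * n ≤ f * n ^ 2 := Nat.mul_le_mul_left f h1
      nlinarith
    · rw [ofReal_inv_nat_succ, ENNReal.ofReal_mul (by positivity)]
      push_cast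
      exact le_rfl
  refine (ENNReal.ofReal_le_ofReal hp).trans (hrun.le_run.trans
    (MeasureTheory.measure_mono ?_))
  rintro c ⟨hc, ρ', hA, hin, hout⟩
  refine ⟨fun s => ρ' s, ⟨hc, hA.1, fun x => hA.2 x x.2⟩, fun i hi => ?_, fun i hi => ?_⟩
  · rw [multiVotes_eq_supportCount]; exact hin i hi
  · rw [multiVotes_eq_supportCount]; exact hout i hi
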